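/- **Model.** Let $\beta_0^0,\beta_1^0\in\mathbb R$ and $(\sigma_u^2)^0,(\sigma_v^2)^0>0$, and let $\nu$ be a probability law on $\mathbb R$ that is not concentrated at one point and satisfies $\int e^{tx}\,\nu(dx)<\infty$ for all $t\in\mathbb R$. For an $m\times n$ array let $X_{ij}\sim\nu$, $U_i\sim N(0,(\sigma_u^2)^0)$, $V_j\sim N(0,(\sigma_v^2)^0)$ $(1\le i\le m,\ 1\le j\le n)$ all be independent. Given all of these, let the responses $Y_{ij}$ be independent and either (Poisson regression) Poisson with mean $\mu_{ij}$, or (Gamma regression) Gamma with known shape $\alpha>0$ and mean $\mu_{ij}$, where $\mu_{ij}=\exp(\beta_0^0+\beta_1^0X_{ij}+U_i+V_j)$. The data are $(X_{ij},Y_{ij})$. **Estimator.** For the linear predictor $\eta$ put $\theta(\eta)=\eta$, $b(\theta)=e^\theta$ in the Poisson case and $\theta(\eta)=-e^{-\eta}$, $b(\theta)=-\log(-\theta)$ in the Gamma case. Let $\Psi^{rc}=(\beta_0^r,\beta_0^c,\beta_1,\sigma_u^2,\sigma_v^2)$ with $\sigma_u^2,\sigma_v^2>0$, and let $\xi$ consist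 of $\mu_{u_i},\mu_{v_j}\in\mathbb R$ and $\lambda_{u_i},\lambda_{v_j}>0$. Fix $\kappa>0$. The Gaussian variational lower bound of the row--column composite log-likelihood (up to terms free of the parameters) is $$\underline{c\ell}(\Psi^{rc},\xi)=\kappa\sum_{i,j}\bigl[Y_{ij}E(\theta^r_{ij})-E\{b(\theta^r_{ij})\}\bigr]+\tfrac12\sum_{i=1}^m\Bigl\{\log\frac{\lambda_{u_i}}{\sigma_u^2}-\frac{\mu_{u_i}^2+\lambda_{u_i}}{\sigma_u^2}\Bigr\}$$ $$\qquad+\kappa\sum_{i,j}\bigl[Y_{ij}E(\theta^c_{ij})-E\{b(\theta^c_{ij})\}\bigr]+\tfrac12\sum_{j=1}^n\Bigl\{\log\frac{\lambda_{v_j}}{\sigma_v^2}-\frac{\mu_{v_j}^2+\lambda_{v_j}}{\sigma_v^2}\Bigr\},$$ where $\theta^r_{ij}=\theta(\beta_0^r+\beta_1X_{ij}+u)$ with the expectation over $u\sim N(\mu_{u_i},\lambda_{u_i})$, and $\theta^c_{ij}=\theta(\beta_0^c+\beta_1X_{ij}+v)$ with the expectation over $v\sim N(\mu_{v_j},\lambda_{v_j})$.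 (The value $\kappa=1$ gives the bound with the dispersion dropped; $\kappa=\alpha$ in the Gamma case is the exact inverse dispersion.) Let $\Theta$ be a fixed set of parameters $\Psi^{rc}$, for instance the whole parameter space or a compact box, which contains a neighbourhood of $\bigl(\beta_0^0+\tfrac12(\sigma_v^2)^0,\ \beta_0^0+\tfrac12(\sigma_u^2)^0,\ \beta_1^0,\ (\sigma_u^2)^0,\ (\sigma_v^2)^0\bigr)$. The estimators $\widehat{\underline\beta}{}_0^r,\widehat{\underline\beta}{}_0^c,\widehat{\underline\beta}_1,\widehat{\underline\sigma}_u^2,\widehat{\underline\sigma}_v^2$ are the $\Psi^{rc}$-components of any global maximizer of $\underline{c\ell}$ over $\Psi^{rc}\in\Theta$ and all $\xi$ (and arbitrary if there is none), and $$\widehat{\underline\beta}_0=\tfrac12\bigl(\widehat{\underline\beta}{}_0^r+\widehat{\underline\beta}{}_0^c\bigr)-\tfrac14\bigl(\widehat{\underline\sigma}_u^2+\widehat{\underline\sigma}_v^2\bigr).$$ **Theorem.** Let $m,n\to\infty$ with $m/n$ bounded away from $0$. Then, for both Poisson and Gamma regression, a global maximizer exists with probability tending to $1$, and each of $$\widehat{\underline\beta}_0-\beta_0^0,\qquad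 \widehat{\underline\beta}_1-\beta_1^0,\qquad \widehat{\underline\sigma}_u^2-(\sigma_u^2)^0,\qquad \widehat{\underline\sigma}_v^2-(\sigma_v^2)^0$$ is $O_p(m^{-1/2}+n^{-1/2})$. -/

import Mathlib

open MeasureTheory ProbabilityTheory Filter Topology

noncomputable section

namespace CrossedGVA

/-- The two response families: Poisson with log link, and Gamma with known shape `α` and log
link. -/
inductive Family where
  | poisson : Family
  | gamma (α : ℝ) : Family

/-- The shape parameter of a Gamma family is positive. -/
def Family.Admissible : Family → Prop
  | .poisson => True
  | .gamma α => 0 < α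

/-- The natural parameter `θ` as a function of the mean `μ`:
`θ = log μ` (Poisson), `θ = -1/μ` (Gamma). -/
def Family.natParam : Family → ℝ → ℝ
  | .poisson, mean => Real.log mean
  | .gamma _, mean => -mean⁻¹

/-- The function `b` of the exponential family, with `b(θ) = exp θ` (Poisson) and
`b(θ) = -log(-θ)`, that is `log μ` (Gamma). -/
def Family.b : Family → ℝ → ℝ
  | .poisson, θ => Real.exp θ
  | .gamma _, θ => -Real.log (-θ)

/-- The natural parameter when the linear predictor is `η`, that is, when `log μ = η`. -/
def Family.theta (fam : Family) (η : ℝ) : ℝ := fam.natParam (Real.exp η)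

/-- The law of a response whose linear predictor is `η`: Poisson with mean `exp η`, or Gamma with
shape `α` and mean `exp η` (hence rate `α / exp η`). -/
def Family.responseLaw : Family → ℝ → Measure ℝ
  | .poisson, η => (poissonMeasure (Real.exp η).toNNReal).map (fun k : ℕ => (k : ℝ))
  | .gamma α, η => gammaMeasure α (α / Real.exp η)

/-- The crossed random effects model for an `m × n` array: the covariates `X i j` are distributed
as `ν`, the row effects `U i` as `N(0, σu2)`, the column effects `V j` as `N(0, σv2)`, all of these
are independent, and, given all of them, the responses `Y i j` are independent with linear
predictors `β0 + β1 * X i j + U i + V j`. -/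
structure IsCrossedSample (fam : Family) (β0 β1 σu2 σv2 : ℝ) (ν : Measure ℝ) {m n : ℕ}
    {Ω : Type*} [MeasurableSpace Ω] (P : Measure Ω)
    (X : Fin m → Fin n → Ω → ℝ) (U : Fin m → Ω → ℝ) (V : Fin n → Ω → ℝ)
    (Y : Fin m → Fin n → Ω → ℝ) : Prop where
  measurable_X : ∀ i j, Measurable (X i j)
  measurable_U : ∀ i, Measurable (U i)
  measurable_V : ∀ j, Measurable (V j)
  measurable_Y : ∀ i j, Measurable (Y i j)
  /-- The joint law of covariates and random effects is the product law. -/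
  latent_law :
    P.map (fun ω => ((fun i j => X i j ω, fun i => U i ω, fun j => V j ω) :
        (Fin m → Fin n → ℝ) × (Fin m → ℝ) × (Fin n → ℝ))) =
      (Measure.pi fun _ : Fin m => Measure.pi fun _ : Fin n => ν).prod
        ((Measure.pi fun _ : Fin m => gaussianReal 0 σu2.toNNReal).prod
          (Measure.pi fun _ : Fin n => gaussianReal 0 σv2.toNNReal))
  /-- The conditional law of the responses given covariates and random effects is the product of
  the response laws, written out on measurable rectangles. -/
  response_law : ∀ A : Set ((Fin m → Fin n → ℝ) × (Fin m → ℝ) × (Fin n → ℝ)), MeasurableSet A →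
    ∀ B : Fin m → Fin n → Set ℝ, (∀ i j, MeasurableSet (B i j)) →
      P {ω | ((fun i j => X i j ω, fun i => U i ω, fun j => V j ω) ∈ A) ∧ ∀ i j, Y i j ω ∈ B i j} =
        ∫⁻ ω in {ω | (fun i j => X i j ω, fun i => U i ω, fun j => V j ω) ∈ A},
          ∏ i, ∏ j, fam.responseLaw (β0 + β1 * X i j ω + U i ω + V j ω) (B i j) ∂P

/-- The model parameter `Ψ^{rc}` of the row-column composite likelihood: the two intercepts, the
common slope and the two variances. -/
structure RowColParam where
  β0r : ℝ
  β0c : ℝ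
  β1 : ℝ
  σu2 : ℝ
  σv2 : ℝ

/-- The variational parameter `ξ`: means and variances of the Gaussian variational laws of the row
effects and of the column effects. -/
structure VarParam (m n : ℕ) where
  meanU : Fin m → ℝ
  varU : Fin m → ℝ
  meanV : Fin n → ℝ
  varV : Fin n → ℝ

/-- The expectation of `g` under the Gaussian law with mean `a` and variance `s`. -/
def gaussExp (a s : ℝ) (g : ℝ → ℝ) : ℝ := ∫ u, g u ∂(gaussianReal a s.toNNReal)

/-- The Gaussian variational lower bound of the row-composite log-likelihood, up to terms that do
not depend on the parameters:
`κ ∑ᵢⱼ [Yᵢⱼ E(θᵢⱼ) - E(b(θᵢⱼ))] + (1/2) ∑ᵢ {log (lᵢ/σ²) - (aᵢ² + lᵢ)/σ²}`,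
where `θᵢⱼ` belongs to the linear predictor `β0 + β1 xᵢⱼ + u` with `u ~ N(aᵢ, lᵢ)`.
The factor `κ` stands for the inverse dispersion. -/
def rowBound (fam : Family) (κ : ℝ) {m n : ℕ} (x y : Fin m → Fin n → ℝ)
    (β0 β1 σ2 : ℝ) (a l : Fin m → ℝ) : ℝ :=
  κ * ∑ i, ∑ j,
      (y i j * gaussExp (a i) (l i) (fun u => fam.theta (β0 + β1 * x i j + u))
        - gaussExp (a i) (l i) (fun u => fam.b (fam.theta (β0 + β1 * x i j + u))))
    + (1 / 2) * ∑ i, (Real.log (l i / σ2) - ((a i) ^ 2 + l i) / σ2)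

/-- The Gaussian variational lower bound of the row-column composite log-likelihood: the bound for
the rows plus the bound for the columns (the row bound of the transposed array). -/
def rowColBound (fam : Family) (κ : ℝ) {m n : ℕ} (x y : Fin m → Fin n → ℝ)
    (p : RowColParam × VarParam m n) : ℝ :=
  rowBound fam κ x y p.1.β0r p.1.β1 p.1.σu2 p.2.meanU p.2.varU
    + rowBound fam κ (fun j i => x i j) (fun j i => y i j)
        p.1.β0c p.1.β1 p.1.σv2 p.2.meanV p.2.varV

/-- The pairs `(Ψ^{rc}, ξ)` over which the bound is maximized: `Ψ^{rc}` lies in the parameter set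
`Θ`, and all variances are positive. -/
def feasible (Θ : Set RowColParam) (m n : ℕ) : Set (RowColParam × VarParam m n) :=
  {p | p.1 ∈ Θ ∧ 0 < p.1.σu2 ∧ 0 < p.1.σv2 ∧ (∀ i, 0 < p.2.varU i) ∧ ∀ j, 0 < p.2.varV j}

/-- `p = (Ψ^{rc}, ξ)` is a global maximizer of the variational lower bound for the data `x, y`. -/
def IsMaximizer (fam : Family) (κ : ℝ) (Θ : Set RowColParam) {m n : ℕ} (x y : Fin m → Fin n → ℝ)
    (p : RowColParam × VarParam m n) : Prop :=
  p ∈ feasible Θ m n ∧ IsMaxOn (rowColBound fam κ x y) (feasible Θ m n) p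

/-- The intercept `β0` recovered from `β0r = β0 + σv2 / 2` and `β0c = β0 + σu2 / 2`. -/
def RowColParam.β0 (ψ : RowColParam) : ℝ := (ψ.β0r + ψ.β0c) / 2 - (ψ.σu2 + ψ.σv2) / 4

/-- `Θ` contains a neighbourhood of the parameter `ψ`. -/
def ContainsNhd (Θ : Set RowColParam) (ψ : RowColParam) : Prop :=
  ∃ δ > 0, ∀ ψ' : RowColParam, |ψ'.β0r - ψ.β0r| < δ → |ψ'.β0c - ψ.β0c| < δ → |ψ'.β1 - ψ.β1| < δ →
    |ψ'.σu2 - ψ.σu2| < δ → |ψ'.σv2 - ψ.σv2| < δ → ψ' ∈ Θ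

/-- `Z k = O_p(r k)` as `k → ∞`; no measurability of `Z k` is asked for, `P k` being applied as an
outer measure. -/
def IsBigOP {Ω : ℕ → Type*} [∀ k, MeasurableSpace (Ω k)] (P : ∀ k, Measure (Ω k))
    (Z : ∀ k, Ω k → ℝ) (r : ℕ → ℝ) : Prop :=
  ∀ ε : ℝ, 0 < ε → ∃ M : ℝ, ∀ᶠ k in atTop, P k {ω | M * r k < |Z k ω|} ≤ ENNReal.ofReal ε

end CrossedGVA

end

namespace CrossedGVA

/-! The bound is the sum of a row half and a column half which share only the slope. In the row half
let `ζ` be the error of the intercept, `b` that of the slope (up to a sign), and `t i` the error of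
the fitted level of row `i` against its true level (up to the same sign). The likelihood part then
depends on `t`, `b` and the variational variances `l` alone, while `ζ` and the variance parameter
occur only in the prior part `reg`, as the mean and variance of a Gaussian law fitted to the numbers
`U i ± t i`. So intercept and variance are found as well as a Gaussian can be fitted to the true
effects, once `t` and `l` are small on average (`rowExplicit_eq`, `gaussian_profile_growth`).

The row half ignores the column effects, yet it is centered correctly. Given `U i`, the cells of one
row are i.i.d., each having its own column effect, and integrating that effect out multiplies the
mean by the lognormal factor `exp (σv2 / 2)`. The score is therefore unbiased at the intercept `β0 +
σv2 / 2` (`integral_score`). Curvature in `(t, b)` comes from the convexity of `exp` and from two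
disjoint compact intervals charged by the covariate law: on one of them `|t + b x|` is of the order
of `max |t| |b|` (`exists_affine_lower`, `exists_two_intervals`).

Each row, with `N` cells, gets a remainder `R` of bounded expectation built from eighth powers of
normalized centered sums. If `R ≤ c N ^ 4`, the gain of the row over the truth is at most `C R`
minus `c N exp (-|U|) (mq (max |t| |b|) + l)` (`exists_fitControl`). Otherwise the gain is at most
of the order `N √R`, and that is `O(R / N)`, so the bad rows together cost only `O(M / N)`.
Expectations add over rows and Markov's inequality suffices, so it does not matter that different
rows share the column effects and are dependent (`exists_sideControl`).

On data controlled in this way the rate is deterministic (`exists_rate`). Comparison with the truth,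
first crudely and then with the `log N` of the reference variance removed, shows that the mean
squared size of the deviations and the squared slope error are `O(r ^ 2)` for `r = 1 / √m + 1 / √n`.
Next the point is compared with the one that keeps slope, deviations and variational variances on
the tame rows but has the true intercept and variance. There the likelihood parts cancel exactly,
only the Gaussian fit remains, and its quadratic growth gives the rate for `ζ` and the variance.
Comparing prior parts alone is essential: they are smaller than the likelihood parts by a factor of
order `N`, and would be lost in the likelihood errors. The ratio `m / n` enters in this step for the
rows, where the column gain, of order `n r ^ 2`, has to be absorbed by `m r ^ 2`.

The argument uses only that a point dominates a small box around the limit. This also yields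
existence (`exists_maximizer_rate`): the bound attains its maximum on the box by coercivity, and any
point beating that maximum would dominate the box, hence be close to the limit, hence lie in the
box. -/

/-! ### Elementary inequalities: exponential excess, affine functions, Gaussian divergence -/

/-- The function `min (r ^ 2) r`, quadratic near zero and linear at infinity. -/
noncomputable def mq (r : ℝ) : ℝ := min (r ^ 2) r

lemma mq_nonneg {r : ℝ} (hr : 0 ≤ r) : 0 ≤ mq r := le_min (sq_nonneg r) hr

lemma mq_of_le_one {r : ℝ} (h0 : 0 ≤ r) (h1 : r ≤ 1) : mq r = r ^ 2 :=
  min_eq_left (by nlinarith)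

lemma mq_of_one_le {r : ℝ} (h1 : 1 ≤ r) : mq r = r :=
  min_eq_right (by nlinarith)

lemma mq_mono {a b : ℝ} (ha : 0 ≤ a) (hab : a ≤ b) : mq a ≤ mq b :=
  min_le_min (pow_le_pow_left₀ ha hab 2) hab

lemma mq_mul {c r : ℝ} (hc0 : 0 ≤ c) (hc1 : c ≤ 1) (hr : 0 ≤ r) : c ^ 2 * mq r ≤ mq (c * r) := by
  refine le_min ?_ ?_
  · rw [mul_pow]
    exact mul_le_mul_of_nonneg_left (min_le_left _ _) (sq_nonneg c)
  · have h1 : c ^ 2 ≤ c := by nlinarith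
    exact mul_le_mul h1 (min_le_right _ _) (mq_nonneg hr) hc0

/-- The excess `exp t - 1 - t` of the exponential over its tangent at zero. -/
noncomputable def expExcess (t : ℝ) : ℝ := Real.exp t - 1 - t

lemma expExcess_nonneg (t : ℝ) : 0 ≤ expExcess t := by
  unfold expExcess; linarith [Real.add_one_le_exp t]

/-- As `t → -∞` the excess grows only linearly, which is why the curvature is measured by `mq` and
not by a square. On `[-1, 0]` the bound comes from inverting a Taylor upper bound for `exp (-t)`,
below `-1` from the tangent at `-1`. -/
lemma mq_le_expExcess (t : ℝ) : mq |t| / 4 ≤ expExcess t := by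
  unfold expExcess
  rcases le_total 0 t with h | h
  · have h1 := Real.quadratic_le_exp_of_nonneg h
    have h2 : mq |t| ≤ t ^ 2 := by rw [← sq_abs]; exact min_le_left _ _
    nlinarith [sq_nonneg t]
  · rw [abs_of_nonpos h]
    rcases le_total (-t) 1 with h1 | h1
    · rw [mq_of_le_one (by linarith) h1]
      have h3 := Real.exp_bound' (x := -t) (by linarith) h1 (n := 2) (by norm_num)
      simp [Finset.sum_range_succ] at h3
      norm_num at h3
      have h4 : Real.exp t * Real.exp (-t) = 1 := by rw [← Real.exp_add]; simp
      set s := -t with hs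
      have ht : t = -s := by linarith
      have hs0 : 0 ≤ s := by linarith
      have hpos := Real.exp_pos t
      have h5 : 1 ≤ Real.exp t * (1 + s + s ^ 2 * 3 / 4) := by
        calc (1:ℝ) = Real.exp t * Real.exp s := h4.symm
          _ ≤ _ := by
            apply mul_le_mul_of_nonneg_left _ hpos.le
            linarith
      have h6 : (1 - s + s ^ 2 / 4) * (1 + s + s ^ 2 * 3 / 4) ≤ 1 := by
        nlinarith [mul_nonneg hs0 hs0, pow_nonneg hs0 3, pow_nonneg hs0 4,
          mul_nonneg (mul_nonneg hs0 hs0) (sub_nonneg.2 h1),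
          mul_nonneg (pow_nonneg hs0 3) (sub_nonneg.2 h1)]
      have h7 : 1 - s + s ^ 2 / 4 ≤ Real.exp t := by
        by_contra hcon
        push Not at hcon
        have : 0 < 1 + s + s ^ 2 * 3 / 4 := by positivity
        nlinarith
      nlinarith
    · rw [mq_of_one_le h1]
      have h2 : Real.exp (-1) * (t + 1 + 1) ≤ Real.exp t := by
        have : Real.exp t = Real.exp (-1) * Real.exp (t + 1) := by
          rw [← Real.exp_add]; congr 1; ring
        rw [this]
        exact mul_le_mul_of_nonneg_left (Real.add_one_le_exp _) (Real.exp_pos _).le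
      have h3 : 1 / 3 ≤ Real.exp (-1) := by
        rw [Real.exp_neg]
        rw [one_div]
        exact inv_anti₀ (Real.exp_pos 1) (by linarith [Real.exp_one_lt_d9])
      have h4 : Real.exp (-1) ≤ 1 / 2 := by
        rw [Real.exp_neg, one_div]
        exact inv_anti₀ (by norm_num) (by linarith [Real.exp_one_gt_d9])
      rcases le_total 0 (t + 1 + 1) with h5 | h5
      · nlinarith
      · nlinarith

/-- On one of two disjoint compact intervals an affine function is bounded below by its
coefficients. -/
lemma exists_affine_lower (a₁ b₁ a₂ b₂ : ℝ) (h : b₁ < a₂) :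
    ∃ c : ℝ, 0 < c ∧ c ≤ 1 ∧ ∀ t b : ℝ,
      (∀ x ∈ Set.Icc a₁ b₁, c * max |t| |b| ≤ |t + b * x|) ∨
      (∀ x ∈ Set.Icc a₂ b₂, c * max |t| |b| ≤ |t + b * x|) := by
  set r : ℝ := 1 + |a₁| + |b₁| + |a₂| + |b₂| + (a₂ - b₁) with hr
  have hr1 : 1 ≤ r := by
    have := abs_nonneg a₁; have := abs_nonneg b₁; have := abs_nonneg a₂; have := abs_nonneg b₂
    linarith
  have hr0 : 0 < r := by linarith
  have hx : ∀ x, x ∈ Set.Icc a₁ b₁ ∨ x ∈ Set.Icc a₂ b₂ → |x| ≤ r := by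
    intro x hx
    have := abs_nonneg a₁; have := abs_nonneg b₁; have := abs_nonneg a₂; have := abs_nonneg b₂
    rcases hx with hx | hx
    · have := abs_le_max_abs_abs hx.1 hx.2
      have := max_le_add_of_nonneg (abs_nonneg a₁) (abs_nonneg b₁)
      linarith
    · have := abs_le_max_abs_abs hx.1 hx.2
      have := max_le_add_of_nonneg (abs_nonneg a₂) (abs_nonneg b₂)
      linarith
  set c : ℝ := (a₂ - b₁) / (4 * r) with hc
  have hcpos : 0 < c := by apply div_pos <;> linarith
  have hc4 : c ≤ 1 / 4 := by
    rw [hc, div_le_div_iff₀ (by linarith) (by norm_num)]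
    have := abs_nonneg a₁; have := abs_nonneg b₁; have := abs_nonneg a₂; have := abs_nonneg b₂
    linarith
  refine ⟨c, hcpos, by linarith, fun t b => ?_⟩
  set ρ := max |t| |b| with hρ
  have hρ0 : 0 ≤ ρ := le_max_of_le_left (abs_nonneg t)
  -- If the slope is small against `ρ`, the level is `ρ` in absolute value and dominates wherever
  -- `|x| ≤ r`. Otherwise the slope is at least `ρ / (2 r)`, and an affine function with that slope
  -- cannot be small at two points which are `a₂ - b₁` apart.
  by_cases hb : |b| * (2 * r) < ρ
  · left
    intro x hx1
    have h1 : |b| < ρ := by nlinarith [abs_nonneg b]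
    have h2 : ρ = |t| := by
      rcases max_choice |t| |b| with h | h
      · exact h
      · rw [hρ, h] at h1; exact absurd h1 (lt_irrefl _)
    have h3 : |t| - |b * x| ≤ |t + b * x| := by
      have := abs_sub_abs_le_abs_sub t (-(b * x))
      rwa [abs_neg, sub_neg_eq_add] at this
    have h4 : |b * x| ≤ |b| * r := by
      rw [abs_mul]; exact mul_le_mul_of_nonneg_left (hx x (Or.inl hx1)) (abs_nonneg b)
    nlinarith
  · push Not at hb
    have hb' : c * ρ ≤ |b| * ((a₂ - b₁) / 2) := by
      have : c * ρ ≤ c * (|b| * (2 * r)) := mul_le_mul_of_nonneg_left hb hcpos.le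
      refine this.trans_eq ?_
      rw [hc]; field_simp; ring
    have key : ∀ x y : ℝ, a₂ - b₁ ≤ y - x → |b| * (a₂ - b₁) ≤ |t + b * x| + |t + b * y| := by
      intro x y hxy
      have h1 : |b * (y - x)| ≤ |t + b * x| + |t + b * y| := by
        have := abs_sub (t + b * y) (t + b * x)
        have e : t + b * y - (t + b * x) = b * (y - x) := by ring
        rw [e] at this; linarith
      rw [abs_mul] at h1
      have : |b| * (a₂ - b₁) ≤ |b| * |y - x| :=
        mul_le_mul_of_nonneg_left (hxy.trans (le_abs_self _)) (abs_nonneg b)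
      linarith
    by_contra hcon
    push Not at hcon
    obtain ⟨⟨x, hx1, hx2⟩, ⟨y, hy1, hy2⟩⟩ := hcon
    have := key x y (by linarith [hx1.2, hy1.1])
    linarith

lemma sub_one_sub_log_le {x : ℝ} (hx : 1 / 2 ≤ x) : x - 1 - Real.log x ≤ 2 * (x - 1) ^ 2 := by
  have h0 : 0 < x := by linarith
  have h1 := Real.one_sub_inv_le_log_of_pos h0
  have h2 : x - 1 - (1 - x⁻¹) = (x - 1) ^ 2 / x := by
    rw [eq_div_iff h0.ne', sub_mul, sub_mul, sub_mul, inv_mul_cancel₀ h0.ne']; ring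
  have h3 : (x - 1) ^ 2 / x ≤ 2 * (x - 1) ^ 2 := by
    rw [div_le_iff₀ h0]; nlinarith [sq_nonneg (x - 1)]
  linarith

/-- This is `log √x ≤ √x - 1`. The Hellinger form holds for all `x > 0`, so the fitted variance
needs no a priori bounds. -/
lemma sqrt_sub_one_sq_le {x : ℝ} (hx : 0 < x) : (√x - 1) ^ 2 ≤ x - 1 - Real.log x := by
  have h1 : Real.log x = 2 * Real.log √x := by rw [Real.log_sqrt hx.le]; ring
  have h2 := Real.log_le_sub_one_of_pos (Real.sqrt_pos.2 hx)
  have h3 := Real.sq_sqrt hx.le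
  nlinarith

/-- The divergence between two Gaussian laws controls the distance of their parameters. -/
lemma param_close {v s μ ζ h : ℝ} (hv : 0 < v) (hs : 0 < s) (h1 : h ≤ 1 / 4)
    (hle : v / s - 1 - Real.log (v / s) + (ζ - μ) ^ 2 / s ≤ h) :
    |s - v| ≤ 10 * v * √h ∧ (ζ - μ) ^ 2 ≤ 4 * v * h := by
  have hx : 0 < v / s := div_pos hv hs
  have hA := sqrt_sub_one_sq_le hx
  have hB : 0 ≤ (ζ - μ) ^ 2 / s := by positivity
  have hA0 : 0 ≤ v / s - 1 - Real.log (v / s) := (sq_nonneg _).trans hA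
  have h2 : |√(v / s) - 1| ≤ √h := by
    apply Real.abs_le_sqrt; linarith
  have h3 : √h ≤ 1 / 2 := by
    rw [Real.sqrt_le_left (by norm_num)]; norm_num; linarith
  have hsq := Real.sq_sqrt hx.le
  have h4 := abs_le.1 h2
  -- From `√(v / s) ≥ 1 / 2`; this makes the hitherto unbounded `s` at most `4 v`.
  have h5 : 1 / 4 ≤ v / s := by
    rw [← hsq]; nlinarith
  have h6 : s ≤ 4 * v := by
    rw [le_div_iff₀ hs] at h5; linarith
  refine ⟨?_, ?_⟩
  · have h7 : |v / s - 1| ≤ 5 / 2 * √h := by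
      have : v / s - 1 = (√(v / s) - 1) * (√(v / s) + 1) := by nlinarith
      rw [this, abs_mul]
      have h8 : |√(v / s) + 1| ≤ 5 / 2 := by
        rw [abs_of_nonneg (by positivity)]; linarith
      calc _ ≤ √h * (5 / 2) := mul_le_mul h2 h8 (abs_nonneg _) (Real.sqrt_nonneg _)
        _ = _ := by ring
    have h8 : |s - v| = s * |v / s - 1| := by
      rw [abs_sub_comm, ← abs_of_pos hs, ← abs_mul, abs_of_pos hs]
      congr 1; field_simp
    rw [h8]
    calc s * |v / s - 1| ≤ (4 * v) * (5 / 2 * √h) :=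
          mul_le_mul h6 h7 (abs_nonneg _) (by positivity)
      _ = _ := by ring
  · have : (ζ - μ) ^ 2 / s ≤ h := by linarith
    rw [div_le_iff₀ hs] at this
    nlinarith

lemma _root_.Real.sqrt_add_le_sqrt_add_sqrt (a b : ℝ) : √(a + b) ≤ √a + √b := by
  rcases le_total a 0 with ha | ha
  · rw [Real.sqrt_eq_zero_of_nonpos ha, zero_add]; exact Real.sqrt_le_sqrt (by linarith)
  rcases le_total b 0 with hb | hb
  · rw [Real.sqrt_eq_zero_of_nonpos hb, add_zero]; exact Real.sqrt_le_sqrt (by linarith)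
  rw [Real.sqrt_le_left (by positivity), add_sq, Real.sq_sqrt ha, Real.sq_sqrt hb]
  have : 0 ≤ √a * √b := by positivity
  linarith

lemma sqrt_half_mul_sq_add_le {c e ε : ℝ} (hc : 0 ≤ c) (he : 0 ≤ e) :
    √(c / 2 * e ^ 2 + 2 * ε) ≤ (√c + 2) * (e + √ε) := by
  have h1 : √(c / 2 * e ^ 2 + 2 * ε) ≤ √(c / 2 * e ^ 2) + √(2 * ε) :=
    Real.sqrt_add_le_sqrt_add_sqrt _ _
  have h2 : √(c / 2 * e ^ 2) ≤ √c * e := by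
    rw [Real.sqrt_mul' _ (sq_nonneg e), Real.sqrt_sq he]
    exact mul_le_mul_of_nonneg_right (Real.sqrt_le_sqrt (by linarith)) he
  have h3 : √(2 * ε) ≤ 2 * √ε := by
    rw [Real.sqrt_mul (by norm_num)]
    refine mul_le_mul_of_nonneg_right ?_ (Real.sqrt_nonneg ε)
    rw [Real.sqrt_le_left (by norm_num)]; norm_num
  have h4 : 0 ≤ √c * √ε := by positivity
  linarith

/-- The contribution of the random-effects part of the bound: `(log (l / s) - ((y - ζ)² + l) / s) / 2`. -/
noncomputable def reg (ζ s y l : ℝ) : ℝ := 1 / 2 * (Real.log (l / s) - ((y - ζ) ^ 2 + l) / s)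

lemma reg_nonpos {ζ s y l : ℝ} (hs : 0 < s) (hl : 0 < l) : reg ζ s y l ≤ 0 := by
  unfold reg
  have h1 := Real.log_le_sub_one_of_pos (div_pos hl hs)
  have h2 : ((y - ζ) ^ 2 + l) / s = (y - ζ) ^ 2 / s + l / s := by ring
  have h3 : 0 ≤ (y - ζ) ^ 2 / s := by positivity
  rw [h2]; linarith

set_option maxHeartbeats 400000 in
/-- Quadratic growth of the averaged random-effects part around the true parameters, in terms of
the moments of the latent effects. -/
lemma gaussian_profile_growth {σ : ℝ} (hσ : 0 < σ) :
    ∃ C e₀ : ℝ, 0 < C ∧ 0 < e₀ ∧ ∀ T0 T1 T2 ζ s e : ℝ, 0 < s → 0 ≤ e → e ≤ e₀ →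
      |T0 - 1| ≤ e → |T1| ≤ e → |T2 - σ| ≤ e →
      (T0 * Real.log (σ / s) - (T2 - 2 * ζ * T1 + ζ ^ 2 * T0) / s + T2 / σ ≤ C * e ^ 2) ∧
      ∀ ε : ℝ, 0 ≤ ε → ε ≤ e₀ →
        -ε ≤ T0 * Real.log (σ / s) - (T2 - 2 * ζ * T1 + ζ ^ 2 * T0) / s + T2 / σ →
        |ζ| ≤ C * (e + √ε) ∧ |s - σ| ≤ C * (e + √ε) := by
  -- `k` bounds the relative deviation of the empirical variance
  set k : ℝ := 2 + 2 * σ + 4 with hk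
  set c₁ : ℝ := 2 * (2 * (k / σ) ^ 2 + 4 / σ) with hc1
  set C : ℝ := c₁ + k + 20 * σ * (2 * (√c₁ + 2)) + 2 + 4 * (σ + 1) * (√c₁ + 2) with hC
  have hk0 : 0 < k := by positivity
  have hc10 : 0 < c₁ := by positivity
  have hsc : 0 ≤ √c₁ := Real.sqrt_nonneg _
  -- The three caps yield, in turn, `T0 ≥ 1 / 2`, an empirical variance comparable with `σ`, and `h
  -- ≤ 1 / 4` as `param_close` demands.
  set e₀ : ℝ := min (min (1 / 2) (σ / (2 * k))) (1 / (8 * (c₁ + 2))) with he0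
  have he0pos : 0 < e₀ := by positivity
  refine ⟨C, e₀, by positivity, he0pos, ?_⟩
  intro T0 T1 T2 ζ s e hs he hee hT0 hT1 hT2
  have he1 : e ≤ 1 / 2 := hee.trans ((min_le_left _ _).trans (min_le_left _ _))
  have he2 : e ≤ σ / (2 * k) := hee.trans ((min_le_left _ _).trans (min_le_right _ _))
  have he3 : e ≤ 1 / (8 * (c₁ + 2)) := hee.trans (min_le_right _ _)
  have hT0' := abs_le.1 hT0
  have hT0h : 1 / 2 ≤ T0 := by linarith
  have hT0p : 0 < T0 := by linarith
  set μ := T1 / T0 with hμ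
  set v := T2 / T0 - μ ^ 2 with hv
  have hμe : |μ| ≤ 2 * e := by
    rw [hμ, abs_div, abs_of_pos hT0p, div_le_iff₀ hT0p]; nlinarith
  have hμ2 : μ ^ 2 ≤ 4 * e ^ 2 := by
    rw [← sq_abs]; nlinarith [abs_nonneg μ]
  have hvσ : |v - σ| ≤ k * e := by
    have h1 : |T2 / T0 - σ| ≤ (2 + 2 * σ) * e := by
      have : T2 / T0 - σ = ((T2 - σ) - σ * (T0 - 1)) / T0 := by field_simp; ring
      rw [this, abs_div, abs_of_pos hT0p, div_le_iff₀ hT0p]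
      have h3 : |T2 - σ - σ * (T0 - 1)| ≤ e + σ * e := by
        refine (abs_sub _ _).trans (add_le_add hT2 ?_)
        rw [abs_mul, abs_of_pos hσ]
        exact mul_le_mul_of_nonneg_left hT0 hσ.le
      have h4 : 0 ≤ (1 + σ) * e := by positivity
      have h5 : (2 + 2 * σ) * e * (1 / 2) ≤ (2 + 2 * σ) * e * T0 :=
        mul_le_mul_of_nonneg_left hT0h (by positivity)
      linarith
    have h2 : v - σ = (T2 / T0 - σ) - μ ^ 2 := by rw [hv]; ring
    rw [h2]
    refine (abs_sub _ _).trans ?_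
    rw [abs_of_nonneg (sq_nonneg μ)]
    nlinarith
  have hkσ : k * e ≤ σ / 2 := by
    have : k * (σ / (2 * k)) = σ / 2 := by field_simp
    nlinarith
  have hvlo : σ / 2 ≤ v := by have := abs_le.1 hvσ; linarith
  have hvhi : v ≤ 2 * σ := by have := abs_le.1 hvσ; linarith
  have hv0 : 0 < v := by linarith
  -- Up to the factor `T0`, the gain is the (doubled) Kullback–Leibler divergence of the empirical
  -- Gaussian `N(μ, v)` from the truth minus its divergence from `N(ζ, s)`. The first is `O(e ^ 2)`
  -- and the second is nonnegative, hence the upper bound. A gain above `-ε` makes the second `O(e ^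
  -- 2 + ε)`, and `param_close` inverts this.
  have hid : T0 * Real.log (σ / s) - (T2 - 2 * ζ * T1 + ζ ^ 2 * T0) / s + T2 / σ
      = T0 * ((v / σ - 1 - Real.log (v / σ)) + μ ^ 2 / σ
        - (v / s - 1 - Real.log (v / s) + (ζ - μ) ^ 2 / s)) := by
    have hT1 : T1 = μ * T0 := by rw [hμ]; field_simp
    have hT2 : T2 = (v + μ ^ 2) * T0 := by rw [hv]; field_simp; ring
    rw [hT1, hT2, Real.log_div hσ.ne' hs.ne', Real.log_div hv0.ne' hσ.ne',
      Real.log_div hv0.ne' hs.ne']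
    field_simp
    ring
  have hup : (v / σ - 1 - Real.log (v / σ)) + μ ^ 2 / σ ≤ c₁ / 2 * e ^ 2 := by
    have h1 : 1 / 2 ≤ v / σ := by rw [le_div_iff₀ hσ]; linarith
    have h2 := sub_one_sub_log_le h1
    have h3 : (v / σ - 1) ^ 2 ≤ (k / σ) ^ 2 * e ^ 2 := by
      have : v / σ - 1 = (v - σ) / σ := by field_simp
      rw [this, div_pow, div_pow, div_mul_eq_mul_div]
      apply div_le_div_of_nonneg_right _ (by positivity)
      rw [← sq_abs, ← mul_pow]
      exact pow_le_pow_left₀ (abs_nonneg _) hvσ 2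
    have h4 : μ ^ 2 / σ ≤ 4 / σ * e ^ 2 := by
      rw [div_mul_eq_mul_div]
      exact div_le_div_of_nonneg_right hμ2 hσ.le
    rw [hc1]; linarith
  have hdn : 0 ≤ v / s - 1 - Real.log (v / s) + (ζ - μ) ^ 2 / s := by
    have := sqrt_sub_one_sq_le (div_pos hv0 hs)
    have h1 : 0 ≤ (ζ - μ) ^ 2 / s := by positivity
    nlinarith [sq_nonneg (√(v / s) - 1)]
  have hT0u : T0 ≤ 2 := by linarith
  rw [hid]
  refine ⟨?_, ?_⟩
  · have h1 : c₁ * e ^ 2 ≤ C * e ^ 2 := by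
      apply mul_le_mul_of_nonneg_right _ (sq_nonneg e)
      rw [hC]; have : 0 ≤ 20 * σ * (2 * (√c₁ + 2)) := by positivity
      have : 0 ≤ 4 * (σ + 1) * (√c₁ + 2) := by positivity
      linarith
    have h2 : 0 ≤ c₁ / 2 * e ^ 2 := by positivity
    nlinarith
  · intro ε hε hεe hge
    have hε3 : ε ≤ 1 / (8 * (c₁ + 2)) := hεe.trans (min_le_right _ _)
    set h := c₁ / 2 * e ^ 2 + 2 * ε with hh
    have hh0 : 0 ≤ h := by positivity
    have hle : v / s - 1 - Real.log (v / s) + (ζ - μ) ^ 2 / s ≤ h := by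
      by_contra hcon
      push Not at hcon
      have h1 : (v / σ - 1 - Real.log (v / σ)) + μ ^ 2 / σ
        - (v / s - 1 - Real.log (v / s) + (ζ - μ) ^ 2 / s) < - (2 * ε) := by linarith only [hup, hcon, hh]
      have h2 := mul_le_mul_of_nonpos_right hT0h (by linarith only [h1, hε] :
        (v / σ - 1 - Real.log (v / σ)) + μ ^ 2 / σ
        - (v / s - 1 - Real.log (v / s) + (ζ - μ) ^ 2 / s) ≤ 0)
      linarith only [h1, h2, hge]
    have hh1 : h ≤ 1 / 4 := by
      have h1 : (c₁ + 2) * (1 / (8 * (c₁ + 2))) = 1 / 8 := by field_simp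
      have h2 : e ^ 2 ≤ e := pow_le_of_le_one he (he1.trans (by norm_num)) two_ne_zero
      have h3 : (c₁ + 2) * e ≤ 1 / 8 := by
        rw [← h1]; exact mul_le_mul_of_nonneg_left he3 (by positivity)
      have h4 : (c₁ + 2) * ε ≤ 1 / 8 := by
        rw [← h1]; exact mul_le_mul_of_nonneg_left hε3 (by positivity)
      have h5 : c₁ / 2 * e ^ 2 ≤ c₁ / 2 * e := mul_le_mul_of_nonneg_left h2 (by positivity)
      have h6 : 0 ≤ c₁ * e := by positivity
      have h7 : 0 ≤ c₁ * ε := by positivity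
      linarith only [hh, h3, h4, h5, h6, h7, he, hε]
    have hsh : √h ≤ (√c₁ + 2) * (e + √ε) := sqrt_half_mul_sq_add_le hc10.le he
    have hsε := Real.sqrt_nonneg ε
    obtain ⟨hA, hB⟩ := param_close hv0 hs hh1 hle
    have hes : 0 ≤ e + √ε := by positivity
    constructor
    · have h1 : |ζ - μ| ≤ 4 * (σ + 1) * √h := by
        apply abs_le_of_sq_le_sq _ (by positivity)
        rw [mul_pow, Real.sq_sqrt hh0]
        refine hB.trans (mul_le_mul_of_nonneg_right ?_ hh0)
        have h7 : 0 ≤ σ ^ 2 := sq_nonneg σ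
        rw [mul_pow, add_sq]; linarith only [h7, hvhi, hσ]
      have h2 : |ζ| ≤ |ζ - μ| + |μ| := by
        have := abs_add_le (ζ - μ) μ
        simpa using this
      calc |ζ| ≤ 4 * (σ + 1) * ((√c₁ + 2) * (e + √ε)) + 2 * (e + √ε) := by
            have := mul_le_mul_of_nonneg_left hsh (by positivity : 0 ≤ 4 * (σ + 1))
            linarith only [h1, h2, this, hμe, hsε]
        _ = (4 * (σ + 1) * (√c₁ + 2) + 2) * (e + √ε) := by ring
        _ ≤ C * (e + √ε) := by
          apply mul_le_mul_of_nonneg_right _ hes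
          have : 0 ≤ 20 * σ * (2 * (√c₁ + 2)) := by positivity
          linarith only [hC, this, hc10, hk0]
    · have h2 : |s - σ| ≤ |s - v| + |v - σ| := abs_sub_le _ _ _
      calc |s - σ| ≤ 20 * σ * ((√c₁ + 2) * (e + √ε)) + k * (e + √ε) := by
            have h3 : 10 * v * √h ≤ 20 * σ * ((√c₁ + 2) * (e + √ε)) :=
              mul_le_mul (by linarith) hsh (Real.sqrt_nonneg _) (by positivity)
            have h4 : k * e ≤ k * (e + √ε) := mul_le_mul_of_nonneg_left (by linarith) hk0.le
            linarith only [h2, h3, h4, hA, hvσ]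
        _ = (20 * σ * (√c₁ + 2) + k) * (e + √ε) := by ring
        _ ≤ C * (e + √ε) := by
          apply mul_le_mul_of_nonneg_right _ hes
          have h5 : 0 ≤ 20 * σ * (√c₁ + 2) := by positivity
          have h6 : 0 ≤ 4 * (σ + 1) * (√c₁ + 2) := by positivity
          have h7 : 20 * σ * (2 * (√c₁ + 2)) = 2 * (20 * σ * (√c₁ + 2)) := by ring
          linarith only [hC, h5, h6, h7, hc10]


/-! ### Likelihood gain of a single row -/

/-- The likelihood part of the bound belonging to one row, with weights `p`, `w`, as a function of
the deviations `t` of the row level and `b` of the slope from the truth, and of the variational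
variance `l`. -/
noncomputable def rowFit {N : ℕ} (p w x : Fin N → ℝ) (t b l : ℝ) : ℝ :=
  ∑ j, (p j * (t + b * x j) - w j * Real.exp (t + b * x j + l / 2))

/-- Upper bounds for the likelihood part of one row, in terms of the random effect `U` and of a
remainder `R` of bounded expectation. -/
structure FitControl (c C : ℝ) (N : ℕ) (fit : ℝ → ℝ → ℝ → ℝ) (U R : ℝ) : Prop where
  exp_le : Real.exp (16 * |U|) ≤ R
  good : R ≤ c * N ^ 4 → ∀ t b l : ℝ, 0 < l → fit t b l - fit 0 0 (1 / N) ≤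
    C * R - c * N * Real.exp (-|U|) * (mq (max |t| |b|) + l)
  far : R ≤ c * N ^ 4 → ∀ t b l : ℝ, |b| ≤ c → 0 < l → (1 < |t| ∨ 1 < l) →
    fit t b l - fit 0 b (1 / N) ≤ -(c * N * Real.exp (-|U|))
  bad : ∀ t b b' l : ℝ, |b'| ≤ 1 → 0 < l → fit t b l - fit 0 b' (1 / N) ≤ C * N * √R

/-- The data of one row: weights `p`, `w`, covariates `x`, a scale `g` of the weights, and a
remainder `R` dominating the centered row sums. -/
structure RowData (a₁ b₁ a₂ b₂ μ₁ μ₂ μ₃ : ℝ) {N : ℕ} (p w x h : Fin N → ℝ) (g U R : ℝ) :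
    Prop where
  p_nonneg : ∀ j, 0 ≤ p j
  w_nonneg : ∀ j, 0 ≤ w j
  saturated : ∀ j t, p j * t - w j * (Real.exp t - 1) ≤ h j
  le_h : ∀ j, p j * |x j| + w j * Real.exp (|x j| + 1) ≤ h j
  exp_le_g : Real.exp (-|U|) ≤ g
  g_le_exp : g ≤ Real.exp |U|
  exp_le : Real.exp (16 * |U|) ≤ R
  sum_h : ∑ j, h j ^ 2 ≤ N * R
  sum_score : (∑ j, (p j - w j) / g) ^ 8 ≤ N ^ 4 * R
  sum_score_x : (∑ j, (p j - w j) * x j / g) ^ 8 ≤ N ^ 4 * R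
  sum_left : (∑ j, (w j * (Set.Icc a₁ b₁).indicator 1 (x j) / g - μ₁)) ^ 8 ≤ N ^ 4 * R
  sum_right : (∑ j, (w j * (Set.Icc a₂ b₂).indicator 1 (x j) / g - μ₂)) ^ 8 ≤ N ^ 4 * R
  sum_weight : (∑ j, (w j * (1 + x j ^ 2 * Real.exp |x j|) / g - μ₃)) ^ 8 ≤ N ^ 4 * R

lemma expExcess_le (z : ℝ) : expExcess z ≤ z ^ 2 * Real.exp |z| := by
  unfold expExcess
  have h1 : Real.exp z - 1 ≤ z * Real.exp z := by
    have h2 := Real.add_one_le_exp (-z)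
    have h3 : Real.exp (-z) * Real.exp z = 1 := by rw [← Real.exp_add]; simp
    nlinarith [Real.exp_pos z]
  have h2 : Real.exp z - 1 - z ≤ z * (Real.exp z - 1) := by linarith
  refine h2.trans ?_
  rcases le_total 0 z with h | h
  · rw [abs_of_nonneg h]
    nlinarith
  · have h4 := Real.add_one_le_exp z
    have h5 : 1 ≤ Real.exp |z| := Real.one_le_exp (abs_nonneg z)
    nlinarith [sq_nonneg z]

/-- The mean of two lower bounds for `exp (τ + l / 2)`: the value `exp τ`, which keeps the curvature
in `τ`, and the tangent `1 + τ + l / 2`, which keeps the growth in `l`. -/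
lemma half_expExcess_add_le {τ l : ℝ} (hl : 0 < l) :
    expExcess τ / 2 + l / 4 ≤ Real.exp (τ + l / 2) - 1 - τ := by
  have h1 := Real.add_one_le_exp (τ + l / 2)
  have h2 : Real.exp τ ≤ Real.exp (τ + l / 2) := Real.exp_le_exp.2 (by linarith)
  unfold expExcess; linarith

lemma exp_half_inv_sub_one_le {N : ℕ} (hN : 1 ≤ N) :
    Real.exp (1 / (N : ℝ) / 2) - 1 ≤ 1 / N := by
  have hN' : (1 : ℝ) ≤ N := by exact_mod_cast hN
  have h0 : 0 < 1 / (N : ℝ) := by positivity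
  have h1 : 1 / (N : ℝ) ≤ 1 := by rw [div_le_one (by linarith)]; exact hN'
  have h2 := Real.exp_bound_div_one_sub_of_interval (x := 1 / (N : ℝ) / 2) (by linarith)
    (by linarith)
  have h3 : 1 / (1 - 1 / (N : ℝ) / 2) ≤ 1 + 1 / N := by
    rw [div_le_iff₀ (by linarith)]; nlinarith
  linarith

lemma abs_le_of_pow_eight_le {s η n : ℝ} (hη : 0 ≤ η) (hn : 0 ≤ n)
    (h : s ^ 8 ≤ η ^ 8 * n ^ 8) : |s| ≤ η * n := by
  rw [← mul_pow] at h
  have h2 : |s| ^ 8 ≤ (η * n) ^ 8 := by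
    rwa [show |s| ^ 8 = s ^ 8 from (Even.pow_abs (by decide) s)]
  exact le_of_pow_le_pow_left₀ (by norm_num) (by positivity) h2

section
variable {a₁ b₁ a₂ b₂ μ₁ μ₂ μ₃ : ℝ} {N : ℕ} {p w x h : Fin N → ℝ} {g U R : ℝ}

lemma RowData.g_pos (H : RowData a₁ b₁ a₂ b₂ μ₁ μ₂ μ₃ p w x h g U R) : 0 < g :=
  (Real.exp_pos _).trans_le H.exp_le_g

lemma RowData.one_le_R (H : RowData a₁ b₁ a₂ b₂ μ₁ μ₂ μ₃ p w x h g U R) : 1 ≤ R :=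
  (Real.one_le_exp (by positivity)).trans H.exp_le

/-- Curvature is not used here: `h j` dominates the gain of a cell whatever its predictor, and
Cauchy–Schwarz turns the bound on the sum of `h j ^ 2` into `N √R`. -/
lemma RowData.bad (H : RowData a₁ b₁ a₂ b₂ μ₁ μ₂ μ₃ p w x h g U R) (hN : 1 ≤ N)
    {t b b' l : ℝ} (hb' : |b'| ≤ 1) (hl : 0 < l) :
    rowFit p w x t b l - rowFit p w x 0 b' (1 / N) ≤ 2 * N * √R := by
  have hN' : (1 : ℝ) ≤ N := by exact_mod_cast hN
  have h1 : rowFit p w x t b l - rowFit p w x 0 b' (1 / N) ≤ ∑ j, 2 * h j := by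
    unfold rowFit
    rw [← Finset.sum_sub_distrib]
    refine Finset.sum_le_sum fun j _ => ?_
    have e1 := H.saturated j (t + b * x j + l / 2)
    have e2 := H.le_h j
    have e3 : -(p j * (0 + b' * x j)) ≤ p j * |x j| := by
      have : -(b' * x j) ≤ |x j| := by
        refine (neg_le_abs _).trans ?_
        rw [abs_mul]; nlinarith [abs_nonneg (x j)]
      nlinarith [H.p_nonneg j]
    have e4 : w j * Real.exp (0 + b' * x j + 1 / N / 2) ≤ w j * Real.exp (|x j| + 1) := by
      refine mul_le_mul_of_nonneg_left (Real.exp_le_exp.2 ?_) (H.w_nonneg j)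
      have : b' * x j ≤ |x j| := by
        refine (le_abs_self _).trans ?_
        rw [abs_mul]; nlinarith [abs_nonneg (x j)]
      have : 1 / (N : ℝ) / 2 ≤ 1 := by
        rw [div_div, div_le_one (by positivity)]; linarith
      linarith
    have e5 : 0 ≤ p j * (l / 2) := mul_nonneg (H.p_nonneg j) (by positivity)
    have e6 := H.w_nonneg j
    nlinarith
  refine h1.trans ?_
  rw [← Finset.mul_sum, mul_assoc]
  refine mul_le_mul_of_nonneg_left ?_ (by norm_num)
  have h2 := sq_sum_le_card_mul_sum_sq (s := Finset.univ) (f := h)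
  simp only [Finset.card_univ, Fintype.card_fin] at h2
  have h3 : (∑ j, h j) ^ 2 ≤ N ^ 2 * R := by
    refine h2.trans ?_
    rw [sq, mul_assoc]
    exact mul_le_mul_of_nonneg_left H.sum_h (by positivity)
  have h4 := Real.le_sqrt_of_sq_le h3
  rwa [Real.sqrt_mul (by positivity), Real.sqrt_sq (by positivity)] at h4

/-- The sum of the weights over one of two intervals, bounded below through its centered sum. -/
lemma le_sum_indicator {a b μ η : ℝ} (hg : 0 < g)
    (hS : |∑ j, (w j * (Set.Icc a b).indicator 1 (x j) / g - μ)| ≤ η * N) :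
    g * N * (μ - η) ≤ ∑ j, w j * (Set.Icc a b).indicator 1 (x j) := by
  rw [Finset.sum_sub_distrib, ← Finset.sum_div] at hS
  simp only [Finset.sum_const, Finset.card_univ, Fintype.card_fin, nsmul_eq_mul] at hS
  have h1 := (abs_le.1 hS).1
  have h2 : N * (μ - η) ≤ (∑ j, w j * (Set.Icc a b).indicator 1 (x j)) / g := by linarith
  rw [le_div_iff₀ hg] at h2
  linarith

/-- Only cells whose covariate lies in the interval are counted; the excess of the others is
nonnegative. -/
lemma sum_mul_expExcess_ge {a b : ℝ} (hw : ∀ j, 0 ≤ w j) {γ ρ t s : ℝ} (hγ : 0 ≤ γ * ρ)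
    (hx : ∀ y ∈ Set.Icc a b, γ * ρ ≤ |t + s * y|) :
    (∑ j, w j * (Set.Icc a b).indicator 1 (x j)) * (mq (γ * ρ) / 4) ≤
      ∑ j, w j * expExcess (t + s * x j) := by
  rw [Finset.sum_mul]
  refine Finset.sum_le_sum fun j _ => ?_
  rw [mul_assoc]
  refine mul_le_mul_of_nonneg_left ?_ (hw j)
  by_cases hj : x j ∈ Set.Icc a b
  · rw [Set.indicator_of_mem hj]
    have h1 := mq_mono hγ (hx _ hj)
    have h2 := mq_le_expExcess (t + s * x j)
    simp only [Pi.one_apply, one_mul]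
    linarith
  · rw [Set.indicator_of_notMem hj, zero_mul]
    exact expExcess_nonneg _

/-- The gain of one row is a linear term minus a curvature term. -/
lemma rowFit_sub_le (hw : ∀ j, 0 ≤ w j) (hN : 1 ≤ N) {t b l : ℝ} (hl : 0 < l) :
    rowFit p w x t b l - rowFit p w x 0 0 (1 / N) ≤
      t * (∑ j, (p j - w j)) + b * (∑ j, (p j - w j) * x j)
        - (∑ j, w j * expExcess (t + b * x j)) / 2 - l / 4 * ∑ j, w j + (∑ j, w j) / N := by
  have hN' : (0 : ℝ) < N := by exact_mod_cast hN
  unfold rowFit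
  rw [← Finset.sum_sub_distrib, Finset.mul_sum, Finset.mul_sum, Finset.mul_sum, Finset.sum_div,
    Finset.sum_div, ← Finset.sum_add_distrib, ← Finset.sum_sub_distrib, ← Finset.sum_sub_distrib,
    ← Finset.sum_add_distrib]
  refine Finset.sum_le_sum fun j _ => ?_
  have h1 := mul_le_mul_of_nonneg_left (half_expExcess_add_le (τ := t + b * x j) hl) (hw j)
  have h2 := mul_le_mul_of_nonneg_left (exp_half_inv_sub_one_le hN) (hw j)
  have e : (0 : ℝ) + 0 * x j + 1 / N / 2 = 1 / N / 2 := by ring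
  rw [e]
  have e2 : w j / N = w j * (1 / N) := by ring
  rw [e2]
  linarith

/-- The slope is common to all rows, so a row that is reset must keep `b`. This is the price of `b`
against slope zero at the reference point: a score term and a second-order term. -/
lemma rowFit_zero_sub_le (hw : ∀ j, 0 ≤ w j) (hN : 1 ≤ N) {b : ℝ} (hb : |b| ≤ 1) :
    rowFit p w x 0 0 (1 / N) - rowFit p w x 0 b (1 / N) ≤
      -b * (∑ j, (p j - w j) * x j)
        + (2 * b ^ 2 + 1 / N) * ∑ j, w j * (1 + x j ^ 2 * Real.exp |x j|) := by
  have hN' : (0 : ℝ) < N := by exact_mod_cast hN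
  have hN1 : (1 : ℝ) ≤ N := by exact_mod_cast hN
  unfold rowFit
  rw [← Finset.sum_sub_distrib, Finset.mul_sum, Finset.mul_sum, ← Finset.sum_add_distrib]
  refine Finset.sum_le_sum fun j _ => ?_
  set u := Real.exp (1 / (N : ℝ) / 2) with hu
  have hu1 : u - 1 ≤ 1 / N := exp_half_inv_sub_one_le hN
  have hu0 : 1 ≤ u := Real.one_le_exp (by positivity)
  have e0 : (0 : ℝ) + 0 * x j + 1 / N / 2 = 1 / N / 2 := by ring
  have e1 : Real.exp (0 + b * x j + 1 / N / 2) = Real.exp (b * x j) * u := by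
    rw [← Real.exp_add]; congr 1; ring
  rw [e0, e1, ← hu]
  have hx0 := abs_nonneg (x j)
  set B := x j ^ 2 * Real.exp |x j| with hB
  have hB0 : 0 ≤ B := by positivity
  have h1 : expExcess (b * x j) ≤ b ^ 2 * B := by
    refine (expExcess_le _).trans ?_
    rw [hB, mul_pow, mul_assoc]
    refine mul_le_mul_of_nonneg_left (mul_le_mul_of_nonneg_left (Real.exp_le_exp.2 ?_)
      (sq_nonneg _)) (sq_nonneg _)
    rw [abs_mul]; nlinarith
  have h2 : b * x j ≤ 1 + B := by
    have h3 : b * x j ≤ |x j| := by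
      refine (le_abs_self _).trans ?_
      rw [abs_mul]; nlinarith
    have h4 : |x j| ≤ 1 + x j ^ 2 := by rw [← sq_abs]; nlinarith [sq_nonneg (|x j| - 1)]
    have h5 : x j ^ 2 ≤ B := by
      rw [hB]; exact le_mul_of_one_le_right (sq_nonneg _) (Real.one_le_exp hx0)
    linarith
  have h3 : u * Real.exp (b * x j) - u ≤ b * x j + (2 * b ^ 2 + 1 / N) * (1 + B) := by
    have h4 : u * Real.exp (b * x j) - u = u * expExcess (b * x j) + (u - 1) * (b * x j) + b * x j := by
      unfold expExcess; ring
    have h5 : u ≤ 2 := by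
      have : 1 / (N : ℝ) ≤ 1 := by rw [div_le_one hN']; exact hN1
      linarith
    have h6 : u * expExcess (b * x j) ≤ 2 * (b ^ 2 * B) :=
      mul_le_mul h5 h1 (expExcess_nonneg _) (by norm_num)
    have h7 : (u - 1) * (b * x j) ≤ 1 / N * (1 + B) := by
      have h8 : (u - 1) * (b * x j) ≤ (u - 1) * (1 + B) :=
        mul_le_mul_of_nonneg_left h2 (by linarith)
      exact h8.trans (mul_le_mul_of_nonneg_right hu1 (by linarith))
    nlinarith [sq_nonneg b]
  have h4 := mul_le_mul_of_nonneg_left h3 (hw j)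
  linarith

end

lemma abs_add_pow_eight_le (s t : ℝ) : (|s| + |t|) ^ 8 ≤ 128 * (s ^ 8 + t ^ 8) := by
  have h := add_pow_le (abs_nonneg s) (abs_nonneg t) 8
  rw [Even.pow_abs (by decide), Even.pow_abs (by decide)] at h
  norm_num at h; exact h

/-- For `ρ ≤ 1` one completes the square, which leaves the term in `s ^ 2`. For `ρ ≥ 1` the
curvature is linear as well and absorbs everything because `s` is a small multiple of `n`. -/
lemma linear_le_curvature {a g n s ρ η : ℝ} (ha : 0 < a) (hg : 0 < g) (hn : 0 < n)
    (hρ : 0 ≤ ρ) (hη : s ≤ 2 * η * n) (hηa : η ≤ a / 8) :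
    ρ * (g * s) ≤ a / 4 * g * n * mq ρ + g * s ^ 2 / (a * n) := by
  rcases le_total ρ 1 with h | h
  · rw [mq_of_le_one hρ h]
    have h1 : a / 4 * g * n * ρ ^ 2 + g * s ^ 2 / (a * n) - ρ * (g * s)
        = g / (a * n) * (a * n * ρ / 2 - s) ^ 2 := by field_simp; ring
    have h2 : 0 ≤ g / (a * n) * (a * n * ρ / 2 - s) ^ 2 := by positivity
    linarith
  · rw [mq_of_one_le h]
    have h1 : s ≤ a / 4 * n := by nlinarith
    have h2 : ρ * (g * s) ≤ ρ * (g * (a / 4 * n)) := by gcongr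
    have h3 : 0 ≤ g * s ^ 2 / (a * n) := by positivity
    linarith

set_option maxHeartbeats 400000 in
/-- The row data imply the bounds of `FitControl`. -/
theorem exists_fitControl (a₁ b₁ a₂ b₂ μ₁ μ₂ μ₃ : ℝ) (hab : b₁ < a₂) (hμ₁ : 0 < μ₁) (hμ₂ : 0 < μ₂)
    (hμ₃ : 0 ≤ μ₃) :
    ∃ c C : ℝ, 0 < c ∧ c ≤ 1 ∧ 0 < C ∧ ∃ N₀ : ℕ, ∀ N : ℕ, N₀ ≤ N → ∀ (p w x h : Fin N → ℝ)
      (g U R : ℝ), RowData a₁ b₁ a₂ b₂ μ₁ μ₂ μ₃ p w x h g U R →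
        FitControl c C N (rowFit p w x) U R := by
  obtain ⟨γ, hγ0, hγ1, hγ⟩ := exists_affine_lower a₁ b₁ a₂ b₂ hab
  set μ := min μ₁ μ₂ with hμ
  have hμ0 : 0 < μ := lt_min hμ₁ hμ₂
  set a := μ * γ ^ 2 / 8 with ha
  have ha0 : 0 < a := by positivity
  -- In a good row every centered sum is at most `η N`, up to the scale `g`. The entries of the
  -- minimum keep the interval weights at least half their means and make all errors a small part of
  -- the curvature `a`.
  set η : ℝ := min (min 1 (μ / 2)) (a / (32 * (2 * μ₃ + 4))) with hη
  have hη0 : 0 < η := by positivity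
  have hη1 : η ≤ 1 := (min_le_left _ _).trans (min_le_left _ _)
  have hημ : η ≤ μ / 2 := (min_le_left _ _).trans (min_le_right _ _)
  have hηa' : η * (32 * (2 * μ₃ + 4)) ≤ a := by
    rw [← le_div_iff₀ (by positivity)]; exact min_le_right _ _
  have hηa : η ≤ a / 128 := by nlinarith
  have haμ : a ≤ μ / 8 := by
    rw [ha]; have : γ ^ 2 ≤ 1 := by nlinarith
    nlinarith
  have hη8 : η ^ 8 ≤ η := pow_le_of_le_one hη0.le hη1 (by norm_num)
  -- The threshold is `η ^ 8` since `S ^ 8 ≤ N ^ 4 R` and `R ≤ η ^ 8 N ^ 4` give `|S| ≤ η N`. The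
  -- lower bound on `N` makes the cost `g (2 μ₃ + 2)` of the reference variance `1 / N` at most `a g
  -- N / 16`.
  refine ⟨η ^ 8, 512 / a + μ₃ + 3, by positivity, by linarith, by positivity,
    max 1 ⌈16 * (2 * μ₃ + 2) / a⌉₊, ?_⟩
  intro N hNN p w x h g U R H
  have hN : 1 ≤ N := (le_max_left _ _).trans hNN
  have hNa : 16 * (2 * μ₃ + 2) / a ≤ N := by
    refine (Nat.le_ceil _).trans ?_
    exact_mod_cast (le_max_right _ _).trans hNN
  rw [div_le_iff₀ ha0] at hNa
  have hN1 : (1 : ℝ) ≤ N := by exact_mod_cast hN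
  have hN0 : (0 : ℝ) < N := by linarith
  have hg := H.g_pos
  have hR1 := H.one_le_R
  have hw := H.w_nonneg
  set SE := ∑ j, (p j - w j) / g with hSE
  set SF := ∑ j, (p j - w j) * x j / g with hSF
  have hE : ∑ j, (p j - w j) = g * SE := by
    rw [hSE, ← Finset.sum_div]; field_simp
  have hF : ∑ j, (p j - w j) * x j = g * SF := by
    rw [hSF, ← Finset.sum_div]; field_simp
  set s := |SE| + |SF| with hs
  have hs0 : 0 ≤ s := by positivity
  -- bounds valid in a good row
  have small : ∀ S : ℝ, S ^ 8 ≤ N ^ 4 * R → R ≤ η ^ 8 * N ^ 4 → |S| ≤ η * N := by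
    intro S hS hR
    apply abs_le_of_pow_eight_le hη0.le hN0.le
    calc S ^ 8 ≤ N ^ 4 * R := hS
      _ ≤ N ^ 4 * (η ^ 8 * N ^ 4) := by gcongr
      _ = η ^ 8 * N ^ 8 := by ring
  have hlin : ∀ t b : ℝ, t * (g * SE) + b * (g * SF) ≤ max |t| |b| * (g * s) := by
    intro t b
    have h1 : t * SE ≤ max |t| |b| * |SE| := by
      refine (le_abs_self _).trans ?_
      rw [abs_mul]; exact mul_le_mul_of_nonneg_right (le_max_left _ _) (abs_nonneg _)
    have h2 : b * SF ≤ max |t| |b| * |SF| := by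
      refine (le_abs_self _).trans ?_
      rw [abs_mul]; exact mul_le_mul_of_nonneg_right (le_max_right _ _) (abs_nonneg _)
    have h3 := mul_le_mul_of_nonneg_left (add_le_add h1 h2) hg.le
    rw [hs]; linarith
  have hW3 : R ≤ η ^ 8 * N ^ 4 →
      ∑ j, w j * (1 + x j ^ 2 * Real.exp |x j|) ≤ g * N * (μ₃ + 1) := by
    intro hR
    have h1 := (abs_le.1 (small _ H.sum_weight hR)).2
    rw [Finset.sum_sub_distrib, ← Finset.sum_div] at h1
    simp only [Finset.sum_const, Finset.card_univ, Fintype.card_fin, nsmul_eq_mul] at h1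
    have h2 : (∑ j, w j * (1 + x j ^ 2 * Real.exp |x j|)) / g ≤ N * (μ₃ + 1) := by nlinarith
    rw [div_le_iff₀ hg] at h2
    linarith
  have hWle : R ≤ η ^ 8 * N ^ 4 → ∑ j, w j ≤ g * N * (μ₃ + 1) := by
    intro hR
    refine le_trans (Finset.sum_le_sum fun j _ => ?_) (hW3 hR)
    have : 0 ≤ x j ^ 2 * Real.exp |x j| := by positivity
    nlinarith [hw j]
  have core : R ≤ η ^ 8 * N ^ 4 → ∀ t b l : ℝ, 0 < l →
      rowFit p w x t b l - rowFit p w x 0 0 (1 / N) ≤ g * s ^ 2 / (a * N) + g * (μ₃ + 1)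
        - a / 4 * g * N * (mq (max |t| |b|) + l) := by
    intro hR t b l hl
    have hρ0 : 0 ≤ max |t| |b| := le_max_of_le_left (abs_nonneg t)
    have hL1 := le_sum_indicator hg (small _ H.sum_left hR)
    have hL2 := le_sum_indicator hg (small _ H.sum_right hR)
    have hgN : 0 < g * N := by positivity
    have hcurv : a * g * N * mq (max |t| |b|) ≤ ∑ j, w j * expExcess (t + b * x j) := by
      have hm := mq_mul hγ0.le hγ1 hρ0
      have hm0 := mq_nonneg hρ0
      have hmm : 0 ≤ mq (γ * max |t| |b|) / 4 :=
        div_nonneg (mq_nonneg (by positivity)) (by norm_num)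
      have fin : ∀ m : ℝ, μ ≤ m → ∀ S : ℝ, g * N * (m - η) ≤ S →
          a * g * N * mq (max |t| |b|) ≤ S * (mq (γ * max |t| |b|) / 4) := by
        intro m hm1 S hS
        have h1 : g * N * (μ / 2) ≤ S := by
          refine le_trans (mul_le_mul_of_nonneg_left ?_ hgN.le) hS; linarith
        calc a * g * N * mq (max |t| |b|)
            = g * N * (μ / 2) * (γ ^ 2 * mq (max |t| |b|) / 4) := by rw [ha]; ring
          _ ≤ g * N * (μ / 2) * (mq (γ * max |t| |b|) / 4) := by gcongr
          _ ≤ S * (mq (γ * max |t| |b|) / 4) := mul_le_mul_of_nonneg_right h1 hmm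
      rcases hγ t b with h | h
      · exact (fin μ₁ (min_le_left _ _) _ hL1).trans
          (sum_mul_expExcess_ge hw (by positivity) h)
      · exact (fin μ₂ (min_le_right _ _) _ hL2).trans
          (sum_mul_expExcess_ge hw (by positivity) h)
    have hWge : g * N * (μ / 2) ≤ ∑ j, w j := by
      have h1 : g * N * (μ / 2) ≤ g * N * (μ₁ - η) := by
        refine mul_le_mul_of_nonneg_left ?_ hgN.le
        have : μ ≤ μ₁ := min_le_left _ _
        linarith
      refine (h1.trans hL1).trans (Finset.sum_le_sum fun j _ => ?_)
      refine mul_le_of_le_one_right (hw j) ?_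
      exact Set.indicator_apply_le' (fun _ => le_refl _) (fun _ => zero_le_one)
    have h1 := rowFit_sub_le (p := p) (x := x) hw hN (t := t) (b := b) hl
    rw [hE, hF] at h1
    have h2 := hlin t b
    have hsη : s ≤ 2 * η * N := by
      have := small _ H.sum_score hR
      have := small _ H.sum_score_x hR
      rw [hs]; linarith
    have h3 := linear_le_curvature ha0 hg hN0 hρ0 hsη (by linarith)
    have h4 : (∑ j, w j) / N ≤ g * (μ₃ + 1) := by
      rw [div_le_iff₀ hN0]; have := hWle hR; linarith
    have h5 : a / 4 * g * N * l ≤ l / 4 * ∑ j, w j := by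
      have h6 : a * g * N ≤ ∑ j, w j := by
        refine le_trans ?_ hWge
        have : a * (g * N) ≤ μ / 2 * (g * N) := by gcongr; linarith
        linarith
      have h7 := mul_le_mul_of_nonneg_left h6 (by positivity : 0 ≤ l / 4)
      linarith
    linarith
  refine ⟨H.exp_le, ?_, ?_, ?_⟩
  · intro hR t b l hl
    have h1 := core hR t b l hl
    have hρ0 : 0 ≤ max |t| |b| := le_max_of_le_left (abs_nonneg t)
    have hml : 0 ≤ mq (max |t| |b|) + l := add_nonneg (mq_nonneg hρ0) hl.le
    have h2 : η ^ 8 * N * Real.exp (-|U|) * (mq (max |t| |b|) + l)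
        ≤ a / 4 * g * N * (mq (max |t| |b|) + l) := by
      refine mul_le_mul_of_nonneg_right ?_ hml
      have h3 : η ^ 8 ≤ a / 4 := by linarith
      calc η ^ 8 * N * Real.exp (-|U|) ≤ a / 4 * N * g := by
            gcongr; exact H.exp_le_g
        _ = a / 4 * g * N := by ring
    have hg1 : g ≤ R := by
      refine H.g_le_exp.trans (le_trans (Real.exp_le_exp.2 ?_) H.exp_le)
      linarith [abs_nonneg U]
    have hg2 : g ^ 2 ≤ R := by
      refine (pow_le_pow_left₀ hg.le H.g_le_exp 2).trans ?_
      rw [← Real.exp_nat_mul]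
      refine le_trans (Real.exp_le_exp.2 ?_) H.exp_le
      push_cast; linarith [abs_nonneg U]
    have hs8 : s ^ 8 ≤ 256 * (N ^ 4 * R) := by
      refine (abs_add_pow_eight_le SE SF).trans ?_
      linarith [H.sum_score, H.sum_score_x]
    -- With `z = s ^ 2 / N`, the product `g z` is at most `(g ^ 2 + z ^ 2) / 2` and `z ^ 2` at most
    -- `(z ^ 4 + 1) / 2`; both `g ^ 2` and `z ^ 4` are controlled by `R`.
    have h4 : g * s ^ 2 / N ≤ 512 * R := by
      set z := s ^ 2 / N with hz
      have hz4 : z ^ 4 ≤ 256 * R := by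
        rw [hz, div_pow, div_le_iff₀ (by positivity), ← pow_mul]
        calc s ^ (2 * 4) = s ^ 8 := by norm_num
          _ ≤ _ := hs8
          _ = _ := by ring
      have h5 : g * s ^ 2 / N = g * z := by rw [hz]; ring
      have h6 := sq_nonneg (z ^ 2 - 1)
      rw [h5]
      linarith only [sq_nonneg (g - z), h6, hz4, hg2, hR1, sq_nonneg z]
    have h5 : g * s ^ 2 / (a * N) ≤ 512 / a * R := by
      have : g * s ^ 2 / (a * N) = g * s ^ 2 / N / a := by rw [div_div]; congr 1; ring
      rw [this, div_mul_eq_mul_div]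
      exact div_le_div_of_nonneg_right h4 ha0.le
    have h6 : g * (μ₃ + 1) ≤ (μ₃ + 1) * R := by
      rw [mul_comm]; exact mul_le_mul_of_nonneg_left hg1 (by linarith)
    linarith
  -- Outside the unit box the curvature is at least `a g N / 4`, while each error, including the
  -- change of slope at the reference point, is a smaller multiple of `g N`.
  · intro hR t b l hb hl hfar
    have hb1 : |b| ≤ η := hb.trans hη8
    have h1 := core hR t b l hl
    have h2 := rowFit_zero_sub_le (p := p) (x := x) hw hN (hb1.trans hη1)
    rw [hF] at h2
    have hρ0 : 0 ≤ max |t| |b| := le_max_of_le_left (abs_nonneg t)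
    have hone : 1 ≤ mq (max |t| |b|) + l := by
      rcases hfar with h | h
      · have h3 : 1 ≤ max |t| |b| := h.le.trans (le_max_left _ _)
        rw [mq_of_one_le h3]; linarith
      · linarith [mq_nonneg hρ0]
    have hgN : 0 < g * N := by positivity
    have h3 : a / 4 * (g * N) ≤ a / 4 * g * N * (mq (max |t| |b|) + l) := by
      have h4 : 0 ≤ a / 4 * g * N := by positivity
      linarith only [mul_le_mul_of_nonneg_left hone h4]
    have hsF : |SF| ≤ η * N := small _ H.sum_score_x hR
    have hsη : s ≤ 2 * η * N := by
      have := small _ H.sum_score hR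
      rw [hs]; linarith
    have h4 : g * s ^ 2 / (a * N) ≤ η * (g * N) := by
      rw [div_le_iff₀ (by positivity)]
      have : s ^ 2 ≤ (2 * η * N) ^ 2 := pow_le_pow_left₀ hs0 hsη 2
      calc g * s ^ 2 ≤ g * (2 * η * N) ^ 2 := mul_le_mul_of_nonneg_left this hg.le
        _ = η * (g * N) * (4 * η * N) := by ring
        _ ≤ η * (g * N) * (a * N) := by gcongr; linarith
    have h5 : -b * (g * SF) ≤ η * (g * N) := by
      have h6 : -b * SF ≤ 1 * (η * N) := by
        refine (le_abs_self _).trans ?_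
        rw [abs_mul, abs_neg]
        exact mul_le_mul (hb1.trans hη1) hsF (abs_nonneg _) zero_le_one
      have := mul_le_mul_of_nonneg_left h6 hg.le
      linarith only [this]
    have h6 : (2 * b ^ 2 + 1 / N) * ∑ j, w j * (1 + x j ^ 2 * Real.exp |x j|)
        ≤ 2 * η * (g * N * (μ₃ + 1)) + g * (μ₃ + 1) := by
      have hb2 : b ^ 2 ≤ η := by
        rw [← sq_abs]
        exact (pow_le_of_le_one (abs_nonneg b) (hb1.trans hη1) two_ne_zero).trans hb1
      have h7 : 2 * η * (g * N * (μ₃ + 1)) + g * (μ₃ + 1)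
          = (2 * η + 1 / N) * (g * N * (μ₃ + 1)) := by field_simp
      rw [h7]
      have hS0 : 0 ≤ ∑ j, w j * (1 + x j ^ 2 * Real.exp |x j|) :=
        Finset.sum_nonneg fun j _ => mul_nonneg (hw j) (by positivity)
      exact mul_le_mul (by linarith only [hb2]) (hW3 hR) hS0 (by positivity)
    have h8 : g * (2 * μ₃ + 2) ≤ a / 16 * (g * N) := by
      have := mul_le_mul_of_nonneg_left hNa hg.le
      linarith only [this]
    have h9 : η * (2 * μ₃ + 4) * (g * N) ≤ a / 32 * (g * N) := by
      refine mul_le_mul_of_nonneg_right ?_ hgN.le; linarith only [hηa']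
    have h10 : η ^ 8 * N * Real.exp (-|U|) ≤ a / 8 * (g * N) := by
      have h3 : η ^ 8 ≤ a / 8 := by linarith
      calc η ^ 8 * N * Real.exp (-|U|) ≤ a / 8 * N * g := by
            gcongr; exact H.exp_le_g
        _ = a / 8 * (g * N) := by ring
    linarith only [h1, h2, h3, h4, h5, h6, h8, h9, h10, mul_nonneg ha0.le hgN.le,
      mul_nonneg hη0.le hgN.le]
  · intro t b b' l hb' hl
    refine (H.bad hN hb' hl).trans ?_
    have h1 : 0 ≤ N * √R := by positivity
    have h2 : 0 ≤ 512 / a := by positivity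
    have h3 : 2 ≤ 512 / a + μ₃ + 3 := by linarith only [h2, hμ₃]
    have := mul_le_mul_of_nonneg_right h3 h1
    linarith only [this]


/-! ### Gain and loss of one row, prior part included -/

/-- Control of one side (rows or columns) of the array: the bounds on the likelihood parts, the
mean remainder, and the first two empirical moments of the random effects. -/
structure SideControl (c C K σ : ℝ) {M : ℕ} (N : ℕ) (fit : Fin M → ℝ → ℝ → ℝ → ℝ)
    (U R : Fin M → ℝ) : Prop where
  fit : ∀ i, FitControl c C N (fit i) (U i) (R i)
  sum_R : ∑ i, R i ≤ K * M
  sum_U : |∑ i, U i| ≤ K * √M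
  sum_sq : |∑ i, (U i ^ 2 - σ)| ≤ K * √M

/-- The part of the bound belonging to one side. -/
noncomputable def sideObj (κ sg : ℝ) {M : ℕ} (fit : Fin M → ℝ → ℝ → ℝ → ℝ) (U : Fin M → ℝ)
    (ζ s b : ℝ) (t l : Fin M → ℝ) : ℝ :=
  ∑ i, (κ * fit i (t i) b (l i) + reg ζ s (U i + sg * t i) (l i))

/-- The loss of one row in terms of the deviations. -/
noncomputable def rowLoss (c : ℝ) (N : ℕ) (U R b t l : ℝ) : ℝ :=
  open Classical in
  if R ≤ c * N ^ 4 then Real.exp (-|U|) * (mq (max |t| |b|) + l) else 0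

/-- A row with controlled data whose deviations are at most one. -/
def IsTame (c : ℝ) (N : ℕ) (R t l : ℝ) : Prop := R ≤ c * N ^ 4 ∧ |t| ≤ 1 ∧ l ≤ 1

section Row
variable {c C κ σ : ℝ} {N : ℕ} {fit : ℝ → ℝ → ℝ → ℝ} {U R : ℝ}

lemma FitControl.exp_pow_le (H : FitControl c C N fit U R) {k : ℝ} (hk : k ≤ 16) :
    Real.exp (k * |U|) ≤ R :=
  (Real.exp_le_exp.2 (mul_le_mul_of_nonneg_right hk (abs_nonneg U))).trans H.exp_le

lemma FitControl.one_le (H : FitControl c C N fit U R) : 1 ≤ R := by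
  have := H.exp_pow_le (k := 0) (by norm_num); simpa using this

lemma FitControl.exp_le_sqrt (H : FitControl c C N fit U R) : Real.exp |U| ≤ √R := by
  apply Real.le_sqrt_of_sq_le
  rw [← Real.exp_nat_mul]
  exact_mod_cast H.exp_pow_le (k := 2) (by norm_num)

lemma one_add_sq_le_exp (U : ℝ) : 1 + |U| + U ^ 2 ≤ 2 * Real.exp |U| := by
  have := Real.quadratic_le_exp_of_nonneg (abs_nonneg U)
  rw [sq_abs] at this
  have := abs_nonneg U
  linarith

lemma sqrt_ge_of_bad (hc : 0 < c) (hc1 : c ≤ 1) (hR : ¬ R ≤ c * N ^ 4) : c * N ^ 2 ≤ √R := by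
  push Not at hR
  apply Real.le_sqrt_of_sq_le
  have : c ^ 2 ≤ c := by nlinarith
  calc (c * N ^ 2) ^ 2 = c ^ 2 * N ^ 4 := by ring
    _ ≤ c * N ^ 4 := by gcongr
    _ ≤ R := hR.le

/-- This is what the eighth moments are for. A bad row has `√R ≥ c N ^ 2`, so its possible gain `N
√R` is only `O(R / N)`; lower moments would give a lower power of `N` in the threshold and miss the
factor `1 / N` needed to reset bad rows cheaply. -/
lemma mul_sqrt_le_of_bad (hc : 0 < c) (hc1 : c ≤ 1) (hN : 1 ≤ N) (hR0 : 0 ≤ R)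
    (hR : ¬ R ≤ c * N ^ 4) : N * √R ≤ R / (c * N) := by
  have hN' : (0 : ℝ) < N := by exact_mod_cast hN
  rw [le_div_iff₀ (by positivity)]
  have h1 := sqrt_ge_of_bad hc hc1 hR
  have h2 := Real.mul_self_sqrt hR0
  have h3 := mul_le_mul_of_nonneg_right h1 (Real.sqrt_nonneg R)
  linarith only [h2, h3]

lemma sqrt_le_of_bad (hc : 0 < c) (hc1 : c ≤ 1) (hN : 1 ≤ N) (hR0 : 0 ≤ R)
    (hR : ¬ R ≤ c * N ^ 4) : √R ≤ R / (c * N) := by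
  have hN' : (1 : ℝ) ≤ N := by exact_mod_cast hN
  exact (le_mul_of_one_le_left (Real.sqrt_nonneg R) hN').trans
    (mul_sqrt_le_of_bad hc hc1 hN hR0 hR)

/-- The variational variance `1 / N` of the reference point costs `log N / 2`, a term that has to be
recovered before the sharp rate can appear. -/
lemma neg_reg_true_le (hσ : 0 < σ) (hN : 1 ≤ N) (U : ℝ) :
    -reg 0 σ U (1 / N) ≤ 1 / 2 * Real.log N + (|Real.log σ| + 1 / σ) * Real.exp |U| := by
  have hN' : (1 : ℝ) ≤ N := by exact_mod_cast hN
  have hN0 : (0 : ℝ) < N := by linarith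
  unfold reg
  rw [Real.log_div (by positivity) hσ.ne', Real.log_div one_ne_zero hN0.ne', Real.log_one]
  have h1 := one_add_sq_le_exp U
  have h2 : ((U - 0) ^ 2 + 1 / N) / σ ≤ 2 * Real.exp |U| / σ := by
    apply div_le_div_of_nonneg_right _ hσ.le
    have : 1 / (N : ℝ) ≤ 1 := by rw [div_le_one hN0]; exact hN'
    have := abs_nonneg U
    rw [sub_zero]; linarith
  have h3 : Real.log σ ≤ |Real.log σ| * Real.exp |U| :=
    (le_abs_self _).trans (le_mul_of_one_le_right (abs_nonneg _)
      (Real.one_le_exp (abs_nonneg U)))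
  have h4 : 0 ≤ |Real.log σ| * Real.exp |U| := by positivity
  have h5 : 2 * Real.exp |U| / σ = 2 * (1 / σ * Real.exp |U|) := by ring
  rw [h5] at h2
  linarith

lemma log_le_of_bad (hc : 0 < c) (hc1 : c ≤ 1) (hN : 1 ≤ N) (hR0 : 0 ≤ R)
    (hR : ¬ R ≤ c * N ^ 4) : Real.log N ≤ R / (c ^ 2 * N) := by
  have hN' : (1 : ℝ) ≤ N := by exact_mod_cast hN
  have hN0 : (0 : ℝ) < N := by linarith
  have h1 : Real.log N ≤ N := (Real.log_le_sub_one_of_pos hN0).trans (by linarith)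
  have h2 := mul_sqrt_le_of_bad hc hc1 hN hR0 hR
  have h3 := sqrt_ge_of_bad hc hc1 hR
  have h4 : c ≤ √R := (le_mul_of_one_le_right hc.le (one_le_pow₀ hN')).trans h3
  have h5 : N * c ≤ N * √R := by gcongr
  have h6 : N * c ≤ R / (c * N) := h5.trans h2
  refine h1.trans ?_
  have h7 : R / (c ^ 2 * N) = R / (c * N) / c := by field_simp
  rw [h7, le_div_iff₀ hc]; exact h6

/-- The gain of one row over the truth, crude form. -/
lemma FitControl.crude (H : FitControl c C N fit U R) (hc : 0 < c) (hc1 : c ≤ 1) (hC : 0 < C)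
    (hκ : 0 < κ) (hσ : 0 < σ) (hN : 1 ≤ N) {ζ s y b t l : ℝ} (hs : 0 < s) (hl : 0 < l) :
    κ * fit t b l + reg ζ s y l - (κ * fit 0 0 (1 / N) + reg 0 σ U (1 / N)) ≤
      -(κ * c * N) * rowLoss c N U R b t l + (κ * C / c + |Real.log σ| + 1 / σ + 1) * R
        + Real.log N := by
  have hN' : (1 : ℝ) ≤ N := by exact_mod_cast hN
  have hlog : 0 ≤ Real.log N := Real.log_nonneg hN'
  have hR0 : 0 ≤ R := zero_le_one.trans H.one_le
  have h1 := reg_nonpos (ζ := ζ) (y := y) hs hl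
  have h2 := neg_reg_true_le hσ hN U
  have h3 : (|Real.log σ| + 1 / σ) * Real.exp |U| ≤ (|Real.log σ| + 1 / σ) * R := by
    have := H.exp_pow_le (k := 1) (by norm_num)
    rw [one_mul] at this
    gcongr
  have h4 : κ * (fit t b l - fit 0 0 (1 / N)) ≤
      -(κ * c * N) * rowLoss c N U R b t l + κ * C / c * R := by
    unfold rowLoss
    split_ifs with hg
    · have h5 := mul_le_mul_of_nonneg_left (H.good hg t b l hl) hκ.le
      have h6 : κ * C * R ≤ κ * C / c * R := by
        refine mul_le_mul_of_nonneg_right ?_ hR0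
        rw [le_div_iff₀ hc]; nlinarith [mul_pos hκ hC]
      linarith only [h5, h6]
    · have h5 := mul_le_mul_of_nonneg_left (H.bad t b 0 l (by simp) hl) hκ.le
      have h6 := mul_sqrt_le_of_bad hc hc1 hN hR0 hg
      have h7 : R / (c * N) ≤ R / c := by
        apply div_le_div_of_nonneg_left hR0 hc; nlinarith
      have h8 := mul_le_mul_of_nonneg_left (h6.trans h7) (mul_pos hκ hC).le
      have h9 : κ * C * (R / c) = κ * C / c * R := by ring
      linarith only [h5, h8, h9]
  linarith only [h1, h2, h3, h4, hlog, hR0]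

lemma half_log_le {a x : ℝ} (ha : 0 < a) (hx : 0 < x) : Real.log x ≤ a * x - Real.log a := by
  have h1 := Real.log_le_sub_one_of_pos (mul_pos ha hx)
  rw [Real.log_mul ha.ne' hx.ne'] at h1
  linarith

/-- The gain of one row over the truth; the variational variance is charged to the loss. -/
lemma FitControl.refined (H : FitControl c C N fit U R) (hc : 0 < c) (hc1 : c ≤ 1) (hC : 0 < C)
    (hκ : 0 < κ) (hσ : 0 < σ) (hN : 1 ≤ N) {ζ s y b t l : ℝ} (hs : 0 < s) (hl : 0 < l) :
    κ * fit t b l + reg ζ s y l - (κ * fit 0 0 (1 / N) + reg 0 σ U (1 / N)) ≤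
      -(κ * c / 2 * N) * rowLoss c N U R b t l
        + (κ * C / c + |Real.log σ| + 1 / σ + 1 + |Real.log (κ * c)| + 1 / c ^ 2) * R
        + (open Classical in if R ≤ c * N ^ 4 then
            -(1 / 2) * Real.log s - (y - ζ) ^ 2 / (2 * s) else 0) := by
  have hN' : (1 : ℝ) ≤ N := by exact_mod_cast hN
  have hN0 : (0 : ℝ) < N := by linarith
  have hlog : 0 ≤ Real.log N := Real.log_nonneg hN'
  have hR1 := H.one_le
  have hR0 : 0 ≤ R := zero_le_one.trans H.one_le
  have h2 := neg_reg_true_le hσ hN U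
  have h3 : (|Real.log σ| + 1 / σ) * Real.exp |U| ≤ (|Real.log σ| + 1 / σ) * R := by
    have := H.exp_pow_le (k := 1) (by norm_num)
    rw [one_mul] at this
    gcongr
  have habs : 0 ≤ |Real.log (κ * c)| * R := by positivity
  have hcR : 0 ≤ 1 / c ^ 2 * R := by positivity
  unfold rowLoss
  split_ifs with hg
  · have h5 := mul_le_mul_of_nonneg_left (H.good hg t b l hl) hκ.le
    have h6 : κ * C * R ≤ κ * C / c * R := by
      refine mul_le_mul_of_nonneg_right ?_ hR0
      rw [le_div_iff₀ hc]; nlinarith [mul_pos hκ hC]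
    have h7 : reg ζ s y l ≤ 1 / 2 * Real.log l - 1 / 2 * Real.log s - (y - ζ) ^ 2 / (2 * s) := by
      unfold reg
      rw [Real.log_div hl.ne' hs.ne']
      have e : ((y - ζ) ^ 2 + l) / s = 2 * ((y - ζ) ^ 2 / (2 * s)) + l / s := by
        field_simp
      have : 0 ≤ l / s := by positivity
      rw [e]; linarith
    -- The tangent bound for `log` at the product `N l`: half of the loss in `l` pays for `log N +
    -- log l`, leaving only `O(R)`. So the `log N` of the reference point disappears.
    have h8 : Real.log N + Real.log l ≤ κ * c * Real.exp (-|U|) * (N * l) + |U|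
        - Real.log (κ * c) := by
      rw [← Real.log_mul hN0.ne' hl.ne']
      have := half_log_le (a := κ * c * Real.exp (-|U|)) (by positivity) (mul_pos hN0 hl)
      rw [Real.log_mul (by positivity) (Real.exp_pos _).ne', Real.log_exp] at this
      linarith
    have h9 : |U| ≤ R := by
      have h10 := H.exp_pow_le (k := 1) (by norm_num)
      rw [one_mul] at h10
      linarith [Real.add_one_le_exp |U|]
    have h10 : -Real.log (κ * c) ≤ |Real.log (κ * c)| * R :=
      (neg_le_abs _).trans (le_mul_of_one_le_right (abs_nonneg _) hR1)
    have h11 : 0 ≤ κ * c * N * Real.exp (-|U|) * mq (max |t| |b|) := by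
      have := mq_nonneg (le_max_of_le_left (abs_nonneg t) : 0 ≤ max |t| |b|)
      positivity
    linarith only [h2, h3, h5, h6, h7, h8, h9, h10, h11, hcR, hR0, habs]
  · have h1 := reg_nonpos (ζ := ζ) (y := y) hs hl
    have h5 := mul_le_mul_of_nonneg_left (H.bad t b 0 l (by simp) hl) hκ.le
    have h6 := mul_sqrt_le_of_bad hc hc1 hN hR0 hg
    have h7 : R / (c * N) ≤ R / c := by
      apply div_le_div_of_nonneg_left hR0 hc; nlinarith
    have h8 := mul_le_mul_of_nonneg_left (h6.trans h7) (mul_pos hκ hC).le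
    have h9 : κ * C * (R / c) = κ * C / c * R := by ring
    have h10 := log_le_of_bad hc hc1 hN hR0 hg
    have h11 : R / (c ^ 2 * N) ≤ 1 / c ^ 2 * R := by
      have e : 1 / c ^ 2 * R = R / c ^ 2 := by ring
      rw [e]
      apply div_le_div_of_nonneg_left hR0 (by positivity)
      have : 0 ≤ c ^ 2 := sq_nonneg c
      nlinarith
    linarith only [h1, h2, h3, h5, h8, h9, h10, h11, habs, hR0, hlog]

lemma rowLoss_nonneg {b t l : ℝ} (hl : 0 < l) : 0 ≤ rowLoss c N U R b t l := by
  unfold rowLoss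
  split_ifs
  · have := mq_nonneg (le_max_of_le_left (abs_nonneg t) : 0 ≤ max |t| |b|)
    positivity
  · exact le_rfl

/-- The loss carries the small weight `exp (-|U|)`. The factor `exp (3 / 2 |U|)` turns its square
root into `exp |U|`, and in Cauchy–Schwarz the square `exp (3 |U|)` of that factor is still covered
by `R`. -/
lemma sqrt_rowLoss_mul_exp {b t l : ℝ} (hg : R ≤ c * N ^ 4) :
    √(rowLoss c N U R b t l) * Real.exp (3 / 2 * |U|)
      = √(mq (max |t| |b|) + l) * Real.exp |U| := by
  unfold rowLoss
  rw [if_pos hg, Real.sqrt_mul (Real.exp_pos _).le, ← Real.exp_half]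
  have : Real.exp (3 / 2 * |U|) = Real.exp (|U| / 2) * Real.exp |U| := by
    rw [← Real.exp_add]; congr 1; ring
  rw [this]
  have h2 : Real.exp (-|U| / 2) * Real.exp (|U| / 2) = 1 := by
    rw [← Real.exp_add, ← Real.exp_zero]; congr 1; ring
  linear_combination √(mq (max |t| |b|) + l) * Real.exp |U| * h2

/-- A row fails to be tame either through deviations beyond one, and then its loss is at least `exp
(-|U|)`, or through a large `R`, and then `exp |U| ≤ √R` is `O(R / N)`. -/
lemma FitControl.exp_le_of_not_tame (H : FitControl c C N fit U R) (hc : 0 < c) (hc1 : c ≤ 1)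
    (hN : 1 ≤ N) {b t l : ℝ} (hl : 0 < l) (ht : ¬ IsTame c N R t l) :
    Real.exp |U| ≤ √(rowLoss c N U R b t l) * Real.exp (3 / 2 * |U|) + R / (c * N) := by
  have hN0 : (0 : ℝ) < N := by exact_mod_cast hN
  have hR0 : 0 ≤ R := zero_le_one.trans H.one_le
  by_cases hg : R ≤ c * N ^ 4
  · rw [sqrt_rowLoss_mul_exp hg]
    have hρ0 : 0 ≤ max |t| |b| := le_max_of_le_left (abs_nonneg t)
    have h1 : 1 ≤ mq (max |t| |b|) + l := by
      by_cases h : |t| ≤ 1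
      · have : 1 < l := by
          by_contra hcon
          exact ht ⟨hg, h, not_lt.1 hcon⟩
        linarith [mq_nonneg hρ0]
      · push Not at h
        rw [mq_of_one_le (h.le.trans (le_max_left _ _))]
        linarith [le_max_left |t| |b|]
    have h2 : 1 ≤ √(mq (max |t| |b|) + l) := Real.one_le_sqrt.2 h1
    have h3 : 0 ≤ R / (c * N) := by positivity
    nlinarith [Real.exp_pos |U|]
  · have h1 := sqrt_le_of_bad hc hc1 hN hR0 hg
    have h2 := H.exp_le_sqrt
    have h3 : 0 ≤ √(rowLoss c N U R b t l) * Real.exp (3 / 2 * |U|) := by positivity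
    linarith

/-- Below one, `mq` is the square and `l ^ 2 ≤ l`, so both deviations are bounded by the square root
of the unweighted loss. -/
lemma mul_exp_le_of_tame {b t l : ℝ} (hl : 0 < l) (ht : IsTame c N R t l) :
    (|t| + l) * Real.exp |U| ≤ 2 * (√(rowLoss c N U R b t l) * Real.exp (3 / 2 * |U|)) := by
  obtain ⟨hg, ht1, hl1⟩ := ht
  rw [sqrt_rowLoss_mul_exp hg, ← mul_assoc]
  refine mul_le_mul_of_nonneg_right ?_ (Real.exp_pos _).le
  have hρ0 : 0 ≤ max |t| |b| := le_max_of_le_left (abs_nonneg t)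
  have hm := mq_nonneg hρ0
  have h1 : |t| ≤ √(mq (max |t| |b|) + l) := by
    apply Real.le_sqrt_of_sq_le
    have h3 : mq |t| ≤ mq (max |t| |b|) := mq_mono (abs_nonneg t) (le_max_left _ _)
    rw [mq_of_le_one (abs_nonneg t) ht1] at h3
    linarith
  have h2 : l ≤ √(mq (max |t| |b|) + l) := by
    apply Real.le_sqrt_of_sq_le
    nlinarith
  linarith

/-- Every row sees the common slope, so each one bounds it; the truncation at one is needed because
`mq` is quadratic only there, and because rows that are not tame give no more than the trivial
bound. -/
lemma FitControl.min_abs_le (H : FitControl c C N fit U R) (hc : 0 < c) (hc1 : c ≤ 1)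
    (hN : 1 ≤ N) {b t l : ℝ} (hl : 0 < l) :
    min |b| 1 ≤ √(rowLoss c N U R b t l) * Real.exp (3 / 2 * |U|) + R / (c * N) := by
  by_cases ht : IsTame c N R t l
  · have hR0 : 0 ≤ R := zero_le_one.trans H.one_le
    have h3 : 0 ≤ R / (c * N) := by positivity
    rw [sqrt_rowLoss_mul_exp ht.1]
    have hb0 := abs_nonneg b
    have h1 : min |b| 1 ≤ √(mq (max |t| |b|) + l) := by
      apply Real.le_sqrt_of_sq_le
      have h4 : mq (min |b| 1) ≤ mq (max |t| |b|) :=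
        mq_mono (le_min hb0 zero_le_one) ((min_le_left _ _).trans (le_max_right _ _))
      rw [mq_of_le_one (le_min hb0 zero_le_one) (min_le_right _ _)] at h4
      linarith
    have h2 : 1 ≤ Real.exp |U| := Real.one_le_exp (abs_nonneg U)
    nlinarith [Real.sqrt_nonneg (mq (max |t| |b|) + l)]
  · have h1 := H.exp_le_of_not_tame hc hc1 hN hl ht (b := b)
    have h2 : 1 ≤ Real.exp |U| := Real.one_le_exp (abs_nonneg U)
    linarith [min_le_right |b| 1]

/-- The polynomial inequality by which a row with large deviations loses against the truth. -/
lemma exists_large_row (κ c D : ℝ) (hκ : 0 < κ) (hc : 0 < c) (hD : 0 ≤ D) :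
    ∃ N₀ : ℕ, ∀ N : ℕ, N₀ ≤ N → ∀ v : ℝ, 1 ≤ v → v ^ 4 ≤ N →
      1 / 2 * Real.log N + D * v ≤ κ * (c * N * v⁻¹) := by
  refine ⟨max 1 ⌈((2 + D) / (κ * c)) ^ 2⌉₊, fun N hN v hv hvN => ?_⟩
  have hN1 : (1 : ℝ) ≤ N := by exact_mod_cast (le_max_left _ _).trans hN
  have hN0 : (0 : ℝ) < N := by linarith
  have hb : ((2 + D) / (κ * c)) ^ 2 ≤ N := by
    refine (Nat.le_ceil _).trans ?_
    exact_mod_cast (le_max_right _ _).trans hN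
  -- In terms of `w = N ^ (1 / 4)`: the left side is at most `(2 + D) w`, because `v ≤ w` and `log N
  -- ≤ 4 w`, whereas `N / v ≥ w ^ 3`.
  set w := √√(N : ℝ) with hw
  have hw2 : w ^ 2 = √(N : ℝ) := Real.sq_sqrt (Real.sqrt_nonneg _)
  have hw4 : w ^ 4 = N := by
    have : w ^ 4 = (w ^ 2) ^ 2 := by ring
    rw [this, hw2, Real.sq_sqrt hN0.le]
  have hw0 : 0 ≤ w := Real.sqrt_nonneg _
  have hw1 : 1 ≤ w := by
    by_contra hcon
    push Not at hcon
    have : w ^ 4 < 1 := pow_lt_one₀ hw0 hcon (by norm_num)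
    linarith
  have hvw : v ≤ w := le_of_pow_le_pow_left₀ (by norm_num : 4 ≠ 0) hw0 (by rw [hw4]; exact hvN)
  have hlog : Real.log N ≤ 4 * w := by
    rw [← hw4, Real.log_pow]
    have := Real.log_le_sub_one_of_pos (by linarith : 0 < w)
    push_cast; linarith
  have hkc : (2 + D) ≤ κ * c * w ^ 2 := by
    have h1 : (2 + D) / (κ * c) ≤ √(N : ℝ) := Real.le_sqrt_of_sq_le hb
    rw [← hw2, div_le_iff₀ (by positivity)] at h1
    linarith
  have hNv : w ^ 3 ≤ N * v⁻¹ := by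
    rw [← div_eq_mul_inv, le_div_iff₀ (by linarith), ← hw4]
    have : w ^ 3 * v ≤ w ^ 3 * w := by gcongr
    linarith
  have h1 : κ * c * w ^ 3 ≤ κ * c * (N * v⁻¹) := by gcongr
  have h2 : (2 + D) * w ≤ κ * c * w ^ 2 * w := by gcongr
  have h3 : D * v ≤ D * w := by gcongr
  linarith only [h1, h2, h3, hlog, hw0]

end Row

/-- The gain of one row over the point with the true parameters, the same slope, and deviations
reset to zero in rows that are not tame. -/
lemma exists_truncate (c C κ σ : ℝ) (hc : 0 < c) (hc1 : c ≤ 1) (hC : 0 < C) (hκ : 0 < κ)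
    (hσ : 0 < σ) : ∃ D : ℝ, 0 < D ∧ ∃ N₀ : ℕ, ∀ N : ℕ, N₀ ≤ N →
      ∀ (fit : ℝ → ℝ → ℝ → ℝ) (U R : ℝ), FitControl c C N fit U R →
      ∀ ζ s y b t l : ℝ, 0 < s → 0 < l → |b| ≤ c → ¬ IsTame c N R t l →
        κ * fit t b l + reg ζ s y l - (κ * fit 0 b (1 / N) + reg 0 σ U (1 / N)) ≤ D * R / N := by
  obtain ⟨N₀, hN₀⟩ := exists_large_row κ c (|Real.log σ| + 1 / σ) hκ hc (by positivity)
  refine ⟨κ * C / c + 1 / c ^ 2 + (|Real.log σ| + 1 / σ) / c, by positivity, max 1 N₀, ?_⟩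
  intro N hNN fit U R H ζ s y b t l hs hl hb ht
  have hN : 1 ≤ N := (le_max_left _ _).trans hNN
  have hN' : (1 : ℝ) ≤ N := by exact_mod_cast hN
  have hN0 : (0 : ℝ) < N := by linarith
  have hR0 : 0 ≤ R := zero_le_one.trans H.one_le
  have h1 := reg_nonpos (ζ := ζ) (y := y) hs hl
  have h2 := neg_reg_true_le hσ hN U
  by_cases hg : R ≤ c * N ^ 4
  · have hfar : 1 < |t| ∨ 1 < l := by
      by_contra hcon
      push Not at hcon
      exact ht ⟨hg, hcon.1, hcon.2⟩
    have h3 := mul_le_mul_of_nonneg_left (H.far hg t b l hb hl hfar) hκ.le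
    -- Here the exponent sixteen is used: `exp (16 |U|) ≤ R ≤ c N ^ 4` keeps the factor `exp (-|U|)`
    -- in the loss above `N ^ (-1 / 4)`, so that the loss beats `log N`.
    have hv4 : Real.exp |U| ^ 4 ≤ N := by
      have h4 : (Real.exp |U| ^ 4) ^ 4 ≤ (N : ℝ) ^ 4 := by
        rw [← pow_mul, ← Real.exp_nat_mul]
        calc Real.exp (((4 * 4 : ℕ) : ℝ) * |U|) = Real.exp (16 * |U|) := by norm_num
          _ ≤ R := H.exp_le
          _ ≤ c * N ^ 4 := hg
          _ ≤ N ^ 4 := mul_le_of_le_one_left (by positivity) hc1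
      exact le_of_pow_le_pow_left₀ (by norm_num) hN0.le h4
    have h5 := hN₀ N ((le_max_right _ _).trans hNN) (Real.exp |U|)
      (Real.one_le_exp (abs_nonneg U)) hv4
    rw [← Real.exp_neg] at h5
    have h6 : 0 ≤ (κ * C / c + 1 / c ^ 2 + (|Real.log σ| + 1 / σ) / c) * R / N := by positivity
    linarith only [h1, h2, h3, h5, h6]
  · have h3 := mul_le_mul_of_nonneg_left (H.bad t b b l (hb.trans hc1) hl) hκ.le
    have h4 := mul_le_mul_of_nonneg_left (mul_sqrt_le_of_bad hc hc1 hN hR0 hg) (mul_pos hκ hC).le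
    have h5 := log_le_of_bad hc hc1 hN hR0 hg
    have h6 := mul_le_mul_of_nonneg_left (H.exp_le_sqrt.trans (sqrt_le_of_bad hc hc1 hN hR0 hg))
      (by positivity : 0 ≤ |Real.log σ| + 1 / σ)
    have e : (κ * C / c + 1 / c ^ 2 + (|Real.log σ| + 1 / σ) / c) * R / N
        = κ * C * (R / (c * N)) + R / (c ^ 2 * N) + (|Real.log σ| + 1 / σ) * (R / (c * N)) := by
      field_simp
    have hlog : 0 ≤ Real.log N := Real.log_nonneg hN'
    rw [e]
    linarith only [h1, h2, h3, h4, h5, h6, hlog]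


/-! ### Summation over one side: small loss, empirical moments, comparison points -/

/-- The rows with controlled data and deviations at most one. -/
noncomputable def tame (c : ℝ) {M : ℕ} (N : ℕ) (R t l : Fin M → ℝ) : Finset (Fin M) :=
  open Classical in Finset.univ.filter fun i => IsTame c N (R i) (t i) (l i)

/-- The total loss of one side. -/
noncomputable def sideLoss (c : ℝ) {M : ℕ} (N : ℕ) (U R : Fin M → ℝ) (b : ℝ) (t l : Fin M → ℝ) :
    ℝ :=
  ∑ i, rowLoss c N (U i) (R i) b (t i) (l i)

section Side
variable {c C K κ σ sg : ℝ} {M N : ℕ} {fit : Fin M → ℝ → ℝ → ℝ → ℝ} {U R t l : Fin M → ℝ}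
  {ζ s b : ℝ}

lemma mem_tame {i : Fin M} : i ∈ tame c N R t l ↔ IsTame c N (R i) (t i) (l i) := by
  classical
  unfold tame; simp

lemma sideLoss_nonneg (hl : ∀ i, 0 < l i) : 0 ≤ sideLoss c N U R b t l :=
  Finset.sum_nonneg fun i _ => rowLoss_nonneg (hl i)

lemma SideControl.crude (H : SideControl c C K σ N fit U R) (hc : 0 < c) (hc1 : c ≤ 1)
    (hC : 0 < C) (hκ : 0 < κ) (hσ : 0 < σ) (hN : 1 ≤ N) (hs : 0 < s) (hl : ∀ i, 0 < l i) :
    sideObj κ sg fit U ζ s b t l - sideObj κ sg fit U 0 σ 0 (fun _ => 0) (fun _ => 1 / N) ≤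
      -(κ * c * N) * sideLoss c N U R b t l
        + M * ((κ * C / c + |Real.log σ| + 1 / σ + 1) * K + Real.log N) := by
  unfold sideObj sideLoss
  rw [← Finset.sum_sub_distrib]
  have h1 : ∀ i ∈ Finset.univ, (κ * fit i (t i) b (l i) + reg ζ s (U i + sg * t i) (l i)
      - (κ * fit i 0 0 (1 / N) + reg 0 σ (U i + sg * 0) (1 / N))) ≤
      -(κ * c * N) * rowLoss c N (U i) (R i) b (t i) (l i)
        + (κ * C / c + |Real.log σ| + 1 / σ + 1) * R i + Real.log N := by
    intro i _
    rw [mul_zero, add_zero]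
    exact (H.fit i).crude hc hc1 hC hκ hσ hN hs (hl i)
  refine (Finset.sum_le_sum h1).trans ?_
  rw [Finset.sum_add_distrib, Finset.sum_add_distrib, ← Finset.mul_sum, ← Finset.mul_sum]
  simp only [Finset.sum_const, Finset.card_univ, Fintype.card_fin, nsmul_eq_mul]
  have h2 := mul_le_mul_of_nonneg_left H.sum_R
    (by positivity : 0 ≤ κ * C / c + |Real.log σ| + 1 / σ + 1)
  linarith only [h2]

/-- Cauchy–Schwarz for the square root of the loss against `exp (3 / 2 |U|)` gives the term in `ϖ`;
the bad rows give the term in `1 / N`. All smallness on average is deduced from this sum. -/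
lemma SideControl.sum_aux (H : SideControl c C K σ N fit U R) (hc : 0 < c)
    (hK : 1 ≤ K) (hN : 1 ≤ N) (hl : ∀ i, 0 < l i) {ϖ : ℝ} (hϖ : 0 ≤ ϖ)
    (hQ : sideLoss c N U R b t l ≤ ϖ ^ 2 * M) :
    ∑ i, (√(rowLoss c N (U i) (R i) b (t i) (l i)) * Real.exp (3 / 2 * |U i|)
      + R i / (c * N)) ≤ (K + K / c) * (ϖ + 1 / N) * M := by
  have hN0 : (0 : ℝ) < N := by exact_mod_cast hN
  rw [Finset.sum_add_distrib]
  have h1 : ∑ i, √(rowLoss c N (U i) (R i) b (t i) (l i)) * Real.exp (3 / 2 * |U i|)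
      ≤ K * ϖ * M := by
    refine (Real.sum_mul_le_sqrt_mul_sqrt _ _ _).trans ?_
    have e1 : ∑ i, √(rowLoss c N (U i) (R i) b (t i) (l i)) ^ 2 = sideLoss c N U R b t l := by
      unfold sideLoss
      exact Finset.sum_congr rfl fun i _ => Real.sq_sqrt (rowLoss_nonneg (hl i))
    have e2 : ∑ i, Real.exp (3 / 2 * |U i|) ^ 2 ≤ K * M := by
      refine le_trans (Finset.sum_le_sum fun i _ => ?_) H.sum_R
      rw [← Real.exp_nat_mul]
      have := (H.fit i).exp_pow_le (k := 3) (by norm_num)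
      refine le_of_eq_of_le ?_ this
      congr 1; push_cast; ring
    rw [e1]
    have h2 : √(sideLoss c N U R b t l) ≤ ϖ * √M := by
      rw [Real.sqrt_le_left (by positivity), mul_pow, Real.sq_sqrt (by positivity)]
      exact hQ
    have h3 : √(∑ i, Real.exp (3 / 2 * |U i|) ^ 2) ≤ K * √M := by
      rw [Real.sqrt_le_left (by positivity), mul_pow, Real.sq_sqrt (by positivity)]
      refine e2.trans (mul_le_mul_of_nonneg_right ?_ (by positivity))
      nlinarith
    calc _ ≤ (ϖ * √M) * (K * √M) := mul_le_mul h2 h3 (Real.sqrt_nonneg _) (by positivity)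
      _ = K * ϖ * (√M * √M) := by ring
      _ = K * ϖ * M := by rw [Real.mul_self_sqrt (by positivity)]
  have h2 : ∑ i, R i / (c * N) ≤ K / c * (1 / N) * M := by
    rw [← Finset.sum_div, div_le_iff₀ (by positivity)]
    have e : K / c * (1 / N) * M * (c * N) = K * M := by field_simp
    rw [e]; exact H.sum_R
  have h3 : 0 ≤ K * (1 / N) * M := by positivity
  have h4 : 0 ≤ K / c * ϖ * M := by positivity
  linarith only [h1, h2, h3, h4]

/-- The weight `exp |U|` dominates `1 + |U| + U ^ 2` up to a factor two, so that dropping the rows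
which are not tame perturbs the count and the first two moments by no more than this. -/
lemma SideControl.sum_not_tame (H : SideControl c C K σ N fit U R) (hc : 0 < c) (hc1 : c ≤ 1)
    (hK : 1 ≤ K) (hN : 1 ≤ N) (hl : ∀ i, 0 < l i) {ϖ : ℝ} (hϖ : 0 ≤ ϖ)
    (hQ : sideLoss c N U R b t l ≤ ϖ ^ 2 * M) :
    ∑ i, (if i ∈ tame c N R t l then 0 else Real.exp |U i|) ≤
      (K + K / c) * (ϖ + 1 / N) * M := by
  refine le_trans (Finset.sum_le_sum fun i _ => ?_) (H.sum_aux hc hK hN hl hϖ hQ)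
  have hN0 : (0 : ℝ) < N := by exact_mod_cast hN
  have hR0 : 0 ≤ R i := zero_le_one.trans (H.fit i).one_le
  split_ifs with h
  · positivity
  · exact (H.fit i).exp_le_of_not_tame hc hc1 hN (hl i) (fun hh => h (mem_tame.2 hh))

lemma SideControl.sum_tame (H : SideControl c C K σ N fit U R) (hc : 0 < c)
    (hK : 1 ≤ K) (hN : 1 ≤ N) (hl : ∀ i, 0 < l i) {ϖ : ℝ} (hϖ : 0 ≤ ϖ)
    (hQ : sideLoss c N U R b t l ≤ ϖ ^ 2 * M) :
    ∑ i, (if i ∈ tame c N R t l then (|t i| + l i) * Real.exp |U i| else 0) ≤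
      2 * ((K + K / c) * (ϖ + 1 / N) * M) := by
  refine le_trans ?_ (mul_le_mul_of_nonneg_left (H.sum_aux hc hK hN hl hϖ hQ) zero_le_two)
  rw [Finset.mul_sum]
  refine Finset.sum_le_sum fun i _ => ?_
  have hN0 : (0 : ℝ) < N := by exact_mod_cast hN
  have hR0 : 0 ≤ R i := zero_le_one.trans (H.fit i).one_le
  have h0 : 0 ≤ R i / (c * N) := by positivity
  split_ifs with h
  · have := mul_exp_le_of_tame (U := U i) (b := b) (hl i) (mem_tame.1 h)
    linarith
  · positivity

lemma SideControl.min_abs_le (H : SideControl c C K σ N fit U R) (hc : 0 < c) (hc1 : c ≤ 1)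
    (hK : 1 ≤ K) (hM : 1 ≤ M) (hN : 1 ≤ N) (hl : ∀ i, 0 < l i) {ϖ : ℝ} (hϖ : 0 ≤ ϖ)
    (hQ : sideLoss c N U R b t l ≤ ϖ ^ 2 * M) :
    min |b| 1 ≤ (K + K / c) * (ϖ + 1 / N) := by
  have hM0 : (0 : ℝ) < M := by exact_mod_cast hM
  have h1 := H.sum_aux hc hK hN hl hϖ hQ
  have h2 : ∑ _i : Fin M, min |b| 1 ≤ (K + K / c) * (ϖ + 1 / N) * M :=
    (Finset.sum_le_sum fun i _ => (H.fit i).min_abs_le hc hc1 hN (hl i)).trans h1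
  simp only [Finset.sum_const, Finset.card_univ, Fintype.card_fin, nsmul_eq_mul] at h2
  rw [mul_comm] at h2
  exact le_of_mul_le_mul_right h2 hM0

/-- The empirical moments of the effects over the tame rows. -/
structure MomentsClose (σ e : ℝ) {M : ℕ} (A : Finset (Fin M)) (y l : Fin M → ℝ) : Prop where
  card : |(A.card : ℝ) / M - 1| ≤ e
  mean : |(∑ i ∈ A, y i) / M| ≤ e
  sq : |(∑ i ∈ A, y i ^ 2) / M - σ| ≤ e
  sq_add : |(∑ i ∈ A, (y i ^ 2 + l i)) / M - σ| ≤ e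

/-- Three sources of error: the fluctuation of the true effects (`1 / √M`), the rows left out, and
the shifts `t` and variances `l` on the tame rows. Boundedness of `t` on tame rows makes the
quadratic terms in `t` linear. -/
lemma SideControl.moments (H : SideControl c C K σ N fit U R) (hc : 0 < c) (hc1 : c ≤ 1)
    (hK : 1 ≤ K) (hM : 1 ≤ M) (hN : 1 ≤ N) (hsg : |sg| = 1) (hl : ∀ i, 0 < l i) {ϖ : ℝ}
    (hϖ : 0 ≤ ϖ) (hQ : sideLoss c N U R b t l ≤ ϖ ^ 2 * M) :
    MomentsClose σ (12 * (K + K / c) * (ϖ + 1 / N + 1 / √M)) (tame c N R t l)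
      (fun i => U i + sg * t i) l := by
  have hM0 : (0 : ℝ) < M := by exact_mod_cast hM
  have hN0 : (0 : ℝ) < N := by exact_mod_cast hN
  set A := tame c N R t l with hA
  set B := (K + K / c) * (ϖ + 1 / N) * M with hB
  set e := 12 * (K + K / c) * (ϖ + 1 / N + 1 / √M) with he
  have hB0 : 0 ≤ B := by positivity
  have hKM : K * √M ≤ (K + K / c) * (1 / √M) * M := by
    have h1 : (K + K / c) * (1 / √M) * M = (K + K / c) * √M := by
      have h2 := Real.mul_self_sqrt hM0.le
      have h3 : 0 < √(M : ℝ) := Real.sqrt_pos.2 hM0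
      field_simp; nlinarith
    rw [h1]
    refine mul_le_mul_of_nonneg_right ?_ (Real.sqrt_nonneg _)
    have : 0 ≤ K / c := by positivity
    linarith
  have heM : 12 * B + 12 * (K * √M) ≤ e * M := by
    rw [he, hB]; linarith
  have hKM0 : 0 ≤ K * √M := by positivity
  have h1 := H.sum_not_tame hc hc1 hK hN hl hϖ hQ
  have h2 := H.sum_tame hc hK hN hl hϖ hQ
  rw [← hA, ← hB] at h1 h2
  -- One template for all four moments: `f` is summed over the tame rows at the perturbed effects,
  -- `g` over all rows at the true ones. The constant is `4 * 2 + 2`, the tame sum being bounded by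
  -- `2 B` and the other by `B`.
  have key : ∀ (f g : Fin M → ℝ), (∀ i, |(if i ∈ A then f i else 0) - g i| ≤
      4 * (if i ∈ A then (|t i| + l i) * Real.exp |U i| else 0)
        + 2 * (if i ∈ A then 0 else Real.exp |U i|)) →
      |∑ i ∈ A, f i - ∑ i, g i| ≤ 10 * B := by
    intro f g hfg
    have e1 : ∑ i ∈ A, f i = ∑ i, if i ∈ A then f i else 0 := by
      rw [Finset.sum_ite_mem, Finset.univ_inter]
    rw [e1, ← Finset.sum_sub_distrib]
    refine (Finset.abs_sum_le_sum_abs _ _).trans ((Finset.sum_le_sum fun i _ => hfg i).trans ?_)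
    rw [Finset.sum_add_distrib, ← Finset.mul_sum, ← Finset.mul_sum]
    linarith
  have fin : ∀ x y : ℝ, |x - y| ≤ 10 * B → ∀ z, |y - M * z| ≤ K * √M → |x / M - z| ≤ e := by
    intro x y hxy z hyz
    have : x / M - z = (x - M * z) / M := by field_simp
    rw [this, abs_div, abs_of_pos hM0, div_le_iff₀ hM0]
    have := abs_sub_le x y (M * z)
    linarith
  have hexp : ∀ i, 1 + |U i| + U i ^ 2 ≤ 2 * Real.exp |U i| := fun i => one_add_sq_le_exp _
  have habs2 : ∀ i, |sg * t i| = |t i| := fun i => by rw [abs_mul, hsg, one_mul]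
  have hsq : ∀ i, (sg * t i) ^ 2 = t i ^ 2 := fun i => by rw [← sq_abs, habs2, sq_abs]
  have hone : ∀ i, 1 ≤ Real.exp |U i| := fun i => Real.one_le_exp (abs_nonneg _)
  have hU2 : |∑ i, U i ^ 2 - M * σ| ≤ K * √M := by
    have := H.sum_sq
    rw [Finset.sum_sub_distrib] at this
    simpa using this
  have hquad : ∀ i ∈ A, |2 * U i * (sg * t i) + t i ^ 2| ≤ 4 * (|t i| * Real.exp |U i|) := by
    intro i hi
    have ht1 : |t i| ≤ 1 := (mem_tame.1 hi).2.1
    refine (abs_add_le _ _).trans ?_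
    rw [abs_mul, habs2, abs_mul, abs_two, abs_pow]
    have h3 := hexp i
    have h4 : 2 * |U i| + 1 ≤ 4 * Real.exp |U i| := by
      have := sq_nonneg (U i); have := abs_nonneg (U i); linarith
    have h5 := mul_le_mul_of_nonneg_left h4 (abs_nonneg (t i))
    nlinarith [abs_nonneg (t i)]
  refine ⟨?_, ?_, ?_, ?_⟩
  · have h3 := key (fun _ => 1) (fun _ => 1) (fun i => by
      have := hone i
      have h4 := abs_nonneg (t i)
      have h5 := hl i
      split_ifs
      · simp; positivity
      · simp; linarith)
    simp only [Finset.sum_const, Finset.card_univ, Fintype.card_fin, nsmul_eq_mul, mul_one] at h3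
    exact fin _ _ h3 1 (by simpa using hKM0)
  · have h3 := key (fun i => U i + sg * t i) U (fun i => by
      have := hone i
      have h4 := abs_nonneg (t i)
      have h5 := hl i
      split_ifs
      · rw [add_sub_cancel_left, habs2]
        nlinarith
      · rw [zero_sub, abs_neg]
        have := hexp i; have := sq_nonneg (U i); linarith)
    have := fin _ _ h3 0 (by simpa using H.sum_U)
    simpa using this
  · refine fin _ _ (key (fun i => (U i + sg * t i) ^ 2) (fun i => U i ^ 2) (fun i => ?_)) σ hU2
    have := hone i
    have h4 := abs_nonneg (t i)
    have h5 := hl i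
    split_ifs with hi
    · have e1 : (U i + sg * t i) ^ 2 - U i ^ 2 = 2 * U i * (sg * t i) + t i ^ 2 := by
        rw [← hsq]; ring
      rw [e1]
      have h6 := hquad i hi
      nlinarith
    · rw [zero_sub, abs_neg, abs_of_nonneg (sq_nonneg _)]
      have := hexp i; have := abs_nonneg (U i); linarith
  · refine fin _ _ (key (fun i => (U i + sg * t i) ^ 2 + l i) (fun i => U i ^ 2)
      (fun i => ?_)) σ hU2
    have := hone i
    have h4 := abs_nonneg (t i)
    have h5 := hl i
    split_ifs with hi
    · have e1 : (U i + sg * t i) ^ 2 + l i - U i ^ 2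
          = (2 * U i * (sg * t i) + t i ^ 2) + l i := by
        rw [← hsq]; ring
      rw [e1]
      have h6 := hquad i hi
      have h7 := abs_add_le (2 * U i * (sg * t i) + t i ^ 2) (l i)
      rw [abs_of_pos h5] at h7
      nlinarith
    · rw [zero_sub, abs_neg, abs_of_nonneg (sq_nonneg _)]
      have := hexp i; have := abs_nonneg (U i); linarith

end Side

/-- A lower bound for the dispersion of the effects around any center. -/
lemma MomentsClose.sum_sq_ge {σ e : ℝ} {M : ℕ} {A : Finset (Fin M)} {y l : Fin M → ℝ}
    (H : MomentsClose σ e A y l) (hM : 1 ≤ M) (he : e ≤ 1 / 2)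
    (heσ : e + 2 * e ^ 2 ≤ σ / 2) (ζ : ℝ) : σ / 2 * M ≤ ∑ i ∈ A, (y i - ζ) ^ 2 := by
  have hM0 : (0 : ℝ) < M := by exact_mod_cast hM
  have e1 : ∑ i ∈ A, (y i - ζ) ^ 2 = ((∑ i ∈ A, y i ^ 2) / M - 2 * ζ * ((∑ i ∈ A, y i) / M)
      + ζ ^ 2 * (A.card / M)) * M := by
    have : ∀ i ∈ A, (y i - ζ) ^ 2 = y i ^ 2 - 2 * ζ * y i + ζ ^ 2 := fun i _ => by ring
    rw [Finset.sum_congr rfl this, Finset.sum_add_distrib, Finset.sum_sub_distrib,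
      ← Finset.mul_sum]
    simp only [Finset.sum_const, nsmul_eq_mul]
    field_simp
  rw [e1]
  refine mul_le_mul_of_nonneg_right ?_ hM0.le
  have h0 := abs_le.1 H.card
  have h1 := H.mean
  have h2 := abs_le.1 H.sq
  set T1 := (∑ i ∈ A, y i) / M
  have h3 : T1 ^ 2 ≤ e ^ 2 := by rw [← sq_abs]; exact pow_le_pow_left₀ (abs_nonneg _) h1 2
  have h4 : 1 / 2 * ζ ^ 2 ≤ ζ ^ 2 * (A.card / M) := by
    have : (1 / 2 : ℝ) ≤ A.card / M := by linarith
    nlinarith [sq_nonneg ζ]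
  nlinarith [sq_nonneg (ζ - 2 * T1)]

/-- The gain of one side over the truth once the loss is known to be small. -/
lemma exists_side_refined (c C K κ σ : ℝ) (hc : 0 < c) (hc1 : c ≤ 1) (hC : 0 < C)
    (hK : 1 ≤ K) (hκ : 0 < κ) (hσ : 0 < σ) :
    ∃ D ϖ : ℝ, 0 < D ∧ 0 < ϖ ∧ ∃ N₀ : ℕ, ∀ M N : ℕ, N₀ ≤ M → N₀ ≤ N →
      ∀ (fit : Fin M → ℝ → ℝ → ℝ → ℝ) (U R : Fin M → ℝ), SideControl c C K σ N fit U R →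
      ∀ (sg ζ s b : ℝ) (t l : Fin M → ℝ), |sg| = 1 → 0 < s → (∀ i, 0 < l i) →
        sideLoss c N U R b t l ≤ ϖ ^ 2 * M →
        sideObj κ sg fit U ζ s b t l - sideObj κ sg fit U 0 σ 0 (fun _ => 0) (fun _ => 1 / N) ≤
          -(κ * c / 2 * N) * sideLoss c N U R b t l + D * M := by
  set L := 12 * (K + K / c) with hL
  have hL0 : 0 < L := by positivity
  set e₀ : ℝ := min (1 / 2) (σ / 4) with he0
  have he0p : 0 < e₀ := by positivity
  set D₀ := κ * C / c + |Real.log σ| + 1 / σ + 1 + |Real.log (κ * c)| + 1 / c ^ 2 with hD0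
  have hD0p : 0 < D₀ := by positivity
  -- `ϖ` and the threshold make each of the three terms of the moment error at most `e₀ / 3`.
  refine ⟨D₀ * K + |Real.log (σ / 2)|, e₀ / (3 * L), by positivity, by positivity,
    max 1 (max ⌈3 * L / e₀⌉₊ ⌈(3 * L / e₀) ^ 2⌉₊), ?_⟩
  intro M N hM' hN' fit U R H sg ζ s b t l hsg hs hl hQ
  have hM : 1 ≤ M := (le_max_left _ _).trans hM'
  have hN : 1 ≤ N := (le_max_left _ _).trans hN'
  have hM0 : (0 : ℝ) < M := by exact_mod_cast hM
  have hN0 : (0 : ℝ) < N := by exact_mod_cast hN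
  have hN3 : 3 * L / e₀ ≤ N := by
    refine (Nat.le_ceil _).trans ?_
    exact_mod_cast (le_max_left _ _).trans ((le_max_right _ _).trans hN')
  have hM3 : 3 * L / e₀ ≤ √M := by
    apply Real.le_sqrt_of_sq_le
    refine (Nat.le_ceil _).trans ?_
    exact_mod_cast (le_max_right _ _).trans ((le_max_right _ _).trans hM')
  have hϖ0 : 0 ≤ e₀ / (3 * L) := by positivity
  have hmom := H.moments hc hc1 hK hM hN hsg hl hϖ0 hQ
  rw [← hL] at hmom
  have hinv : ∀ x : ℝ, 0 < x → 3 * L / e₀ ≤ x → 1 / x ≤ e₀ / (3 * L) := by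
    intro x hx h
    rw [div_le_div_iff₀ hx (by positivity)]
    rw [div_le_iff₀ he0p] at h; linarith
  have hle : L * (e₀ / (3 * L) + 1 / N + 1 / √M) ≤ e₀ := by
    have h1 := hinv N hN0 hN3
    have h2 := hinv (√M) (Real.sqrt_pos.2 hM0) hM3
    have h3 : L * (e₀ / (3 * L)) = e₀ / 3 := by field_simp
    have h4 := mul_le_mul_of_nonneg_left h1 hL0.le
    have h5 := mul_le_mul_of_nonneg_left h2 hL0.le
    linarith only [h3, h4, h5]
  set e := L * (e₀ / (3 * L) + 1 / N + 1 / √M) with he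
  have hepos : 0 ≤ e := by positivity
  have he1 : e ≤ 1 / 2 := hle.trans (min_le_left _ _)
  have he2 : e ≤ σ / 4 := hle.trans (min_le_right _ _)
  have hge := hmom.sum_sq_ge hM he1 (by nlinarith) ζ
  -- the contribution of the prior
  have hprior : ∑ i, (open Classical in if R i ≤ c * N ^ 4 then
      -(1 / 2) * Real.log s - (U i + sg * t i - ζ) ^ 2 / (2 * s) else 0)
        ≤ |Real.log (σ / 2)| * M := by
    -- Only `s < 1` can bring a gain through `-log s / 2`. It is paid for by the dispersion of the
    -- effects, at least `σ M / 2` around any center: `log (1 / s)` is at most `(σ / 2) / s` up to a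
    -- constant.
    rcases le_total 1 s with h1 | h1
    · have h2 : 0 ≤ |Real.log (σ / 2)| * M := by positivity
      refine le_trans (Finset.sum_nonpos fun i _ => ?_) h2
      split_ifs
      · have := Real.log_nonneg h1
        have : 0 ≤ (U i + sg * t i - ζ) ^ 2 / (2 * s) := by positivity
        linarith
      · exact le_rfl
    · have hlog : Real.log s ≤ 0 := Real.log_nonpos hs.le h1
      have h2 : ∀ i ∈ Finset.univ, (open Classical in if R i ≤ c * N ^ 4 then
          -(1 / 2) * Real.log s - (U i + sg * t i - ζ) ^ 2 / (2 * s) else 0) ≤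
          -(1 / 2) * Real.log s
            - (if i ∈ tame c N R t l then (U i + sg * t i - ζ) ^ 2 else 0) / (2 * s) := by
        intro i _
        by_cases hi : i ∈ tame c N R t l
        · rw [if_pos hi, if_pos (mem_tame.1 hi).1]
        · rw [if_neg hi, zero_div, sub_zero]
          split_ifs
          · have : 0 ≤ (U i + sg * t i - ζ) ^ 2 / (2 * s) := by positivity
            linarith
          · linarith
      refine (Finset.sum_le_sum h2).trans ?_
      rw [Finset.sum_sub_distrib, ← Finset.sum_div, Finset.sum_ite_mem, Finset.univ_inter]
      simp only [Finset.sum_const, Finset.card_univ, Fintype.card_fin, nsmul_eq_mul]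
      have h3 : σ / 2 * M / (2 * s) ≤
          (∑ i ∈ tame c N R t l, (U i + sg * t i - ζ) ^ 2) / (2 * s) :=
        div_le_div_of_nonneg_right hge (by positivity)
      have h4 := half_log_le (a := σ / 2) (x := s⁻¹) (by positivity) (by positivity)
      rw [Real.log_inv] at h4
      have h5 : σ / 2 * M / (2 * s) = 1 / 2 * M * (σ / 2 * s⁻¹) := by field_simp
      have h6 := mul_le_mul_of_nonneg_left h4 (by positivity : 0 ≤ 1 / 2 * (M : ℝ))
      have h7 : -Real.log (σ / 2) * M ≤ |Real.log (σ / 2)| * M :=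
        mul_le_mul_of_nonneg_right (neg_le_abs _) hM0.le
      have h8 : 0 ≤ |Real.log (σ / 2)| * M := by positivity
      linarith only [h3, h5, h6, h7, h8]
  unfold sideObj
  rw [← Finset.sum_sub_distrib]
  have h1 : ∀ i ∈ Finset.univ, (κ * fit i (t i) b (l i) + reg ζ s (U i + sg * t i) (l i)
      - (κ * fit i 0 0 (1 / N) + reg 0 σ (U i + sg * 0) (1 / N))) ≤
      -(κ * c / 2 * N) * rowLoss c N (U i) (R i) b (t i) (l i) + D₀ * R i
        + (open Classical in if R i ≤ c * N ^ 4 then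
            -(1 / 2) * Real.log s - (U i + sg * t i - ζ) ^ 2 / (2 * s) else 0) := by
    intro i _
    rw [mul_zero, add_zero]
    exact (H.fit i).refined hc hc1 hC hκ hσ hN hs (hl i)
  refine (Finset.sum_le_sum h1).trans ?_
  rw [Finset.sum_add_distrib, Finset.sum_add_distrib, ← Finset.mul_sum, ← Finset.mul_sum]
  unfold sideLoss
  have h2 := mul_le_mul_of_nonneg_left H.sum_R hD0p.le
  linarith only [h2, hprior]

/-- The averaged gain in the random-effects part, in terms of the empirical moments. -/
noncomputable def profileGain (σ ζ s : ℝ) {M : ℕ} (A : Finset (Fin M)) (y l : Fin M → ℝ) : ℝ :=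
  (A.card : ℝ) / M * Real.log (σ / s) - ((∑ i ∈ A, (y i ^ 2 + l i)) / M
    - 2 * ζ * ((∑ i ∈ A, y i) / M) + ζ ^ 2 * ((A.card : ℝ) / M)) / s
    + (∑ i ∈ A, (y i ^ 2 + l i)) / M / σ

/-- The two terms contain the same `log l`, which cancels. What remains is affine in `1`, `y` and `y
^ 2 + l`, so only the empirical moments over `A` matter. -/
lemma sum_reg_sub {σ ζ s : ℝ} (hσ : 0 < σ) (hs : 0 < s) {M : ℕ} (hM : 1 ≤ M)
    (A : Finset (Fin M)) (y l : Fin M → ℝ) (hl : ∀ i, 0 < l i) :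
    ∑ i ∈ A, (reg ζ s (y i) (l i) - reg 0 σ (y i) (l i)) = M / 2 * profileGain σ ζ s A y l := by
  have hM0 : (0 : ℝ) < M := by exact_mod_cast hM
  have h1 : ∀ i ∈ A, reg ζ s (y i) (l i) - reg 0 σ (y i) (l i) =
      1 / 2 * (Real.log (σ / s) + (2 * ζ / s) * y i - ζ ^ 2 / s
        + (1 / σ - 1 / s) * (y i ^ 2 + l i)) := by
    intro i _
    unfold reg
    rw [Real.log_div (hl i).ne' hs.ne', Real.log_div (hl i).ne' hσ.ne',
      Real.log_div hσ.ne' hs.ne']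
    field_simp
    ring
  rw [Finset.sum_congr rfl h1, ← Finset.mul_sum, Finset.sum_add_distrib, Finset.sum_sub_distrib,
    Finset.sum_add_distrib, ← Finset.mul_sum, ← Finset.mul_sum]
  simp only [Finset.sum_const, nsmul_eq_mul]
  unfold profileGain
  field_simp
  ring

/-- The gain of one side over the point with the true parameters and the same slope, whose
deviations are reset to zero in the rows that are not tame. -/
lemma exists_side_truncate (c C K κ σ : ℝ) (hc : 0 < c) (hc1 : c ≤ 1) (hC : 0 < C)
    (hK : 1 ≤ K) (hκ : 0 < κ) (hσ : 0 < σ) :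
    ∃ D : ℝ, 0 < D ∧ ∃ N₀ : ℕ, ∀ M N : ℕ, 1 ≤ M → N₀ ≤ N →
      ∀ (fit : Fin M → ℝ → ℝ → ℝ → ℝ) (U R : Fin M → ℝ), SideControl c C K σ N fit U R →
      ∀ (sg b : ℝ) (t l : Fin M → ℝ), |b| ≤ c → (∀ i, 0 < l i) →
      ∃ t' l' : Fin M → ℝ, (∀ i, 0 < l' i) ∧ ∀ ζ s : ℝ, 0 < s →
        sideObj κ sg fit U ζ s b t l - sideObj κ sg fit U 0 σ b t' l' ≤
          M / 2 * profileGain σ ζ s (tame c N R t l) (fun i => U i + sg * t i) l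
            + D * (M / N) := by
  obtain ⟨D, hD, N₀, hN₀⟩ := exists_truncate c C κ σ hc hc1 hC hκ hσ
  refine ⟨D * K, by positivity, max 1 N₀, ?_⟩
  intro M N hM hN' fit U R H sg b t l hb hl
  have hN : 1 ≤ N := (le_max_left _ _).trans hN'
  have hM0 : (0 : ℝ) < M := by exact_mod_cast hM
  have hN0 : (0 : ℝ) < N := by exact_mod_cast hN
  set A := tame c N R t l with hA
  -- On tame rows the comparison point keeps `t` and `l`, so the likelihood parts cancel
  -- identically. The other rows are reset to level zero and variance `1 / N`, at a total cost `D *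
  -- (M / N)`. The choice does not involve `ζ` and `s`.
  refine ⟨fun i => if i ∈ A then t i else 0, fun i => if i ∈ A then l i else 1 / N, ?_, ?_⟩
  · intro i
    dsimp only
    split_ifs
    · exact hl i
    · positivity
  intro ζ s hs
  rw [← sum_reg_sub hσ hs hM A _ l hl]
  have e1 : ∑ i ∈ A, (reg ζ s (U i + sg * t i) (l i) - reg 0 σ (U i + sg * t i) (l i))
      = ∑ i, if i ∈ A then (reg ζ s (U i + sg * t i) (l i) - reg 0 σ (U i + sg * t i) (l i))
        else 0 := by
    rw [Finset.sum_ite_mem, Finset.univ_inter]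
  have e2 : D * K * (M / N) ≥ ∑ i, D * R i / N := by
    rw [← Finset.sum_div, ← Finset.mul_sum, ge_iff_le, div_le_iff₀ hN0]
    have := mul_le_mul_of_nonneg_left H.sum_R hD.le
    refine this.trans_eq ?_
    field_simp
  unfold sideObj
  rw [e1, ← Finset.sum_sub_distrib]
  refine le_trans ?_ (add_le_add_right e2 _)
  rw [← Finset.sum_add_distrib]
  refine Finset.sum_le_sum fun i _ => ?_
  have hR0 : 0 ≤ R i := zero_le_one.trans (H.fit i).one_le
  have h0 : 0 ≤ D * R i / N := by positivity
  dsimp only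
  by_cases hi : i ∈ A
  · simp only [if_pos hi]
    linarith only [h0]
  · simp only [if_neg hi, mul_zero, add_zero, zero_add]
    exact hN₀ N ((le_max_right _ _).trans hN') _ _ _ (H.fit i) ζ s _ b (t i) (l i) hs (hl i) hb
      (fun h => hi (mem_tame.2 h))


/-! ### Both sides together: the deterministic rate -/

lemma FitControl.mono {c c' C C' : ℝ} {N : ℕ} {fit : ℝ → ℝ → ℝ → ℝ} {U R : ℝ}
    (H : FitControl c C N fit U R) (hc : c' ≤ c) (hC : C ≤ C') : FitControl c' C' N fit U R := by
  have hR0 : 0 ≤ R := zero_le_one.trans H.one_le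
  have hgood : R ≤ c' * N ^ 4 → R ≤ c * N ^ 4 := fun h => h.trans (by gcongr)
  refine ⟨H.exp_le, ?_, ?_, ?_⟩
  · intro h t b l hl
    refine (H.good (hgood h) t b l hl).trans ?_
    have hm := mq_nonneg (le_max_of_le_left (abs_nonneg t) : 0 ≤ max |t| |b|)
    gcongr
  · intro h t b l hb hl hf
    refine (H.far (hgood h) t b l (hb.trans hc) hl hf).trans ?_
    gcongr
  · intro t b b' l hb hl
    refine (H.bad t b b' l hb hl).trans ?_
    gcongr

lemma SideControl.mono {c c' C C' K K' σ : ℝ} {M N : ℕ} {fit : Fin M → ℝ → ℝ → ℝ → ℝ}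
    {U R : Fin M → ℝ} (H : SideControl c C K σ N fit U R) (hc : c' ≤ c) (hC : C ≤ C')
    (hK : K ≤ K') : SideControl c' C' K' σ N fit U R :=
  ⟨fun i => (H.fit i).mono hc hC, H.sum_R.trans (by gcongr), H.sum_U.trans (by gcongr),
    H.sum_sq.trans (by gcongr)⟩

lemma MomentsClose.mono {σ e e' : ℝ} {M : ℕ} {A : Finset (Fin M)} {y l : Fin M → ℝ}
    (H : MomentsClose σ e A y l) (he : e ≤ e') : MomentsClose σ e' A y l :=
  ⟨H.card.trans he, H.mean.trans he, H.sq.trans he, H.sq_add.trans he⟩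

lemma exists_log_div_le (D : ℝ) {ε : ℝ} (hε : 0 < ε) :
    ∃ N₀ : ℕ, ∀ N : ℕ, N₀ ≤ N → D + Real.log N ≤ ε * N := by
  refine ⟨max 1 ⌈((|D| + 2) / ε) ^ 2⌉₊, fun N hN => ?_⟩
  have hN1 : (1 : ℝ) ≤ N := by exact_mod_cast (le_max_left _ _).trans hN
  have h2 : (|D| + 2) / ε ≤ √N := by
    apply Real.le_sqrt_of_sq_le
    refine (Nat.le_ceil _).trans ?_
    exact_mod_cast (le_max_right _ _).trans hN
  rw [div_le_iff₀ hε] at h2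
  have h3 := Real.mul_self_sqrt (by linarith : (0 : ℝ) ≤ N)
  have h1 : 1 ≤ √(N : ℝ) := Real.one_le_sqrt.2 hN1
  have h4 : Real.log N ≤ 2 * √(N : ℝ) := by
    have h5 : Real.log N = 2 * Real.log √(N : ℝ) := by rw [Real.log_sqrt (by linarith)]; ring
    have := Real.log_le_sub_one_of_pos (by linarith : 0 < √(N : ℝ))
    linarith
  have h5 : D ≤ |D| * √(N : ℝ) := (le_abs_self D).trans (le_mul_of_one_le_right (abs_nonneg _) h1)
  have h6 := mul_le_mul_of_nonneg_right h2 (Real.sqrt_nonneg (N : ℝ))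
  nlinarith

lemma exists_rate_le {ρ : ℝ} (hρ : 0 < ρ) :
    ∃ N₀ : ℕ, ∀ m n : ℕ, N₀ ≤ m → N₀ ≤ n → 1 / √(m : ℝ) + 1 / √(n : ℝ) ≤ ρ := by
  refine ⟨max 1 ⌈(2 / ρ) ^ 2⌉₊, ?_⟩
  have key : ∀ N : ℕ, max 1 ⌈(2 / ρ) ^ 2⌉₊ ≤ N → 1 / √(N : ℝ) ≤ ρ / 2 := by
    intro N hN
    have hN1 : (1 : ℝ) ≤ N := by exact_mod_cast (le_max_left _ _).trans hN
    have h2 : 2 / ρ ≤ √N := by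
      apply Real.le_sqrt_of_sq_le
      refine (Nat.le_ceil _).trans ?_
      exact_mod_cast (le_max_right _ _).trans hN
    have h1 : 0 < √(N : ℝ) := Real.sqrt_pos.2 (by linarith)
    rw [div_le_iff₀ hρ] at h2
    rw [div_le_iff₀ h1]; linarith
  intro m n hm hn
  have := key m hm
  have := key n hn
  linarith

/-- Any point of the parameter space which dominates a neighbourhood of the true parameters (with
arbitrary variational parameters) is close to the true parameters. -/
theorem exists_rate (c C K κ σr σc δ cmn : ℝ) (hc : 0 < c) (hc1 : c ≤ 1) (hC : 0 < C)
    (hK : 1 ≤ K) (hκ : 0 < κ) (hσr : 0 < σr) (hσc : 0 < σc) (hδ : 0 < δ) (hcmn : 0 < cmn) :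
    ∃ D : ℝ, 0 < D ∧ ∃ N₀ : ℕ, ∀ m n : ℕ, N₀ ≤ m → N₀ ≤ n → cmn * n ≤ m →
      ∀ (fr : Fin m → ℝ → ℝ → ℝ → ℝ) (Ur Rr : Fin m → ℝ), SideControl c C K σr n fr Ur Rr →
      ∀ (fc : Fin n → ℝ → ℝ → ℝ → ℝ) (Uc Rc : Fin n → ℝ), SideControl c C K σc m fc Uc Rc →
      ∀ (sg ζr sr ζc sc b : ℝ) (tr lr : Fin m → ℝ) (tc lc : Fin n → ℝ), |sg| = 1 → 0 < sr →
        0 < sc → (∀ i, 0 < lr i) → (∀ j, 0 < lc j) →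
        (∀ (ζr' sr' ζc' sc' b' : ℝ) (tr' lr' : Fin m → ℝ) (tc' lc' : Fin n → ℝ), 0 < sr' →
          0 < sc' → (∀ i, 0 < lr' i) → (∀ j, 0 < lc' j) → |ζr'| < δ → |sr' - σr| < δ →
          |ζc'| < δ → |sc' - σc| < δ → |b'| < δ →
          sideObj κ sg fr Ur ζr' sr' b' tr' lr' + sideObj κ sg fc Uc ζc' sc' b' tc' lc' ≤
            sideObj κ sg fr Ur ζr sr b tr lr + sideObj κ sg fc Uc ζc sc b tc lc) →
        |ζr| ≤ D * (1 / √m + 1 / √n) ∧ |sr - σr| ≤ D * (1 / √m + 1 / √n) ∧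
        |ζc| ≤ D * (1 / √m + 1 / √n) ∧ |sc - σc| ≤ D * (1 / √m + 1 / √n) ∧
        |b| ≤ D * (1 / √m + 1 / √n) := by
  obtain ⟨D₁, ϖ₁, hD₁, hϖ₁, N₁, href₁⟩ := exists_side_refined c C K κ σr hc hc1 hC hK hκ hσr
  obtain ⟨D₂, ϖ₂, hD₂, hϖ₂, N₂, href₂⟩ := exists_side_refined c C K κ σc hc hc1 hC hK hκ hσc
  obtain ⟨D₃, hD₃, N₃, htr₁⟩ := exists_side_truncate c C K κ σr hc hc1 hC hK hκ hσr
  obtain ⟨D₄, hD₄, N₄, htr₂⟩ := exists_side_truncate c C K κ σc hc hc1 hC hK hκ hσc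
  obtain ⟨G₁, e₁, hG₁, he₁, hgr₁⟩ := gaussian_profile_growth hσr
  obtain ⟨G₂, e₂, hG₂, he₂, hgr₂⟩ := gaussian_profile_growth hσc
  set F₁ := (κ * C / c + |Real.log σr| + 1 / σr + 1) * K with hF₁
  set F₂ := (κ * C / c + |Real.log σc| + 1 / σc + 1) * K with hF₂
  set ϖ := min ϖ₁ ϖ₂ with hϖ
  have hϖ0 : 0 < ϖ := lt_min hϖ₁ hϖ₂
  have hκc : 0 < κ * c := mul_pos hκ hc
  obtain ⟨N₅, hN₅⟩ := exists_log_div_le F₁ (ε := κ * c * ϖ ^ 2 / 2) (by positivity)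
  obtain ⟨N₆, hN₆⟩ := exists_log_div_le F₂ (ε := κ * c * ϖ ^ 2 / 2) (by positivity)
  -- constants of the successive rates
  set B := 2 * (D₁ + D₂) / (κ * c) with hB
  have hB0 : 0 < B := by positivity
  set Kc := K + K / c with hKc
  have hKc0 : 0 < Kc := by positivity
  set E := 12 * Kc * (√B + 2) with hE
  have hE0 : 0 < E := by positivity
  set H₁ := 2 * D₃ + (2 * D₄ + G₂ * E ^ 2) / cmn with hH₁
  have hH₁0 : 0 < H₁ := by positivity
  set A₁ := G₁ * (E + √H₁) with hA₁
  have hA₁0 : 0 < A₁ := by positivity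
  set A₂ := G₂ * (E + √(2 * D₄)) with hA₂
  have hA₂0 : 0 < A₂ := by positivity
  set ρ : ℝ := min (min (min 1 (e₁ / E)) (min (e₂ / E) (e₁ / H₁)))
    (min (min (e₂ / (2 * D₄)) (δ / (2 * A₁))) (min (c / E) (min (δ / (2 * E)) (1 / (2 * E))))) with hρ
  have hρ0 : 0 < ρ := by positivity
  obtain ⟨N₇, hN₇⟩ := exists_rate_le hρ0
  refine ⟨E + A₁ + A₂, by positivity, (1 + N₁ + N₂ + N₃ + N₄ + N₅ + N₆ + N₇), ?_⟩
  intro m n hm hn hmn fr Ur Rr Hr fc Uc Rc Hc sg ζr sr ζc sc b tr lr tc lc hsg hsr hsc hlr hlc hdom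
  have hm1 : 1 ≤ m := by omega
  have hn1 : 1 ≤ n := by omega
  have hm0 : (0 : ℝ) < m := by exact_mod_cast hm1
  have hn0 : (0 : ℝ) < n := by exact_mod_cast hn1
  set r : ℝ := 1 / √(m : ℝ) + 1 / √(n : ℝ) with hr
  have hrρ : r ≤ ρ := hN₇ m n (by omega) (by omega)
  have hsm : 0 < √(m : ℝ) := Real.sqrt_pos.2 hm0
  have hsn : 0 < √(n : ℝ) := Real.sqrt_pos.2 hn0
  have hr0 : 0 < r := by positivity
  have hr1 : r ≤ 1 := by
    refine hrρ.trans ?_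
    exact (min_le_left _ _).trans ((min_le_left _ _).trans (min_le_left _ _))
  have hrE1 : r ≤ e₁ / E := by
    refine hrρ.trans ?_
    exact (min_le_left _ _).trans ((min_le_left _ _).trans (min_le_right _ _))
  have hrE2 : r ≤ e₂ / E := by
    refine hrρ.trans ?_
    exact (min_le_left _ _).trans ((min_le_right _ _).trans (min_le_left _ _))
  have hrH : r ≤ e₁ / H₁ := by
    refine hrρ.trans ?_
    exact (min_le_left _ _).trans ((min_le_right _ _).trans (min_le_right _ _))
  have hrD : r ≤ e₂ / (2 * D₄) := by
    refine hrρ.trans ?_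
    exact (min_le_right _ _).trans ((min_le_left _ _).trans (min_le_left _ _))
  have hrA : r ≤ δ / (2 * A₁) := by
    refine hrρ.trans ?_
    exact (min_le_right _ _).trans ((min_le_left _ _).trans (min_le_right _ _))
  have hrc : r ≤ c / E := by
    refine hrρ.trans ?_
    exact (min_le_right _ _).trans ((min_le_right _ _).trans (min_le_left _ _))
  have hrδ : r ≤ δ / (2 * E) := by
    refine hrρ.trans ?_
    exact (min_le_right _ _).trans ((min_le_right _ _).trans
      ((min_le_right _ _).trans (min_le_left _ _)))
  have hr2E : r ≤ 1 / (2 * E) := by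
    refine hrρ.trans ?_
    exact (min_le_right _ _).trans ((min_le_right _ _).trans
      ((min_le_right _ _).trans (min_le_right _ _)))
  clear_value ρ
  have him : 1 / (m : ℝ) ≤ r ^ 2 := by
    have h1 : (1 / √(m : ℝ)) ^ 2 = 1 / m := by rw [div_pow, Real.sq_sqrt hm0.le, one_pow]
    rw [← h1]
    exact pow_le_pow_left₀ (by positivity) (le_add_of_nonneg_right (by positivity)) 2
  have hin : 1 / (n : ℝ) ≤ r ^ 2 := by
    have h1 : (1 / √(n : ℝ)) ^ 2 = 1 / n := by rw [div_pow, Real.sq_sqrt hn0.le, one_pow]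
    rw [← h1]
    exact pow_le_pow_left₀ (by positivity) (le_add_of_nonneg_left (by positivity)) 2
  have hr2 : r ^ 2 ≤ r := pow_le_of_le_one hr0.le hr1 two_ne_zero
  have hQr0 := sideLoss_nonneg (c := c) (N := n) (U := Ur) (R := Rr) (b := b) (t := tr) hlr
  have hQc0 := sideLoss_nonneg (c := c) (N := m) (U := Uc) (R := Rc) (b := b) (t := tc) hlc
  set Qr := sideLoss c n Ur Rr b tr lr with hQr
  set Qc := sideLoss c m Uc Rc b tc lc with hQc
  -- comparison with the truth
  have htruth := hdom 0 σr 0 σc 0 (fun _ => 0) (fun _ => 1 / n) (fun _ => 0) (fun _ => 1 / m)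
    hσr hσc (fun _ => by positivity) (fun _ => by positivity) (by simpa using hδ)
    (by simpa using hδ) (by simpa using hδ) (by simpa using hδ) (by simpa using hδ)
  -- The crude gain bounds `n Qr + m Qc` by constants times `m (1 + log n) + n (1 + log m)`, which
  -- is `o(m n)`. This is just enough to make the refined bound applicable.
  have hsmall : Qr ≤ ϖ ^ 2 * m ∧ Qc ≤ ϖ ^ 2 * n := by
    have h1 := Hr.crude hc hc1 hC hκ hσr hn1 hsr hlr (ζ := ζr) (b := b) (t := tr) (sg := sg)
    have h2 := Hc.crude hc hc1 hC hκ hσc hm1 hsc hlc (ζ := ζc) (b := b) (t := tc) (sg := sg)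
    rw [← hF₁, ← hQr] at h1
    rw [← hF₂, ← hQc] at h2
    have h3 := mul_le_mul_of_nonneg_left (hN₅ n (by omega)) hm0.le
    have h4 := mul_le_mul_of_nonneg_left (hN₆ m (by omega)) hn0.le
    have h5 : κ * c * (n * Qr + m * Qc) ≤ κ * c * (ϖ ^ 2 * (m * n)) := by
      linarith only [h1, h2, h3, h4, htruth]
    have h6 := le_of_mul_le_mul_left h5 hκc
    constructor
    · have h7 : 0 ≤ m * Qc := by positivity
      have h8 : n * Qr ≤ n * (ϖ ^ 2 * m) := by linarith only [h6, h7]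
      exact le_of_mul_le_mul_left h8 hn0
    · have h7 : 0 ≤ n * Qr := by positivity
      have h8 : m * Qc ≤ m * (ϖ ^ 2 * n) := by linarith only [h6, h7]
      exact le_of_mul_le_mul_left h8 hm0
  -- refined comparison
  set w := √B * r with hw
  have hw0 : 0 ≤ w := by positivity
  have hw2 : w ^ 2 = B * r ^ 2 := by rw [hw, mul_pow, Real.sq_sqrt hB0.le]
  -- Without the logarithms `n Qr + m Qc` is at most `B (m + n)`, and `m + n ≤ r ^ 2 m n`: the mean
  -- loss of either side is of order `r ^ 2`.
  have hloss : Qr ≤ w ^ 2 * m ∧ Qc ≤ w ^ 2 * n := by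
    have h1 := href₁ m n (by omega) (by omega) fr Ur Rr Hr sg ζr sr b tr lr hsg hsr hlr
      (hsmall.1.trans (by gcongr; exact min_le_left _ _))
    have h2 := href₂ n m (by omega) (by omega) fc Uc Rc Hc sg ζc sc b tc lc hsg hsc hlc
      (hsmall.2.trans (by gcongr; exact min_le_right _ _))
    rw [← hQr] at h1
    rw [← hQc] at h2
    have h5 : κ * c / 2 * (n * Qr + m * Qc) ≤ κ * c / 2 * (B * (m + n)) := by
      have h6 : κ * c / 2 * (B * (m + n)) = (D₁ + D₂) * (m + n) := by rw [hB]; field_simp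
      have h7 : 0 ≤ D₁ * n := by positivity
      have h8 : 0 ≤ D₂ * m := by positivity
      linarith only [h1, h2, h6, htruth, h7, h8]
    have h6 := le_of_mul_le_mul_left h5 (by positivity)
    have h9 : (m : ℝ) + n ≤ r ^ 2 * (m * n) := by
      have h10 : 1 / (m : ℝ) + 1 / n ≤ r ^ 2 := by
        have e1 : r ^ 2 = 1 / m + 1 / n + 2 * (1 / √(m : ℝ) * (1 / √(n : ℝ))) := by
          have h1 : (1 / √(m : ℝ)) ^ 2 = 1 / m := by rw [div_pow, Real.sq_sqrt hm0.le, one_pow]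
          have h2 : (1 / √(n : ℝ)) ^ 2 = 1 / n := by rw [div_pow, Real.sq_sqrt hn0.le, one_pow]
          rw [hr, ← h1, ← h2]; ring
        have : 0 ≤ 2 * (1 / √(m : ℝ) * (1 / √(n : ℝ))) := by positivity
        linarith only [e1, this]
      have e2 : (m : ℝ) + n = (1 / (m : ℝ) + 1 / n) * (m * n) := by field_simp; ring
      rw [e2]; gcongr
    have h11 : n * Qr + m * Qc ≤ B * (r ^ 2 * (m * n)) := h6.trans (by gcongr)
    rw [hw2]
    constructor
    · have h7 : 0 ≤ m * Qc := by positivity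
      have h8 : n * Qr ≤ n * (B * r ^ 2 * m) := by linarith only [h11, h7]
      exact le_of_mul_le_mul_left h8 hn0
    · have h7 : 0 ≤ n * Qr := by positivity
      have h8 : m * Qc ≤ m * (B * r ^ 2 * n) := by linarith only [h11, h7]
      exact le_of_mul_le_mul_left h8 hm0
  have hwr : w + 1 / n ≤ (√B + 1) * r := by rw [hw]; linarith only [hin, hr2]
  have hwr' : w + 1 / m ≤ (√B + 1) * r := by rw [hw]; linarith only [him, hr2]
  -- the slope
  have hbE : |b| ≤ E * r := by
    have h1 := Hr.min_abs_le hc hc1 hK hm1 hn1 hlr hw0 hloss.1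
    rw [← hKc] at h1
    have h2 : min |b| 1 ≤ E * r / 2 := by
      refine h1.trans ((mul_le_mul_of_nonneg_left hwr hKc0.le).trans ?_)
      rw [hE]
      have h3 : 0 ≤ Kc * √B * r := by positivity
      have h4 : 0 ≤ Kc * r := by positivity
      linarith only [h3, h4]
    -- This excludes the alternative that `min |b| 1` equals one.
    have h3 : E * r ≤ 1 / 2 := by
      have := mul_le_mul_of_nonneg_left hr2E hE0.le
      have e : E * (1 / (2 * E)) = 1 / 2 := by field_simp
      linarith only [this, e]
    rcases min_le_iff.1 h2 with h | h
    · have : 0 ≤ E * r := by positivity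
      linarith only [h, this]
    · linarith only [h, h3]
  have hbc : |b| ≤ c := by
    refine hbE.trans ?_
    rw [le_div_iff₀ hE0] at hrc; linarith only [hrc]
  have hbδ : |b| < δ := by
    refine lt_of_le_of_lt hbE ?_
    rw [le_div_iff₀ (by positivity)] at hrδ; linarith only [hrδ, hδ]
  -- moments
  set e := E * r with he
  have he0 : 0 ≤ e := by positivity
  have hee₁ : e ≤ e₁ := by rw [le_div_iff₀ hE0] at hrE1; linarith only [hrE1, he]
  have hee₂ : e ≤ e₂ := by rw [le_div_iff₀ hE0] at hrE2; linarith only [hrE2, he]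
  have hmr : 1 / √(m : ℝ) ≤ r := le_add_of_nonneg_right (by positivity)
  have hnr : 1 / √(n : ℝ) ≤ r := le_add_of_nonneg_left (by positivity)
  have Mr := (Hr.moments hc hc1 hK hm1 hn1 hsg hlr hw0 hloss.1).mono (e' := e) (by
    rw [he, hE, ← hKc, mul_assoc (12 * Kc)]
    refine mul_le_mul_of_nonneg_left ?_ (by positivity)
    linarith only [hwr, hmr])
  have Mc := (Hc.moments hc hc1 hK hn1 hm1 hsg hlc hw0 hloss.2).mono (e' := e) (by
    rw [he, hE, ← hKc, mul_assoc (12 * Kc)]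
    refine mul_le_mul_of_nonneg_left ?_ (by positivity)
    linarith only [hwr', hnr])
  obtain ⟨tr', lr', hlr', hcr⟩ := htr₁ m n hm1 (by omega) fr Ur Rr Hr sg b tr lr hbc hlr
  obtain ⟨tc', lc', hlc', hcc⟩ := htr₂ n m hn1 (by omega) fc Uc Rc Hc sg b tc lc hbc hlc
  obtain ⟨-, hgr⟩ := hgr₁ _ _ _ ζr sr e hsr he0 hee₁ Mr.card Mr.mean Mr.sq_add
  obtain ⟨hgcu, hgc⟩ := hgr₂ _ _ _ ζc sc e hsc he0 hee₂ Mc.card Mc.mean Mc.sq_add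
  set Pr := profileGain σr ζr sr (tame c n Rr tr lr) (fun i => Ur i + sg * tr i) lr with hPr
  set Pc := profileGain σc ζc sc (tame c m Rc tc lc) (fun i => Uc i + sg * tc i) lc with hPc
  have hgcu' : Pc ≤ G₂ * e ^ 2 := hgcu
  have hmnr : (n : ℝ) / m ≤ 1 / cmn := by
    rw [div_le_div_iff₀ hm0 hcmn]; linarith only [hmn]
  -- rows
  have hrows : -(H₁ * r ^ 2) ≤ Pr := by
    -- The column parameters are not yet known to be within `δ` of the truth, so a comparison point
    -- must not contain them and both sides are reset at once. The column gain is at most of order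
    -- `n e ^ 2`; relative to the `m` rows it is `O(r ^ 2)` because `n / m ≤ 1 / cmn`.
    have h1 := hdom 0 σr 0 σc b tr' lr' tc' lc' hσr hσc hlr' hlc' (by simpa using hδ)
      (by simpa using hδ) (by simpa using hδ) (by simpa using hδ) hbδ
    have h2 := hcr ζr sr hsr
    have h3 := hcc ζc sc hsc
    have h4 : n / 2 * Pc ≤ n / 2 * (G₂ * e ^ 2) := by gcongr
    have h5 : 0 ≤ m / 2 * Pr + D₃ * (m / n) + n / 2 * (G₂ * e ^ 2) + D₄ * (n / m) := by
      linarith only [h1, h2, h3, h4]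
    have h6 : m / 2 * Pr + D₃ * (m / n) + n / 2 * (G₂ * e ^ 2) + D₄ * (n / m)
        = m / 2 * (Pr + 2 * D₃ * (1 / n) + (n / m) * (G₂ * e ^ 2)
          + (n / m) * (2 * D₄ * (1 / m))) := by field_simp
    rw [h6] at h5
    have h7 := nonneg_of_mul_nonneg_right h5 (by positivity)
    have h8 : 2 * D₃ * (1 / n) ≤ 2 * D₃ * r ^ 2 := by gcongr
    have h9 : (n : ℝ) / m * (G₂ * e ^ 2) ≤ 1 / cmn * (G₂ * e ^ 2) := by gcongr
    have h10 : (n : ℝ) / m * (2 * D₄ * (1 / m)) ≤ 1 / cmn * (2 * D₄ * r ^ 2) := by gcongr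
    have h11 : H₁ * r ^ 2 = 2 * D₃ * r ^ 2 + 1 / cmn * (G₂ * e ^ 2)
        + 1 / cmn * (2 * D₄ * r ^ 2) := by rw [hH₁, he]; ring
    linarith only [h7, h8, h9, h10, h11]
  have hsq : ∀ x : ℝ, 0 ≤ x → √(x * r ^ 2) = √x * r := fun x hx => by
    rw [Real.sqrt_mul hx, Real.sqrt_sq hr0.le]
  have hrow := hgr (H₁ * r ^ 2) (by positivity) (by
    rw [le_div_iff₀ hH₁0] at hrH
    have := mul_le_mul_of_nonneg_left hr2 hH₁0.le
    linarith only [hrH, this]) hrows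
  rw [hsq _ hH₁0.le] at hrow
  have eA₁ : G₁ * (e + √H₁ * r) = A₁ * r := by rw [hA₁, he]; ring
  rw [eA₁] at hrow
  have hA₁δ : A₁ * r < δ := by
    rw [le_div_iff₀ (by positivity)] at hrA; linarith only [hrA, hδ]
  -- columns
  have hcols : -(2 * D₄ * r ^ 2) ≤ Pc := by
    -- The row parameters are now known to be within `δ`, so the row half can be left unchanged and
    -- cancels. No bound on `m / n` is needed for the columns.
    have h1 := hdom ζr sr 0 σc b tr lr tc' lc' hsr hσc hlr hlc' (hrow.1.trans_lt hA₁δ)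
      (hrow.2.trans_lt hA₁δ) (by simpa using hδ) (by simpa using hδ) hbδ
    have h3 := hcc ζc sc hsc
    have h5 : 0 ≤ n / 2 * Pc + D₄ * (n / m) := by linarith only [h1, h3]
    have h6 : n / 2 * Pc + D₄ * (n / m) = n / 2 * (Pc + 2 * D₄ * (1 / m)) := by field_simp
    rw [h6] at h5
    have h7 := nonneg_of_mul_nonneg_right h5 (by positivity)
    have h8 : 2 * D₄ * (1 / m) ≤ 2 * D₄ * r ^ 2 := by gcongr
    linarith only [h7, h8]
  have hcol := hgc (2 * D₄ * r ^ 2) (by positivity) (by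
    rw [le_div_iff₀ (by positivity)] at hrD
    have := mul_le_mul_of_nonneg_left hr2 (by positivity : 0 ≤ 2 * D₄)
    linarith only [hrD, this]) hcols
  rw [hsq _ (by positivity)] at hcol
  have eA₂ : G₂ * (e + √(2 * D₄) * r) = A₂ * r := by rw [hA₂, he]; ring
  rw [eA₂] at hcol
  have f1 : 0 ≤ E * r := by positivity
  have f2 : 0 ≤ A₁ * r := by positivity
  have f3 : 0 ≤ A₂ * r := by positivity
  have f4 : (E + A₁ + A₂) * r = E * r + A₁ * r + A₂ * r := by ring
  rw [f4]
  refine ⟨?_, ?_, ?_, ?_, ?_⟩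
  · linarith only [hrow.1, f1, f3]
  · linarith only [hrow.2, f1, f3]
  · linarith only [hcol.1, f1, f2]
  · linarith only [hcol.2, f1, f2]
  · linarith only [hbE, f2, f3]


/-! ### Closed form of the bound and centered coordinates -/

/-- The sign with which the linear predictor enters the natural form of the bound. -/
def Family.sgn : Family → ℝ
  | .poisson => 1
  | .gamma _ => -1

lemma Family.abs_sgn (fam : Family) : |fam.sgn| = 1 := by cases fam <;> simp [Family.sgn]

lemma Family.sgn_mul_self (fam : Family) : fam.sgn * fam.sgn = 1 := by
  cases fam <;> simp [Family.sgn]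

/-- The contribution of one response to the bound, for a Gaussian linear predictor with mean `η`
and variance `l`. -/
noncomputable def Family.cellBound : Family → ℝ → ℝ → ℝ → ℝ
  | .poisson, y, η, l => y * η - Real.exp (η + l / 2)
  | .gamma _, y, η, l => -(y * Real.exp (-η + l / 2)) - η

lemma integral_exp_gaussian (a l : ℝ) (hl : 0 < l) (t : ℝ) :
    ∫ u, Real.exp (t * u) ∂(gaussianReal a l.toNNReal) = Real.exp (a * t + l * t ^ 2 / 2) := by
  have h := congr_fun (mgf_id_gaussianReal (μ := a) (v := l.toNNReal)) t
  simp only [mgf, id] at h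
  rw [h, Real.coe_toNNReal _ hl.le]

lemma gaussExp_const_add (a l k : ℝ) : gaussExp a l (fun u => k + u) = k + a := by
  unfold gaussExp
  have hint : Integrable (fun u : ℝ => u) (gaussianReal a l.toNNReal) :=
    (memLp_id_gaussianReal 1).integrable (by simp)
  rw [integral_add (integrable_const _) hint, integral_id_gaussianReal]
  simp

lemma gaussExp_exp (a l k : ℝ) (hl : 0 < l) :
    gaussExp a l (fun u => Real.exp (k + u)) = Real.exp (k + a + l / 2) := by
  unfold gaussExp
  have h := integral_exp_gaussian a l hl 1
  simp only [one_mul, mul_one, one_pow] at h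
  simp_rw [Real.exp_add k]
  rw [integral_const_mul, h, ← Real.exp_add]
  congr 1; ring

lemma gaussExp_exp_neg (a l k : ℝ) (hl : 0 < l) :
    gaussExp a l (fun u => Real.exp (-(k + u))) = Real.exp (-(k + a) + l / 2) := by
  unfold gaussExp
  have h := integral_exp_gaussian a l hl (-1)
  have e : ∀ u : ℝ, Real.exp (-(k + u)) = Real.exp (-k) * Real.exp (-1 * u) := by
    intro u; rw [← Real.exp_add]; congr 1; ring
  simp_rw [e]
  rw [integral_const_mul, h, ← Real.exp_add]
  congr 1; ring

lemma Family.theta_poisson (η : ℝ) : Family.poisson.theta η = η := by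
  simp [Family.theta, Family.natParam]

lemma Family.theta_gamma (α η : ℝ) : (Family.gamma α).theta η = -Real.exp (-η) := by
  simp [Family.theta, Family.natParam, Real.exp_neg]

lemma Family.cellBound_eq (fam : Family) {l : ℝ} (hl : 0 < l) (y a k : ℝ) :
    y * gaussExp a l (fun u => fam.theta (k + u))
      - gaussExp a l (fun u => fam.b (fam.theta (k + u))) = fam.cellBound y (k + a) l := by
  cases fam with
  | poisson =>
    simp only [Family.theta_poisson, Family.b, Family.cellBound]
    rw [gaussExp_const_add, gaussExp_exp _ _ _ hl]
  | gamma α =>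
    simp only [Family.theta_gamma, Family.b, Family.cellBound, neg_neg, Real.log_exp]
    rw [gaussExp_const_add]
    have h : gaussExp a l (fun u => -Real.exp (-(k + u))) = -Real.exp (-(k + a) + l / 2) := by
      rw [← gaussExp_exp_neg _ _ _ hl]
      unfold gaussExp
      rw [integral_neg]
    rw [h]; ring

/-- The closed form of `rowBound`. -/
noncomputable def rowExplicit (fam : Family) (κ : ℝ) {m n : ℕ} (x y : Fin m → Fin n → ℝ)
    (β0 β1 σ2 : ℝ) (a l : Fin m → ℝ) : ℝ :=
  κ * ∑ i, ∑ j, fam.cellBound (y i j) (β0 + β1 * x i j + a i) (l i)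
    + (1 / 2) * ∑ i, (Real.log (l i / σ2) - ((a i) ^ 2 + l i) / σ2)

lemma rowBound_eq (fam : Family) (κ : ℝ) {m n : ℕ} (x y : Fin m → Fin n → ℝ)
    (β0 β1 σ2 : ℝ) (a l : Fin m → ℝ) (hl : ∀ i, 0 < l i) :
    rowBound fam κ x y β0 β1 σ2 a l = rowExplicit fam κ x y β0 β1 σ2 a l := by
  unfold rowBound rowExplicit
  simp_rw [fun i j => fam.cellBound_eq (hl i) (y i j) (a i) (β0 + β1 * x i j)]

/-- The linear weight of a response in the bound. -/
def Family.linWeight : Family → ℝ → ℝ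
  | .poisson, y => y
  | .gamma _, _ => 1

/-- The exponential weight of a response in the bound, relative to the predictor `η`. -/
noncomputable def Family.expWeight : Family → ℝ → ℝ → ℝ
  | .poisson, η, _ => Real.exp η
  | .gamma _, η, y => y * Real.exp (-η)

/-- The part of the bound that does not depend on the parameters. -/
def Family.offset : Family → ℝ → ℝ → ℝ
  | .poisson, η, y => y * η
  | .gamma _, η, _ => -η

/-- Both families take the form `p t - w exp (t + l / 2)` in `t = ± (η - η₀)`. The Gamma likelihood
contains `exp (-η)`, hence the minus sign, and there the response is the exponential weight while
the linear weight is one; in the Poisson case it is the other way round. -/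
lemma Family.cellBound_decomp (fam : Family) (y η η₀ l : ℝ) :
    fam.cellBound y η l = fam.linWeight y * (fam.sgn * (η - η₀))
      - fam.expWeight η₀ y * Real.exp (fam.sgn * (η - η₀) + l / 2) + fam.offset η₀ y := by
  cases fam with
  | poisson =>
    simp only [Family.cellBound, Family.linWeight, Family.expWeight, Family.offset, Family.sgn]
    rw [← Real.exp_add]
    have : η₀ + (1 * (η - η₀) + l / 2) = η + l / 2 := by ring
    rw [this]; ring
  | gamma α =>
    simp only [Family.cellBound, Family.linWeight, Family.expWeight, Family.offset, Family.sgn]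
    rw [mul_assoc, ← Real.exp_add]
    have : -η₀ + (-1 * (η - η₀) + l / 2) = -η + l / 2 := by ring
    rw [this]; ring

/-- The likelihood parts of the rows, relative to the predictors `β0 + β1 x + U`. -/
noncomputable def Family.fits (fam : Family) {m n : ℕ} (x y : Fin m → Fin n → ℝ) (β0 β1 : ℝ)
    (U : Fin m → ℝ) (i : Fin m) : ℝ → ℝ → ℝ → ℝ :=
  rowFit (fun j => fam.linWeight (y i j)) (fun j => fam.expWeight (β0 + β1 * x i j + U i) (y i j))
    (x i)

/-- Changing from the variational means `a i` to the level errors moves the intercept out of the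
likelihood: `a i` equals `U i ± t i` minus the intercept error, so that error remains only in the
prior part. -/
lemma rowExplicit_eq (fam : Family) (κ : ℝ) {m n : ℕ} (x y : Fin m → Fin n → ℝ)
    (b0 b1 : ℝ) (U : Fin m → ℝ) (β0 β1 σ2 : ℝ) (a l : Fin m → ℝ) :
    rowExplicit fam κ x y β0 β1 σ2 a l =
      sideObj κ fam.sgn (fam.fits x y b0 b1 U) U (β0 - b0) σ2 (fam.sgn * (β1 - b1))
        (fun i => fam.sgn * (β0 + a i - b0 - U i)) l
      + κ * ∑ i, ∑ j, fam.offset (b0 + b1 * x i j + U i) (y i j) := by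
  unfold rowExplicit sideObj Family.fits rowFit
  rw [Finset.sum_add_distrib, ← Finset.mul_sum]
  have h1 : ∑ i, reg (β0 - b0) σ2 (U i + fam.sgn * (fam.sgn * (β0 + a i - b0 - U i))) (l i)
      = (1 / 2) * ∑ i, (Real.log (l i / σ2) - ((a i) ^ 2 + l i) / σ2) := by
    rw [Finset.mul_sum]
    refine Finset.sum_congr rfl fun i _ => ?_
    unfold reg
    have : U i + fam.sgn * (fam.sgn * (β0 + a i - b0 - U i)) - (β0 - b0) = a i := by
      rw [← mul_assoc, fam.sgn_mul_self]; ring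
    rw [this]
  rw [h1]
  have h2 : ∀ i j, fam.cellBound (y i j) (β0 + β1 * x i j + a i) (l i) =
      (fam.linWeight (y i j) * (fam.sgn * (β0 + a i - b0 - U i) + fam.sgn * (β1 - b1) * x i j)
        - fam.expWeight (b0 + b1 * x i j + U i) (y i j)
          * Real.exp (fam.sgn * (β0 + a i - b0 - U i) + fam.sgn * (β1 - b1) * x i j + l i / 2))
      + fam.offset (b0 + b1 * x i j + U i) (y i j) := by
    intro i j
    rw [fam.cellBound_decomp _ _ (b0 + b1 * x i j + U i)]
    have : fam.sgn * (β0 + β1 * x i j + a i - (b0 + b1 * x i j + U i))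
        = fam.sgn * (β0 + a i - b0 - U i) + fam.sgn * (β1 - b1) * x i j := by ring
    rw [this]
  simp_rw [h2, Finset.sum_add_distrib]
  ring

/-! ### Existence of maximizers over a compact box -/

/-- The quadratic term beats `D |a|`, the linear term in `l` beats the logarithm for large `l`, and
`log l` tends to `-∞` at zero. Hence superlevel sets in the variational parameters stay away from
the boundary. -/
lemma exists_coercive (D S : ℝ) (hD : 0 ≤ D) (hS : 0 < S) (V : ℝ) :
    ∃ B : ℝ, 1 ≤ B ∧ ∀ a l : ℝ, 0 < l →
      -V ≤ D + D * |a| - a ^ 2 / (2 * S) + 1 / 2 * Real.log l - l / (2 * S) →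
      |a| ≤ B ∧ B⁻¹ ≤ l ∧ l ≤ B := by
  set W := |V| + D + D ^ 2 * S + 1 / 2 * |Real.log (1 / (2 * S))| with hW
  have hW0 : 0 ≤ W := by positivity
  set A := 1 + 4 * S * W with hA
  have hA1 : 1 ≤ A := by rw [hA]; have : 0 ≤ 4 * S * W := by positivity
                         linarith
  refine ⟨max A (Real.exp (2 * (|V| + D + D * A))), le_max_of_le_left hA1, ?_⟩
  intro a l hl h
  have h1 := half_log_le (a := 1 / (2 * S)) (x := l) (by positivity) hl
  have h2 : D * |a| ≤ a ^ 2 / (4 * S) + D ^ 2 * S := by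
    have : a ^ 2 / (4 * S) + D ^ 2 * S - D * |a| = (|a| - 2 * D * S) ^ 2 / (4 * S) := by
      rw [← sq_abs a]; field_simp; ring
    have h3 : 0 ≤ (|a| - 2 * D * S) ^ 2 / (4 * S) := by positivity
    linarith
  have h3 : a ^ 2 / (2 * S) = 2 * (a ^ 2 / (4 * S)) := by field_simp; ring
  have h4 : l / (2 * S) = 2 * (l / (4 * S)) := by field_simp; ring
  have h5 : 1 / (2 * S) * l = 2 * (l / (4 * S)) := by field_simp; ring
  have h6 : a ^ 2 / (4 * S) + l / (4 * S) ≤ W := by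
    have := le_abs_self V
    have := neg_le_abs (Real.log (1 / (2 * S)))
    rw [h3, h4] at h
    rw [h5] at h1
    rw [hW]; linarith
  have h7 : a ^ 2 + l ≤ 4 * S * W := by
    rw [← add_div, div_le_iff₀ (by positivity)] at h6
    linarith
  have ha : |a| ≤ A := by
    have : a ^ 2 ≤ 4 * S * W := by linarith
    rw [← sq_abs] at this
    nlinarith [sq_nonneg (|a| - 1)]
  have hlA : l ≤ A := by
    have := sq_nonneg a; linarith
  refine ⟨ha.trans (le_max_left _ _), ?_, hlA.trans (le_max_left _ _)⟩
  have h8 : -(2 * (|V| + D + D * A)) ≤ Real.log l := by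
    have h9 : 0 ≤ a ^ 2 / (2 * S) := by positivity
    have h10 : 0 ≤ l / (2 * S) := by positivity
    have h11 : D * |a| ≤ D * A := mul_le_mul_of_nonneg_left ha hD
    have := le_abs_self V
    linarith
  rw [Real.le_log_iff_exp_le hl, Real.exp_neg] at h8
  refine le_trans (inv_anti₀ (Real.exp_pos _) (le_max_right _ _)) h8

lemma Family.cellBound_le (fam : Family) {y : ℝ} (hy : 0 ≤ y) (η l : ℝ) :
    fam.cellBound y η l ≤ (1 + y) * |η| := by
  have h0 := abs_nonneg η
  cases fam with
  | poisson =>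
    simp only [Family.cellBound]
    have := Real.exp_pos (η + l / 2)
    have := mul_le_mul_of_nonneg_left (le_abs_self η) hy
    linarith
  | gamma α =>
    simp only [Family.cellBound]
    have h1 := Real.exp_pos (-η + l / 2)
    have := mul_nonneg hy h1.le
    have := mul_nonneg hy h0
    linarith [neg_le_abs η]

/-- A row of the bound is bounded above, uniformly over a bounded parameter region. -/
lemma exists_row_upper (fam : Family) (κ : ℝ) (hκ : 0 < κ) {m n : ℕ} (x y : Fin m → Fin n → ℝ)
    (hy : ∀ i j, 0 ≤ y i j) (B s₀ S : ℝ) (hB : 0 ≤ B) (hs₀ : 0 < s₀) :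
    ∃ D : ℝ, 0 ≤ D ∧ ∀ (i : Fin m) (β0 β1 s a l : ℝ), |β0| ≤ B → |β1| ≤ B → s₀ ≤ s → s ≤ S →
      0 < l →
      κ * ∑ j, fam.cellBound (y i j) (β0 + β1 * x i j + a) l
        + 1 / 2 * (Real.log (l / s) - (a ^ 2 + l) / s) ≤
      D + D * |a| - a ^ 2 / (2 * S) + 1 / 2 * Real.log l - l / (2 * S) := by
  set T : ℝ := ∑ i, ∑ j, (1 + y i j) * (1 + |x i j|) with hT
  have hT0 : 0 ≤ T := Finset.sum_nonneg fun i _ => Finset.sum_nonneg fun j _ =>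
    mul_nonneg (by linarith [hy i j]) (by positivity)
  refine ⟨κ * T * (1 + B) + |Real.log s₀|, by positivity, ?_⟩
  intro i β0 β1 s a l hβ0 hβ1 hs hsS hl
  have hs0 : 0 < s := hs₀.trans_le hs
  have h1 : ∑ j, fam.cellBound (y i j) (β0 + β1 * x i j + a) l ≤ T * (B + |a|) := by
    have h2 : ∑ j, (1 + y i j) * (1 + |x i j|) ≤ T :=
      Finset.single_le_sum (f := fun i => ∑ j, (1 + y i j) * (1 + |x i j|))
        (fun i _ => Finset.sum_nonneg fun j _ =>
          mul_nonneg (by linarith [hy i j]) (by positivity)) (Finset.mem_univ i)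
    refine le_trans ?_ (mul_le_mul_of_nonneg_right h2 (by positivity))
    rw [Finset.sum_mul]
    refine Finset.sum_le_sum fun j _ => (fam.cellBound_le (hy i j) _ _).trans ?_
    rw [mul_assoc]
    refine mul_le_mul_of_nonneg_left ?_ (by linarith [hy i j])
    have h3 : |β0 + β1 * x i j + a| ≤ |β0| + |β1| * |x i j| + |a| := by
      rw [← abs_mul]
      exact (abs_add_le _ _).trans (add_le_add_left (abs_add_le _ _) _)
    have h4 : |β1| * |x i j| ≤ B * |x i j| := mul_le_mul_of_nonneg_right hβ1 (abs_nonneg _)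
    have h5 : 0 ≤ |x i j| * |a| := by positivity
    linarith
  have h2 := mul_le_mul_of_nonneg_left h1 hκ.le
  have h3 : Real.log (l / s) ≤ Real.log l + |Real.log s₀| := by
    rw [Real.log_div hl.ne' hs0.ne']
    have := Real.log_le_log hs₀ hs
    linarith [neg_le_abs (Real.log s₀)]
  have h4 : a ^ 2 / (2 * S) + l / (2 * S) ≤ 1 / 2 * ((a ^ 2 + l) / s) := by
    have e : 1 / 2 * ((a ^ 2 + l) / s) = (a ^ 2 + l) / (2 * s) := by field_simp
    rw [e, ← add_div]
    exact div_le_div_of_nonneg_left (by positivity) (by positivity) (by linarith)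
  have h5 : 0 ≤ |Real.log s₀| * |a| := by positivity
  have h6 : 0 ≤ κ * T * B * |a| := by positivity
  have h7 : 0 ≤ κ * T := by positivity
  have h8 := abs_nonneg (Real.log s₀)
  linarith only [h2, h3, h4, h5, h6, h7, h8]


/-- The closed box of radius `d` around the parameter `ψ`. -/
def InBox (d : ℝ) (ψ ψ' : RowColParam) : Prop :=
  |ψ'.β0r - ψ.β0r| ≤ d ∧ |ψ'.β0c - ψ.β0c| ≤ d ∧ |ψ'.β1 - ψ.β1| ≤ d ∧
    |ψ'.σu2 - ψ.σu2| ≤ d ∧ |ψ'.σv2 - ψ.σv2| ≤ d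

lemma coercive_upper {D S : ℝ} (hS : 0 < S) {a l : ℝ} (hl : 0 < l) :
    D + D * |a| - a ^ 2 / (2 * S) + 1 / 2 * Real.log l - l / (2 * S) ≤
      |D| + D ^ 2 * S + |Real.log (1 / (2 * S))| := by
  have h1 := half_log_le (a := 1 / (2 * S)) (x := l) (by positivity) hl
  have h2 : D * |a| ≤ a ^ 2 / (2 * S) + D ^ 2 * S := by
    have : a ^ 2 / (2 * S) + D ^ 2 * S - D * |a|
        = (|a| - D * S) ^ 2 / (2 * S) + D ^ 2 * S / 2 := by
      rw [← sq_abs a]; field_simp; ring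
    have h3 : 0 ≤ (|a| - D * S) ^ 2 / (2 * S) + D ^ 2 * S / 2 := by positivity
    linarith
  have h5 : 1 / (2 * S) * l = l / (2 * S) := by field_simp
  have h6 : 0 ≤ l / (2 * S) := by positivity
  have h7 := neg_le_abs (Real.log (1 / (2 * S)))
  have h8 := abs_nonneg (Real.log (1 / (2 * S)))
  have h9 := le_abs_self D
  rw [h5] at h1
  linarith

lemma Family.continuous_cellBound (fam : Family) (y : ℝ) :
    Continuous fun q : ℝ × ℝ => fam.cellBound y q.1 q.2 := by
  cases fam <;> simp only [Family.cellBound] <;> fun_prop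

lemma continuousOn_rowExplicit (fam : Family) (κ : ℝ) {m n : ℕ} (x y : Fin m → Fin n → ℝ)
    {T : Type*} [TopologicalSpace T] {K : Set T} {β0 β1 s : T → ℝ} {a l : T → Fin m → ℝ}
    (hβ0 : Continuous β0) (hβ1 : Continuous β1) (hs : Continuous s) (ha : Continuous a)
    (hl : Continuous l) (hs0 : ∀ q ∈ K, 0 < s q) (hl0 : ∀ q ∈ K, ∀ i, 0 < l q i) :
    ContinuousOn (fun q => rowExplicit fam κ x y (β0 q) (β1 q) (s q) (a q) (l q)) K := by
  unfold rowExplicit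
  have hai : ∀ i, Continuous fun q => a q i := fun i => (continuous_apply i).comp ha
  have hli : ∀ i, Continuous fun q => l q i := fun i => (continuous_apply i).comp hl
  refine ContinuousOn.add ?_ ?_
  · refine Continuous.continuousOn ?_
    refine continuous_const.mul (continuous_finsetSum _ fun i _ => continuous_finsetSum _
      fun j _ => ?_)
    exact (fam.continuous_cellBound (y i j)).comp
      ((hβ0.add (hβ1.mul continuous_const)).add (hai i) |>.prodMk (hli i))
  · refine continuousOn_const.mul (continuousOn_finsetSum _ fun i _ => ?_)
    refine ContinuousOn.sub (ContinuousOn.log ?_ ?_) ?_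
    · exact (hli i).continuousOn.div hs.continuousOn fun q hq => (hs0 q hq).ne'
    · intro q hq
      exact (div_pos (hl0 q hq i) (hs0 q hq)).ne'
    · exact (((hai i).pow 2).add (hli i)).continuousOn.div hs.continuousOn
        fun q hq => (hs0 q hq).ne'

lemma rowExplicit_eq_sum (fam : Family) (κ : ℝ) {m n : ℕ} (x y : Fin m → Fin n → ℝ)
    (β0 β1 s : ℝ) (a l : Fin m → ℝ) :
    rowExplicit fam κ x y β0 β1 s a l = ∑ i, (κ * ∑ j, fam.cellBound (y i j)
      (β0 + β1 * x i j + a i) (l i) + 1 / 2 * (Real.log (l i / s) - (a i ^ 2 + l i) / s)) := by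
  unfold rowExplicit
  rw [Finset.sum_add_distrib, Finset.mul_sum, Finset.mul_sum]

/-- The bound attains its maximum over a box of parameters bounded away from zero variances. -/
theorem exists_box_maximizer (fam : Family) (κ : ℝ) (hκ : 0 < κ) {m n : ℕ}
    (x y : Fin m → Fin n → ℝ) (hy : ∀ i j, 0 ≤ y i j) (ψ : RowColParam) (d : ℝ) (hd : 0 < d)
    (hu : d < ψ.σu2) (hv : d < ψ.σv2) :
    ∃ p : RowColParam × VarParam m n, InBox d ψ p.1 ∧ (∀ i, 0 < p.2.varU i) ∧
      (∀ j, 0 < p.2.varV j) ∧ ∀ p' : RowColParam × VarParam m n, InBox d ψ p'.1 →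
        (∀ i, 0 < p'.2.varU i) → (∀ j, 0 < p'.2.varV j) →
        rowColBound fam κ x y p' ≤ rowColBound fam κ x y p := by
  set B := |ψ.β0r| + |ψ.β0c| + |ψ.β1| + d with hB
  have hB0 : 0 ≤ B := by positivity
  set S := ψ.σu2 + ψ.σv2 + d with hS
  have hS0 : 0 < S := by linarith
  obtain ⟨D₁, hD₁, hrow₁⟩ := exists_row_upper fam κ hκ x y hy B (ψ.σu2 - d) S hB0 (by linarith)
  obtain ⟨D₂, hD₂, hrow₂⟩ := exists_row_upper fam κ hκ (fun j i => x i j) (fun j i => y i j)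
    (fun j i => hy i j) B (ψ.σv2 - d) S hB0 (by linarith)
  set W₁ := |D₁| + D₁ ^ 2 * S + |Real.log (1 / (2 * S))| with hW₁
  set W₂ := |D₂| + D₂ ^ 2 * S + |Real.log (1 / (2 * S))| with hW₂
  have hW₁0 : 0 ≤ W₁ := by positivity
  have hW₂0 : 0 ≤ W₂ := by positivity
  -- the objective in coordinates
  let T := (ℝ × ℝ × ℝ × ℝ × ℝ) × ((Fin m → ℝ) × (Fin m → ℝ)) × ((Fin n → ℝ) × (Fin n → ℝ))
  let F : T → ℝ := fun q =>
    rowExplicit fam κ x y q.1.1 q.1.2.2.1 q.1.2.2.2.1 q.2.1.1 q.2.1.2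
      + rowExplicit fam κ (fun j i => x i j) (fun j i => y i j) q.1.2.1 q.1.2.2.1 q.1.2.2.2.2
          q.2.2.1 q.2.2.2
  let base : T := ((ψ.β0r, ψ.β0c, ψ.β1, ψ.σu2, ψ.σv2), (0, fun _ => 1), (0, fun _ => 1))
  -- Every row contributes at most `W₁` and every column at most `W₂`. At a point at least as good
  -- as `base` no single contribution can therefore be below `-V`, and coercivity confines its
  -- variational parameters.
  set V := m * W₁ + n * W₂ - F base with hV
  obtain ⟨B₁, hB₁, hco₁⟩ := exists_coercive D₁ S hD₁ hS0 V
  obtain ⟨B₂, hB₂, hco₂⟩ := exists_coercive D₂ S hD₂ hS0 V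
  let lo : T := ((ψ.β0r - d, ψ.β0c - d, ψ.β1 - d, ψ.σu2 - d, ψ.σv2 - d),
    (fun _ => -B₁, fun _ => B₁⁻¹), (fun _ => -B₂, fun _ => B₂⁻¹))
  let hi : T := ((ψ.β0r + d, ψ.β0c + d, ψ.β1 + d, ψ.σu2 + d, ψ.σv2 + d),
    (fun _ => B₁, fun _ => B₁), (fun _ => B₂, fun _ => B₂))
  have hB₁i : B₁⁻¹ ≤ 1 := inv_le_one_of_one_le₀ hB₁
  have hB₂i : B₂⁻¹ ≤ 1 := inv_le_one_of_one_le₀ hB₂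
  have hB₁p : 0 < B₁⁻¹ := by positivity
  have hB₂p : 0 < B₂⁻¹ := by positivity
  have hbase : base ∈ Set.Icc lo hi := by
    refine ⟨⟨⟨?_, ?_, ?_, ?_, ?_⟩, ⟨?_, ?_⟩, ⟨?_, ?_⟩⟩, ⟨⟨?_, ?_, ?_, ?_, ?_⟩, ⟨?_, ?_⟩, ⟨?_, ?_⟩⟩⟩
    all_goals first
      | (intro i; simp only [base, lo, hi, Pi.zero_apply]; linarith)
      | (simp only [base, lo, hi]; linarith)
  have hcont : ContinuousOn F (Set.Icc lo hi) := by
    refine ContinuousOn.add ?_ ?_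
    · refine continuousOn_rowExplicit fam κ x y (by fun_prop) (by fun_prop) (by fun_prop)
        (by fun_prop) (by fun_prop) ?_ ?_
      · intro q hq
        have h1 : ψ.σu2 - d ≤ q.1.2.2.2.1 := hq.1.1.2.2.2.1
        linarith
      · intro q hq i
        have h1 : B₁⁻¹ ≤ q.2.1.2 i := hq.1.2.1.2 i
        linarith
    · refine continuousOn_rowExplicit fam κ _ _ (by fun_prop) (by fun_prop) (by fun_prop)
        (by fun_prop) (by fun_prop) ?_ ?_
      · intro q hq
        have h1 : ψ.σv2 - d ≤ q.1.2.2.2.2 := hq.1.1.2.2.2.2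
        linarith
      · intro q hq i
        have h1 : B₂⁻¹ ≤ q.2.2.2 i := hq.1.2.2.2 i
        linarith
  obtain ⟨q, hq, hqmax⟩ := isCompact_Icc.exists_isMaxOn ⟨base, hbase⟩ hcont
  let coord : RowColParam × VarParam m n → T := fun p =>
    ((p.1.β0r, p.1.β0c, p.1.β1, p.1.σu2, p.1.σv2), (p.2.meanU, p.2.varU), (p.2.meanV, p.2.varV))
  have hF : ∀ p : RowColParam × VarParam m n, (∀ i, 0 < p.2.varU i) → (∀ j, 0 < p.2.varV j) →
      rowColBound fam κ x y p = F (coord p) := by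
    intro p h1 h2
    unfold rowColBound
    rw [rowBound_eq fam κ x y _ _ _ _ _ h1, rowBound_eq fam κ _ _ _ _ _ _ _ h2]
  have hdom : ∀ p : RowColParam × VarParam m n, InBox d ψ p.1 → (∀ i, 0 < p.2.varU i) →
      (∀ j, 0 < p.2.varV j) → F base ≤ F (coord p) → coord p ∈ Set.Icc lo hi := by
    intro p hbox h1 h2 hge
    obtain ⟨b1, b2, b3, b4, b5⟩ := hbox
    have ab : ∀ z w : ℝ, |z - w| ≤ d → |z| ≤ |w| + d := fun z w h => by
      have := abs_sub_abs_le_abs_sub z w; linarith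
    have n1 := abs_nonneg ψ.β0r
    have n2 := abs_nonneg ψ.β0c
    have n3 := abs_nonneg ψ.β1
    have c1 := ab _ _ b1
    have c2 := ab _ _ b2
    have c3 := ab _ _ b3
    rw [abs_le] at b1 b2 b3 b4 b5
    have r1 := fun i => hrow₁ i p.1.β0r p.1.β1 p.1.σu2 (p.2.meanU i) (p.2.varU i)
      (by linarith) (by linarith) (by linarith) (by linarith) (h1 i)
    have r2 := fun j => hrow₂ j p.1.β0c p.1.β1 p.1.σv2 (p.2.meanV j) (p.2.varV j)
      (by linarith) (by linarith) (by linarith) (by linarith) (h2 j)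
    have u1 := fun i => coercive_upper (D := D₁) hS0 (a := p.2.meanU i) (h1 i)
    have u2 := fun j => coercive_upper (D := D₂) hS0 (a := p.2.meanV j) (h2 j)
    rw [← hW₁] at u1
    rw [← hW₂] at u2
    set h₁ : Fin m → ℝ := fun i => D₁ + D₁ * |p.2.meanU i| - p.2.meanU i ^ 2 / (2 * S)
      + 1 / 2 * Real.log (p.2.varU i) - p.2.varU i / (2 * S) with hh₁
    set h₂ : Fin n → ℝ := fun j => D₂ + D₂ * |p.2.meanV j| - p.2.meanV j ^ 2 / (2 * S)
      + 1 / 2 * Real.log (p.2.varV j) - p.2.varV j / (2 * S) with hh₂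
    have hsum : F base ≤ ∑ i, h₁ i + ∑ j, h₂ j := by
      refine hge.trans ?_
      refine add_le_add ?_ ?_
      · rw [rowExplicit_eq_sum]
        exact Finset.sum_le_sum fun i _ => r1 i
      · rw [rowExplicit_eq_sum]
        exact Finset.sum_le_sum fun j _ => r2 j
    have hs1 : ∑ i, (W₁ - h₁ i) = m * W₁ - ∑ i, h₁ i := by
      rw [Finset.sum_sub_distrib]; simp
    have hs2 : ∑ j, (W₂ - h₂ j) = n * W₂ - ∑ j, h₂ j := by
      rw [Finset.sum_sub_distrib]; simp
    have p1 : 0 ≤ ∑ i, (W₁ - h₁ i) := Finset.sum_nonneg fun i _ => sub_nonneg.2 (u1 i)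
    have p2 : 0 ≤ ∑ j, (W₂ - h₂ j) := Finset.sum_nonneg fun j _ => sub_nonneg.2 (u2 j)
    have k1 : ∀ i, -V ≤ h₁ i := fun i => by
      have := Finset.single_le_sum (f := fun i => W₁ - h₁ i)
        (fun i _ => sub_nonneg.2 (u1 i)) (Finset.mem_univ i)
      linarith
    have k2 : ∀ j, -V ≤ h₂ j := fun j => by
      have := Finset.single_le_sum (f := fun j => W₂ - h₂ j)
        (fun i _ => sub_nonneg.2 (u2 i)) (Finset.mem_univ j)
      linarith
    have f1 := fun i => hco₁ _ _ (h1 i) (k1 i)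
    have f2 := fun j => hco₂ _ _ (h2 j) (k2 j)
    refine ⟨⟨⟨?_, ?_, ?_, ?_, ?_⟩, ⟨?_, ?_⟩, ⟨?_, ?_⟩⟩, ⟨⟨?_, ?_, ?_, ?_, ?_⟩, ⟨?_, ?_⟩, ⟨?_, ?_⟩⟩⟩
    all_goals first
      | (simp only [coord, lo, hi]; linarith)
      | exact fun i => (abs_le.1 (f1 i).1).1
      | exact fun i => (f1 i).2.1
      | exact fun i => (abs_le.1 (f2 i).1).1
      | exact fun i => (f2 i).2.1
      | exact fun i => (abs_le.1 (f1 i).1).2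
      | exact fun i => (f1 i).2.2
      | exact fun i => (abs_le.1 (f2 i).1).2
      | exact fun i => (f2 i).2.2
  refine ⟨(⟨q.1.1, q.1.2.1, q.1.2.2.1, q.1.2.2.2.1, q.1.2.2.2.2⟩,
    ⟨q.2.1.1, q.2.1.2, q.2.2.1, q.2.2.2⟩), ?_, ?_, ?_, ?_⟩
  · obtain ⟨⟨⟨a1, a2, a3, a4, a5⟩, -, -⟩, ⟨⟨b1, b2, b3, b4, b5⟩, -, -⟩⟩ := hq
    simp only [lo, hi] at a1 a2 a3 a4 a5 b1 b2 b3 b4 b5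
    refine ⟨?_, ?_, ?_, ?_, ?_⟩ <;> rw [abs_le] <;> constructor <;> dsimp only <;> linarith
  · intro i
    have h1 : B₁⁻¹ ≤ q.2.1.2 i := hq.1.2.1.2 i
    exact hB₁p.trans_le h1
  · intro i
    have h1 : B₂⁻¹ ≤ q.2.2.2 i := hq.1.2.2.2 i
    exact hB₂p.trans_le h1
  · intro p' hbox h1 h2
    rw [hF p' h1 h2, hF _ (fun i => hB₁p.trans_le (hq.1.2.1.2 i))
      (fun i => hB₂p.trans_le (hq.1.2.2.2 i))]
    change F (coord p') ≤ F q
    rcases le_total (F base) (F (coord p')) with h | h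
    · exact hqmax (hdom p' hbox h1 h2 h)
    · exact h.trans (hqmax hbase)


/-! ### Existence and rate of global maximizers on controlled data -/

/-- The objective of both sides in coordinates centered at the limit `ψ` and the effects `U`, `V`. -/
lemma exists_rowColBound_eq (fam : Family) (κ : ℝ) {m n : ℕ} (x y : Fin m → Fin n → ℝ)
    (ψ : RowColParam) (U : Fin m → ℝ) (V : Fin n → ℝ) :
    ∃ k : ℝ, ∀ p : RowColParam × VarParam m n, (∀ i, 0 < p.2.varU i) → (∀ j, 0 < p.2.varV j) →
      rowColBound fam κ x y p =
        sideObj κ fam.sgn (fam.fits x y ψ.β0r ψ.β1 U) U (p.1.β0r - ψ.β0r) p.1.σu2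
          (fam.sgn * (p.1.β1 - ψ.β1))
          (fun i => fam.sgn * (p.1.β0r + p.2.meanU i - ψ.β0r - U i)) p.2.varU
        + sideObj κ fam.sgn (fam.fits (fun j i => x i j) (fun j i => y i j) ψ.β0c ψ.β1 V) V
          (p.1.β0c - ψ.β0c) p.1.σv2 (fam.sgn * (p.1.β1 - ψ.β1))
          (fun j => fam.sgn * (p.1.β0c + p.2.meanV j - ψ.β0c - V j)) p.2.varV + k := by
  refine ⟨κ * ∑ i, ∑ j, fam.offset (ψ.β0r + ψ.β1 * x i j + U i) (y i j)
    + κ * ∑ j, ∑ i, fam.offset (ψ.β0c + ψ.β1 * x i j + V j) (y i j), fun p h1 h2 => ?_⟩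
  unfold rowColBound
  rw [rowBound_eq _ _ _ _ _ _ _ _ _ h1, rowBound_eq _ _ _ _ _ _ _ _ _ h2,
    rowExplicit_eq fam κ x y ψ.β0r ψ.β1 U,
    rowExplicit_eq fam κ (fun j i => x i j) (fun j i => y i j) ψ.β0c ψ.β1 V]
  ring

/-- On data with both sides under control, a global maximizer exists, and every global maximizer
is close to the limit. -/
theorem exists_maximizer_rate (fam : Family) (κ : ℝ) (hκ : 0 < κ) (ψ : RowColParam)
    (hσu : 0 < ψ.σu2) (hσv : 0 < ψ.σv2) (Θ : Set RowColParam) (hΘ : ContainsNhd Θ ψ)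
    (c C K cmn : ℝ) (hc : 0 < c) (hc1 : c ≤ 1) (hC : 0 < C) (hK : 1 ≤ K) (hcmn : 0 < cmn) :
    ∃ D : ℝ, 0 < D ∧ ∃ N₀ : ℕ, ∀ m n : ℕ, N₀ ≤ m → N₀ ≤ n → cmn * n ≤ m →
      ∀ (x y : Fin m → Fin n → ℝ) (U Rr : Fin m → ℝ) (V Rc : Fin n → ℝ), (∀ i j, 0 ≤ y i j) →
        SideControl c C K ψ.σu2 n (fam.fits x y ψ.β0r ψ.β1 U) U Rr →
        SideControl c C K ψ.σv2 m
          (fam.fits (fun j i => x i j) (fun j i => y i j) ψ.β0c ψ.β1 V) V Rc →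
        (∃ p, IsMaximizer fam κ Θ x y p) ∧ ∀ p, IsMaximizer fam κ Θ x y p →
          InBox (D * (1 / √m + 1 / √n)) ψ p.1 := by
  obtain ⟨δ, hδ, hΘ⟩ := hΘ
  set d := min (δ / 2) (min ψ.σu2 ψ.σv2 / 2) with hd
  have hd0 : 0 < d := lt_min (by linarith) (by have := lt_min hσu hσv; linarith)
  have hdδ : d < δ := (min_le_left _ _).trans_lt (by linarith)
  have hd2 : d ≤ min ψ.σu2 ψ.σv2 / 2 := min_le_right _ _
  have hdu : d < ψ.σu2 := by
    have := min_le_left ψ.σu2 ψ.σv2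
    linarith
  have hdv : d < ψ.σv2 := by
    have := min_le_right ψ.σu2 ψ.σv2
    linarith
  obtain ⟨D, hD, N₁, hrate⟩ := exists_rate c C K κ ψ.σu2 ψ.σv2 d cmn hc hc1 hC hK hκ hσu hσv hd0 hcmn
  obtain ⟨N₂, hN₂⟩ : ∃ N₂ : ℕ, ∀ m n : ℕ, N₂ ≤ m → N₂ ≤ n → D * (1 / √m + 1 / √n) ≤ d := by
    obtain ⟨N, hN⟩ := exists_nat_gt ((2 * D / d) ^ 2)
    have key : ∀ m : ℕ, N ≤ m → D * (1 / √m) ≤ d / 2 := by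
      intro m hm
      have h1 : (2 * D / d) ^ 2 ≤ (m : ℝ) := hN.le.trans (by exact_mod_cast hm)
      have h2 : 2 * D / d ≤ √m := Real.le_sqrt_of_sq_le h1
      have h3 : 0 < √(m : ℝ) := lt_of_lt_of_le (by positivity) h2
      rw [div_le_iff₀ hd0] at h2
      rw [mul_one_div, div_le_iff₀ h3]
      linarith
    exact ⟨N, fun m n hm hn => by rw [mul_add]; linarith [key m hm, key n hn]⟩
  refine ⟨D, hD, max N₁ N₂, ?_⟩
  intro m n hm hn hmn x y U Rr V Rc hy hr hcc
  have hsmall := hN₂ m n (le_of_max_le_right hm) (le_of_max_le_right hn)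
  have hsg := fam.abs_sgn
  have hsq := fam.sgn_mul_self
  obtain ⟨k, hk⟩ := exists_rowColBound_eq fam κ x y ψ U V
  -- Neither membership in `Θ` nor maximality is assumed, only domination of the box. So this
  -- applies to global maximizers and also to hypothetical points that beat the maximizer over the
  -- box.
  have dominator : ∀ p : RowColParam × VarParam m n, 0 < p.1.σu2 → 0 < p.1.σv2 →
      (∀ i, 0 < p.2.varU i) → (∀ j, 0 < p.2.varV j) →
      (∀ p' : RowColParam × VarParam m n, InBox d ψ p'.1 → (∀ i, 0 < p'.2.varU i) →
        (∀ j, 0 < p'.2.varV j) → rowColBound fam κ x y p' ≤ rowColBound fam κ x y p) →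
      InBox (D * (1 / √m + 1 / √n)) ψ p.1 := by
    intro p h1 h2 h3 h4 hdom
    obtain ⟨e1, e2, e3, e4, e5⟩ := hrate m n (le_of_max_le_left hm) (le_of_max_le_left hn) hmn
      _ U Rr hr _ V Rc hcc fam.sgn (p.1.β0r - ψ.β0r) p.1.σu2 (p.1.β0c - ψ.β0c) p.1.σv2
      (fam.sgn * (p.1.β1 - ψ.β1)) (fun i => fam.sgn * (p.1.β0r + p.2.meanU i - ψ.β0r - U i))
      p.2.varU (fun j => fam.sgn * (p.1.β0c + p.2.meanV j - ψ.β0c - V j)) p.2.varV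
      hsg h1 h2 h3 h4 (by
        intro ζr' sr' ζc' sc' b' tr' lr' tc' lc' g1 g2 g3 g4 b1 b2 b3 b4 b5
        have q := hdom (⟨ψ.β0r + ζr', ψ.β0c + ζc', ψ.β1 + fam.sgn * b', sr', sc'⟩,
          ⟨fun i => U i + fam.sgn * tr' i - ζr', lr', fun j => V j + fam.sgn * tc' j - ζc', lc'⟩)
          ⟨by simpa using b1.le, by simpa using b3.le, by
            simpa [abs_mul, hsg] using b5.le, b2.le, b4.le⟩ g3 g4
        rw [hk _ g3 g4, hk p h3 h4] at q
        have f1 : fam.sgn * (fam.sgn * b') = b' := by rw [← mul_assoc, hsq, one_mul]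
        have f2 : (fun i => fam.sgn * (ψ.β0r + ζr' + (U i + fam.sgn * tr' i - ζr') - ψ.β0r - U i))
            = tr' := by
          funext i
          have : ψ.β0r + ζr' + (U i + fam.sgn * tr' i - ζr') - ψ.β0r - U i = fam.sgn * tr' i := by
            ring
          rw [this, ← mul_assoc, hsq, one_mul]
        have f3 : (fun j => fam.sgn * (ψ.β0c + ζc' + (V j + fam.sgn * tc' j - ζc') - ψ.β0c - V j))
            = tc' := by
          funext j
          have : ψ.β0c + ζc' + (V j + fam.sgn * tc' j - ζc') - ψ.β0c - V j = fam.sgn * tc' j := by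
            ring
          rw [this, ← mul_assoc, hsq, one_mul]
        simp only [f1, f2, f3, add_sub_cancel_left] at q
        linarith only [q])
    rw [abs_mul, hsg, one_mul] at e5
    exact ⟨e1, e3, e5, e2, e4⟩
  have box_feasible : ∀ p : RowColParam × VarParam m n, InBox d ψ p.1 → (∀ i, 0 < p.2.varU i) →
      (∀ j, 0 < p.2.varV j) → p ∈ feasible Θ m n := by
    rintro p ⟨b1, b2, b3, b4, b5⟩ h3 h4
    refine ⟨hΘ _ (b1.trans_lt hdδ) (b2.trans_lt hdδ) (b3.trans_lt hdδ) (b4.trans_lt hdδ)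
      (b5.trans_lt hdδ), ?_, ?_, h3, h4⟩
    · linarith [(abs_le.1 b4).1]
    · linarith [(abs_le.1 b5).1]
  constructor
  · obtain ⟨p, hp, h3, h4, hmax⟩ := exists_box_maximizer fam κ hκ x y hy ψ d hd0 hdu hdv
    refine ⟨p, box_feasible p hp h3 h4, ?_⟩
    rintro q ⟨-, q1, q2, q3, q4⟩
    -- A feasible point better than the box maximizer dominates the box, so it is within the rate,
    -- which is at most `d`. It thus lies in the box, where it cannot be better.
    by_contra hlt
    have hlt : rowColBound fam κ x y p < rowColBound fam κ x y q := not_le.1 hlt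
    obtain ⟨b1, b2, b3, b4, b5⟩ := dominator q q1 q2 q3 q4 fun p' g g1 g2 =>
      (hmax p' g g1 g2).trans hlt.le
    exact absurd (hmax q ⟨b1.trans hsmall, b2.trans hsmall, b3.trans hsmall, b4.trans hsmall,
      b5.trans hsmall⟩ q3 q4) (not_le.2 hlt)
  · rintro p ⟨⟨-, p1, p2, p3, p4⟩, hmax⟩
    exact dominator p p1 p2 p3 p4 fun p' g g1 g2 => hmax (box_feasible p' g g1 g2)

lemma InBox.β0_le {r : ℝ} {ψ ψ' : RowColParam} (h : InBox r ψ ψ') :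
    |ψ'.β0 - ψ.β0| ≤ 2 * r := by
  obtain ⟨h1, h2, -, h4, h5⟩ := h
  rw [abs_le] at *
  unfold RowColParam.β0
  constructor <;> linarith


/-! ### Eighth moments of sums of independent centered variables -/

lemma pow_mul_pow_le_pow_six_mul_sq_add {s x : ℝ} (hs : 0 ≤ s) (hx : 0 ≤ x) (k : ℕ) (hk : k ≤ 6) :
    s ^ (6 - k) * x ^ (k + 2) ≤ s ^ 6 * x ^ 2 + x ^ 8 := by
  rcases le_total s x with h | h
  · have h1 : s ^ (6 - k) * x ^ (k + 2) ≤ x ^ (6 - k) * x ^ (k + 2) := by gcongr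
    have h2 : x ^ (6 - k) * x ^ (k + 2) = x ^ 8 := by rw [← pow_add]; congr 1; omega
    have : 0 ≤ s ^ 6 * x ^ 2 := by positivity
    linarith
  · have h1 : s ^ (6 - k) * x ^ k ≤ s ^ (6 - k) * s ^ k := by gcongr
    have h2 : s ^ (6 - k) * s ^ k = s ^ 6 := by rw [← pow_add]; congr 1; omega
    have h3 : s ^ (6 - k) * x ^ (k + 2) = (s ^ (6 - k) * x ^ k) * x ^ 2 := by ring
    have h4 : s ^ (6 - k) * x ^ k * x ^ 2 ≤ s ^ 6 * x ^ 2 := by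
      gcongr; linarith
    have : 0 ≤ x ^ 8 := by positivity
    linarith

/-- The first-order term is kept because its expectation vanishes for an independent centered `x`.
All higher terms lie between the extreme ones, and their coefficients `28 + 56 + 70 + 56 + 28 + 8 +
1` add up to `247`. -/
lemma add_pow_eight_le (s x : ℝ) :
    (s + x) ^ 8 ≤ s ^ 8 + 8 * (s ^ 7 * x) + 247 * (s ^ 6 * x ^ 2 + x ^ 8) := by
  have h := fun k hk => pow_mul_pow_le_pow_six_mul_sq_add (abs_nonneg s) (abs_nonneg x) k hk
  have e6 : |s| ^ 6 = s ^ 6 := by rw [← abs_pow]; exact abs_of_nonneg (by positivity)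
  have e2 : |x| ^ 2 = x ^ 2 := sq_abs x
  have e8 : |x| ^ 8 = x ^ 8 := by rw [← abs_pow]; exact abs_of_nonneg (by positivity)
  have key : ∀ k ≤ 6, s ^ (6 - k) * x ^ (k + 2) ≤ s ^ 6 * x ^ 2 + x ^ 8 := by
    intro k hk
    have h1 := h k hk
    rw [e6, e2, e8, ← abs_pow, ← abs_pow, ← abs_mul] at h1
    exact (le_abs_self _).trans h1
  have k0 := key 0 (by norm_num)
  have k1 := key 1 (by norm_num)
  have k2 := key 2 (by norm_num)
  have k3 := key 3 (by norm_num)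
  have k4 := key 4 (by norm_num)
  have k5 := key 5 (by norm_num)
  have k6 := key 6 (by norm_num)
  norm_num at k0 k1 k2 k3 k4 k5 k6
  have : (s + x) ^ 8 = s ^ 8 + 8 * (s ^ 7 * x) + 28 * (s ^ 6 * x ^ 2) + 56 * (s ^ 5 * x ^ 3)
    + 70 * (s ^ 4 * x ^ 4) + 56 * (s ^ 3 * x ^ 5) + 28 * (s ^ 2 * x ^ 6) + 8 * (s * x ^ 7)
    + x ^ 8 := by ring
  have p : 0 ≤ s ^ 6 * x ^ 2 := by positivity
  linarith

/-- Weighted arithmetic–geometric means in the place of Hölder's inequality: with `a = k N`, an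
eighth moment below `(k N) ^ 4` forces a sixth moment below `(k N) ^ 3`. -/
lemma pow_six_mul_le {a : ℝ} (ha : 0 < a) (s : ℝ) : s ^ 6 ≤ 3 / 4 * (s ^ 8 / a) + a ^ 3 / 4 := by
  have h : 0 ≤ (s ^ 2 - a) ^ 2 * (3 * s ^ 4 + 2 * s ^ 2 * a + a ^ 2) := by positivity
  have e : 3 / 4 * (s ^ 8 / a) + a ^ 3 / 4 - s ^ 6
      = (s ^ 2 - a) ^ 2 * (3 * s ^ 4 + 2 * s ^ 2 * a + a ^ 2) / (4 * a) := by
    field_simp; ring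
  have : 0 ≤ (s ^ 2 - a) ^ 2 * (3 * s ^ 4 + 2 * s ^ 2 * a + a ^ 2) / (4 * a) := by positivity
  linarith

section Moments

variable {Ω : Type*} [MeasurableSpace Ω] {P : Measure Ω} [IsProbabilityMeasure P]

lemma integrable_pow_of_memLp {f : Ω → ℝ} {q : ℕ} (hf : MemLp f q P) (k : ℕ) (hk : k ≤ q) :
    Integrable (fun ω => f ω ^ k) P := by
  have h1 : MemLp f k P := hf.mono_exponent (by exact_mod_cast hk)
  have h2 := h1.integrable_norm_pow'
  refine h2.mono' (h1.1.pow k) (Eventually.of_forall fun ω => ?_)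
  rw [norm_pow]

/-- The eighth moment of a sum of independent centered variables is of the order of the fourth
power of their number. -/
theorem integral_sum_pow_eight_le {ι : Type*} (f : ι → Ω → ℝ) (hm : ∀ i, Measurable (f i))
    (hind : iIndepFun f P) (hL : ∀ i, MemLp (f i) 8 P) (h0 : ∀ i, ∫ ω, f i ω ∂P = 0) (D : ℝ)
    (hD : 1 ≤ D) (h8 : ∀ i, ∫ ω, f i ω ^ 8 ∂P ≤ D) (s : Finset ι) :
    ∫ ω, (∑ i ∈ s, f i ω) ^ 8 ∂P ≤ (494 * D * s.card) ^ 4 := by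
  classical
  induction s using Finset.induction_on with
  | empty => simp
  | insert a s ha ih =>
    set S : Ω → ℝ := fun ω => ∑ i ∈ s, f i ω with hS
    have hSL : MemLp S 8 P := memLp_finsetSum _ fun i _ => hL i
    have hSm : Measurable S := Finset.measurable_sum _ fun i _ => hm i
    have hi : IndepFun S (f a) P := by
      have := hind.indepFun_finsetSum_of_notMem hm ha
      convert this using 1
      funext ω; simp [hS]
    have i8 := integrable_pow_of_memLp (q := 8) hSL 8 le_rfl
    have i7 := integrable_pow_of_memLp (q := 8) hSL 7 (by norm_num)
    have i6 := integrable_pow_of_memLp (q := 8) hSL 6 (by norm_num)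
    have x8 := integrable_pow_of_memLp (q := 8) (hL a) 8 le_rfl
    have x2 := integrable_pow_of_memLp (q := 8) (hL a) 2 (by norm_num)
    have x1 := integrable_pow_of_memLp (q := 8) (hL a) 1 (by norm_num)
    simp only [pow_one] at x1
    have hi7 : IndepFun (fun ω => S ω ^ 7) (f a) P :=
      hi.comp (φ := fun x => x ^ 7) (ψ := id) (by fun_prop) measurable_id
    have hi6 : IndepFun (fun ω => S ω ^ 6) (fun ω => f a ω ^ 2) P :=
      hi.comp (φ := fun x => x ^ 6) (ψ := fun x => x ^ 2) (by fun_prop) (by fun_prop)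
    have j7 : Integrable (fun ω => S ω ^ 7 * f a ω) P := hi7.integrable_mul i7 x1
    have j6 : Integrable (fun ω => S ω ^ 6 * f a ω ^ 2) P := hi6.integrable_mul i6 x2
    have v7 : ∫ ω, S ω ^ 7 * f a ω ∂P = 0 := by
      rw [hi7.integral_fun_mul_eq_mul_integral i7.1 x1.1, h0, mul_zero]
    have v6 : ∫ ω, S ω ^ 6 * f a ω ^ 2 ∂P = (∫ ω, S ω ^ 6 ∂P) * ∫ ω, f a ω ^ 2 ∂P :=
      hi6.integral_fun_mul_eq_mul_integral i6.1 x2.1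
    have hx2 : ∫ ω, f a ω ^ 2 ∂P ≤ 2 * D := by
      have h1 : ∫ ω, f a ω ^ 2 ∂P ≤ ∫ ω, (1 + f a ω ^ 8) ∂P := by
        refine integral_mono x2 ((integrable_const _).add x8) fun ω => ?_
        rcases le_total (f a ω ^ 2) 1 with h | h
        · have : 0 ≤ f a ω ^ 8 := by positivity
          simp only []
          linarith
        · have h2 := le_self_pow₀ h (n := 4) (by norm_num)
          rw [← pow_mul, show 2 * 4 = 8 from rfl] at h2
          simp only []
          linarith
      rw [integral_add (integrable_const _) x8] at h1
      simp only [integral_const, probReal_univ, one_smul] at h1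
      linarith [h8 a]
    have hx20 : 0 ≤ ∫ ω, f a ω ^ 2 ∂P := integral_nonneg fun ω => by positivity
    have hmain : ∫ ω, (∑ i ∈ insert a s, f i ω) ^ 8 ∂P ≤
        ∫ ω, S ω ^ 8 ∂P + 247 * ((∫ ω, S ω ^ 6 ∂P) * (2 * D) + D) := by
      have hT : MemLp (fun ω => ∑ i ∈ insert a s, f i ω) 8 P := memLp_finsetSum _ fun i _ => hL i
      have h1 : ∫ ω, (∑ i ∈ insert a s, f i ω) ^ 8 ∂P ≤
          ∫ ω, (S ω ^ 8 + 8 * (S ω ^ 7 * f a ω) + 247 * (S ω ^ 6 * f a ω ^ 2 + f a ω ^ 8)) ∂P := by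
        refine integral_mono (integrable_pow_of_memLp (q := 8) hT 8 le_rfl)
          ((i8.add (j7.const_mul 8)).add ((j6.add x8).const_mul 247)) fun ω => ?_
        simp only [Finset.sum_insert ha]
        rw [add_comm (f a ω)]
        exact add_pow_eight_le _ _
      have hA : Integrable (fun ω => S ω ^ 8 + 8 * (S ω ^ 7 * f a ω)) P := i8.add (j7.const_mul 8)
      have hB : Integrable (fun ω => 247 * (S ω ^ 6 * f a ω ^ 2 + f a ω ^ 8)) P :=
        (j6.add x8).const_mul 247
      rw [integral_add hA hB,
        integral_add i8 (j7.const_mul 8), integral_const_mul, integral_const_mul,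
        integral_add j6 x8, v7, v6] at h1
      have h6 : 0 ≤ ∫ ω, S ω ^ 6 ∂P := integral_nonneg fun ω => by positivity
      have h2 := mul_le_mul_of_nonneg_left hx2 h6
      have h3 := h8 a
      linarith
    refine hmain.trans ?_
    rw [Finset.card_insert_of_notMem ha]
    rcases Nat.eq_zero_or_pos s.card with hc | hc
    · rw [Finset.card_eq_zero] at hc
      rw [hc] at hS ⊢
      simp only [hS, Finset.sum_empty, Finset.card_empty]
      norm_num
      nlinarith [one_le_pow₀ hD (n := 3)]
    · set N : ℝ := (s.card : ℝ) with hN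
      have hN1 : (1 : ℝ) ≤ N := by rw [hN]; exact_mod_cast hc
      -- `494 = 2 * 247`: the increment then is at most `k (k N) ^ 3 + k`, which the difference of
      -- `(k (N + 1)) ^ 4` and `(k N) ^ 4` covers, so the induction closes.
      set k : ℝ := 494 * D with hk
      have hk1 : 494 ≤ k := by rw [hk]; linarith
      have hkN : 0 < k * N := by positivity
      have h6 : ∫ ω, S ω ^ 6 ∂P ≤ (k * N) ^ 3 := by
        have h1 : ∫ ω, S ω ^ 6 ∂P ≤ ∫ ω, (3 / 4 * (S ω ^ 8 / (k * N)) + (k * N) ^ 3 / 4) ∂P :=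
          integral_mono i6 (((i8.div_const _).const_mul _).add (integrable_const _))
            fun ω => pow_six_mul_le hkN _
        rw [integral_add ((i8.div_const _).const_mul _) (integrable_const _), integral_const_mul,
          integral_div] at h1
        simp only [integral_const, probReal_univ, one_smul] at h1
        have h2 : (∫ ω, S ω ^ 8 ∂P) / (k * N) ≤ (k * N) ^ 3 := by
          rw [div_le_iff₀ hkN]; refine ih.trans (le_of_eq (by ring))
        linarith
      push_cast
      have hkD : 247 * (2 * D) = k := by rw [hk]; ring
      have h7 : 247 * ((∫ ω, S ω ^ 6 ∂P) * (2 * D) + D) ≤ k * (k * N) ^ 3 + k := by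
        have := mul_le_mul_of_nonneg_right h6 (show 0 ≤ k by linarith)
        rw [← hkD] at this ⊢
        linarith
      have h8 : (k * (N + 1)) ^ 4 = (k * N) ^ 4 + 4 * (k * (k * N) ^ 3) + 6 * (k ^ 4 * N ^ 2)
        + 4 * (k ^ 4 * N) + k ^ 4 := by ring
      have h9 : k ≤ k ^ 4 := le_self_pow₀ (by linarith) (by norm_num)
      have h10 : 0 ≤ k * (k * N) ^ 3 := by positivity
      have h11 : 0 ≤ k ^ 4 * N ^ 2 := by positivity
      have h12 : 0 ≤ k ^ 4 * N := by positivity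
      linarith

/-- The eighth moment bound for independent copies of a function of one coordinate. -/
theorem lintegral_pi_sum_pow_eight_le {f : Ω → ℝ} (hf : Measurable f) (D : ℝ) (hD : 1 ≤ D)
    (h8 : ∫⁻ ω, ENNReal.ofReal (f ω ^ 8) ∂P ≤ ENNReal.ofReal D) (h0 : ∫ ω, f ω ∂P = 0) (N : ℕ) :
    ∫⁻ z, ENNReal.ofReal ((∑ j : Fin N, f (z j)) ^ 8) ∂(Measure.pi fun _ : Fin N => P) ≤
      ENNReal.ofReal ((494 * D) ^ 4 * N ^ 4) := by
  have hi8 : Integrable (fun ω => f ω ^ 8) P := by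
    refine ⟨(hf.pow_const 8).aestronglyMeasurable, ?_⟩
    rw [hasFiniteIntegral_iff_ofReal (Eventually.of_forall fun ω => by positivity)]
    exact h8.trans_lt ENNReal.ofReal_lt_top
  have hL : MemLp f 8 P := by
    have h1 : MemLp (fun ω => f ω ^ 8) 1 P := memLp_one_iff_integrable.2 hi8
    rw [← integrable_norm_rpow_iff hf.aestronglyMeasurable (by norm_num) (by norm_num)]
    refine hi8.norm.congr (Eventually.of_forall fun ω => ?_)
    simp only [norm_pow]
    rw [← Real.rpow_natCast]
    norm_num
  have hpres : ∀ j : Fin N, MeasurePreserving (fun z : Fin N → Ω => z j)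
      (Measure.pi fun _ : Fin N => P) P := fun j => measurePreserving_eval _ j
  have hind : iIndepFun (fun (j : Fin N) (z : Fin N → Ω) => f (z j))
      (Measure.pi fun _ : Fin N => P) := iIndepFun_pi fun _ => hf.aemeasurable
  have hLj : ∀ j : Fin N, MemLp (fun z : Fin N → Ω => f (z j)) 8 (Measure.pi fun _ : Fin N => P) :=
    fun j => hL.comp_measurePreserving (hpres j)
  have hint : ∀ g : Ω → ℝ, Measurable g → ∀ j : Fin N,
      ∫ z, g (z j) ∂(Measure.pi fun _ : Fin N => P) = ∫ ω, g ω ∂P := fun g hg j => by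
    conv_rhs => rw [← (hpres j).map_eq]
    rw [integral_map (measurable_pi_apply j).aemeasurable hg.aestronglyMeasurable]
  have hD8 : ∫ ω, f ω ^ 8 ∂P ≤ D := by
    rw [← ofReal_integral_eq_lintegral_ofReal hi8 (Eventually.of_forall fun ω => by positivity)]
      at h8
    exact (ENNReal.ofReal_le_ofReal_iff (by linarith)).1 h8
  have h1 := integral_sum_pow_eight_le (P := Measure.pi fun _ : Fin N => P)
    (fun (j : Fin N) (z : Fin N → Ω) => f (z j)) (fun j => hf.comp (measurable_pi_apply j)) hind hLj
    (fun j => (hint f hf j).trans h0) D hD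
    (fun j => (hint (fun ω => f ω ^ 8) (hf.pow_const 8) j).trans_le hD8) Finset.univ
  rw [Finset.card_univ, Fintype.card_fin, mul_pow] at h1
  rw [← ofReal_integral_eq_lintegral_ofReal]
  · exact ENNReal.ofReal_le_ofReal h1
  · exact integrable_pow_of_memLp (q := 8) (memLp_finsetSum _ fun j _ => hLj j) 8 le_rfl
  · exact Eventually.of_forall fun z => by positivity

end Moments


/-! ### Response laws: moments, support, sampling from a uniform variable -/

lemma lintegral_poissonMeasure (r : NNReal) (g : ℕ → ENNReal) :
    ∫⁻ k, g k ∂(poissonMeasure r) =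
      ∑' k : ℕ, ENNReal.ofReal (Real.exp (-r) * r ^ k / k.factorial) * g k := by
  unfold poissonMeasure
  rw [lintegral_sum_measure]
  refine tsum_congr fun k => ?_
  rw [lintegral_smul_measure, lintegral_dirac' _ (measurable_of_countable g), smul_eq_mul]

/-- The Chen–Stein identity, by a shift of the summation index. Iterated, it yields the factorial
moments. -/
lemma lintegral_poissonMeasure_mul (r : NNReal) (g : ℕ → ENNReal) :
    ∫⁻ k, k * g k ∂(poissonMeasure r) = r * ∫⁻ k, g (k + 1) ∂(poissonMeasure r) := by
  rw [lintegral_poissonMeasure, lintegral_poissonMeasure, tsum_eq_zero_add' ENNReal.summable,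
    ← ENNReal.tsum_mul_left]
  simp only [Nat.cast_zero, zero_mul, mul_zero, zero_add]
  refine tsum_congr fun k => ?_
  rw [← mul_assoc, ← mul_assoc]
  congr 1
  rw [← ENNReal.ofReal_natCast, ← ENNReal.ofReal_mul (by positivity),
    ← ENNReal.ofReal_coe_nnreal, ← ENNReal.ofReal_mul (by positivity)]
  congr 1
  rw [Nat.factorial_succ]
  have : (k.factorial : ℝ) ≠ 0 := by positivity
  have : ((k : ℝ) + 1) ≠ 0 := by positivity
  push_cast
  field_simp
  ring

lemma lintegral_descFactorial_poissonMeasure (r : NNReal) (q : ℕ) :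
    ∫⁻ k, (k.descFactorial q : ENNReal) ∂(poissonMeasure r) = r ^ q := by
  induction q with
  | zero => simp
  | succ q ih =>
    have h : ∀ k : ℕ, (k.descFactorial (q + 1) : ENNReal) = k * ((k - 1).descFactorial q : ℕ) := by
      intro k
      rw [← Nat.cast_mul]
      congr 1
      cases k with
      | zero => simp
      | succ k => rw [Nat.succ_descFactorial_succ]; simp
    simp_rw [h]
    rw [lintegral_poissonMeasure_mul r fun k => ((k - 1).descFactorial q : ℕ)]
    simp only [Nat.add_sub_cancel]
    rw [ih, pow_succ']

lemma add_one_pow_eight_le_descFactorial (k : ℕ) :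
    (1 + k) ^ 8 ≤ 9 ^ 8 * (1 + k.descFactorial 8) := by
  rcases lt_or_ge k 8 with h | h
  · have : (1 + k) ^ 8 ≤ 9 ^ 8 := Nat.pow_le_pow_left (by omega) 8
    nlinarith [Nat.zero_le (k.descFactorial 8)]
  · have h1 := Nat.pow_sub_le_descFactorial k 8
    have h2 : (1 + k) ^ 8 ≤ (9 * (k + 1 - 8)) ^ 8 := Nat.pow_le_pow_left (by omega) 8
    rw [mul_pow] at h2
    refine h2.trans (Nat.mul_le_mul_left _ ?_)
    omega

/-- The weight of a response against which the summands of the bound are compared. -/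
noncomputable def Family.tail : Family → ℝ → ℝ
  | .poisson, y => (1 + |y|) ^ 8
  | .gamma α, y => (1 + |y|) ^ 8 + |y| ^ (-(α / 2))

lemma Family.pow_le_tail (fam : Family) (y : ℝ) : (1 + |y|) ^ 8 ≤ fam.tail y := by
  cases fam with
  | poisson => exact le_rfl
  | gamma α =>
    have : 0 ≤ |y| ^ (-(α / 2)) := Real.rpow_nonneg (abs_nonneg _) _
    simp only [Family.tail]; linarith

lemma Family.measurable_tail (fam : Family) : Measurable fam.tail := by
  cases fam <;> unfold Family.tail <;> fun_prop

/-- The set in which the responses lie. -/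
def Family.support : Family → Set ℝ
  | .poisson => Set.Ici 0
  | .gamma _ => Set.Ioi 0

lemma Family.measurableSet_support (fam : Family) : MeasurableSet fam.support := by
  cases fam
  · exact measurableSet_Ici
  · exact measurableSet_Ioi

lemma Family.isProbabilityMeasure_responseLaw (fam : Family) (hfam : fam.Admissible) (η : ℝ) :
    IsProbabilityMeasure (fam.responseLaw η) := by
  cases fam with
  | poisson => exact Measure.isProbabilityMeasure_map (measurable_of_countable _).aemeasurable
  | gamma α => exact isProbabilityMeasure_gammaMeasure hfam (div_pos hfam (Real.exp_pos _))

lemma Family.measurable_responseLaw (fam : Family) : Measurable fam.responseLaw := by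
  refine Measure.measurable_of_measurable_coe _ fun s hs => ?_
  cases fam with
  | poisson =>
    have : ∀ η : ℝ, Family.poisson.responseLaw η s = ∑' k : ℕ,
        ENNReal.ofReal (Real.exp (-((Real.exp η).toNNReal : ℝ)) * ((Real.exp η).toNNReal : ℝ) ^ k
          / k.factorial) * ((fun k : ℕ => (k : ℝ)) ⁻¹' s).indicator 1 k := by
      intro η
      simp only [Family.responseLaw]
      rw [Measure.map_apply (measurable_of_countable _) hs, ← lintegral_indicator_one
        (measurable_of_countable (fun k : ℕ => (k : ℝ)) hs), lintegral_poissonMeasure]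
    simp_rw [this]
    refine Measurable.tsum fun k => Measurable.mul_const ?_ _
    fun_prop
  | gamma α =>
    have : ∀ η : ℝ, (Family.gamma α).responseLaw η s =
        ∫⁻ y in s, gammaPDF α (α / Real.exp η) y := by
      intro η
      simp only [Family.responseLaw, gammaMeasure]
      rw [withDensity_apply _ hs]
    simp_rw [this]
    refine Measurable.lintegral_prod_right' (f := fun q : ℝ × ℝ =>
      gammaPDF α (α / Real.exp q.1) q.2) ?_
    unfold gammaPDF gammaPDFReal
    refine Measurable.ennreal_ofReal (Measurable.ite ?_ ?_ ?_)
    · exact measurableSet_le measurable_const measurable_snd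
    · fun_prop
    · fun_prop

/-- Multiplication by `y ^ q` turns the Gamma density into a multiple of the one with shape `α + q`.
Negative `q` above `-α` is allowed, and `q = -α / 2` is needed for the logarithm of the response. -/
lemma lintegral_rpow_gammaMeasure {α r q : ℝ} (hα : 0 < α) (hr : 0 < r) (hq : 0 < α + q) :
    ∫⁻ y, ENNReal.ofReal (|y| ^ q) ∂(gammaMeasure α r) =
      ENNReal.ofReal (Real.Gamma (α + q) / (Real.Gamma α * r ^ q)) := by
  unfold gammaMeasure
  have hmeas : ∀ a, Measurable (gammaPDF a r) := fun a =>
    (measurable_gammaPDFReal a r).ennreal_ofReal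
  rw [lintegral_withDensity_eq_lintegral_mul _ (hmeas α) (by fun_prop)]
  have hG := Real.Gamma_pos_of_pos hα
  have hG' := Real.Gamma_pos_of_pos hq
  have hrq : 0 < r ^ q := Real.rpow_pos_of_pos hr _
  have key : ∀ y : ℝ, y ≠ 0 → (gammaPDF α r * fun y => ENNReal.ofReal (|y| ^ q)) y =
      ENNReal.ofReal (Real.Gamma (α + q) / (Real.Gamma α * r ^ q)) * gammaPDF (α + q) r y := by
    intro y hy
    simp only [Pi.mul_apply]
    rcases lt_or_gt_of_ne hy with h | h
    · rw [gammaPDF_of_neg h, gammaPDF_of_neg h, zero_mul, mul_zero]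
    · rw [gammaPDF_of_nonneg h.le, gammaPDF_of_nonneg h.le, ← ENNReal.ofReal_mul (by positivity),
        ← ENNReal.ofReal_mul (by positivity), abs_of_pos h]
      congr 1
      rw [Real.rpow_add hr, show α + q - 1 = (α - 1) + q by ring, Real.rpow_add h]
      field_simp
  rw [lintegral_congr_ae (g := fun y => ENNReal.ofReal (Real.Gamma (α + q) / (Real.Gamma α * r ^ q))
    * gammaPDF (α + q) r y), lintegral_const_mul _ (hmeas _), lintegral_gammaPDF_eq_one hq hr,
    mul_one]
  have : ∀ᵐ y : ℝ ∂volume, y ≠ 0 := by simp [ae_iff]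
  filter_upwards [this] with y hy using key y hy

lemma Family.responseLaw_support (fam : Family) (hfam : fam.Admissible) (η : ℝ) :
    fam.responseLaw η fam.support = 1 := by
  cases fam with
  | poisson =>
    simp only [Family.responseLaw, Family.support]
    rw [Measure.map_apply (measurable_of_countable _) measurableSet_Ici]
    have : ((fun k : ℕ => (k : ℝ)) ⁻¹' Set.Ici 0) = Set.univ := by ext k; simp
    rw [this, measure_univ]
  | gamma α =>
    have hr : 0 < α / Real.exp η := div_pos hfam (Real.exp_pos _)
    have := isProbabilityMeasure_gammaMeasure hfam hr
    simp only [Family.responseLaw, Family.support]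
    rw [prob_compl_eq_zero_iff measurableSet_Ioi |>.symm]
    rw [Set.compl_Ioi, gammaMeasure, withDensity_apply _ measurableSet_Iic,
      setLIntegral_congr Iio_ae_eq_Iic.symm]
    exact lintegral_gammaPDF_of_nonpos le_rfl

/-- The response law has mean `exp η`. -/
lemma Family.lintegral_responseLaw (fam : Family) (hfam : fam.Admissible) (η : ℝ) :
    ∫⁻ y, ENNReal.ofReal y ∂(fam.responseLaw η) = ENNReal.ofReal (Real.exp η) := by
  cases fam with
  | poisson =>
    simp only [Family.responseLaw]
    rw [lintegral_map (by fun_prop) (measurable_of_countable _)]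
    have := lintegral_descFactorial_poissonMeasure (Real.exp η).toNNReal 1
    simp only [Nat.descFactorial_one, pow_one] at this
    simp only [ENNReal.ofReal_natCast]
    rw [this]; rfl
  | gamma α =>
    have hα : 0 < α := hfam
    have hr : 0 < α / Real.exp η := div_pos hα (Real.exp_pos _)
    have := lintegral_rpow_gammaMeasure (q := 1) hα hr (by linarith)
    have hs := (Family.gamma α).responseLaw_support hfam η
    have hp := (Family.gamma α).isProbabilityMeasure_responseLaw hfam η
    have hae : ∀ᵐ y ∂((Family.gamma α).responseLaw η), y ∈ (Family.gamma α).support :=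
      (mem_ae_iff_prob_eq_one (Family.measurableSet_support _)).2 hs
    rw [lintegral_congr_ae (g := fun y => ENNReal.ofReal (|y| ^ (1 : ℝ)))]
    · simp only [Family.responseLaw]
      rw [this, Real.Gamma_add_one hα.ne', Real.rpow_one]
      congr 1
      have := (Real.Gamma_pos_of_pos hα).ne'
      have := (Real.exp_pos η).ne'
      field_simp
    · filter_upwards [hae] with y hy
      have hy : 0 < y := hy
      rw [Real.rpow_one, abs_of_pos hy]

/-- The moments occurring in `tail` are bounded by constants and powers of the mean `exp η`, hence
grow at most exponentially in `|η|`. Such growth can be integrated against the effects and the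
covariate. -/
lemma Family.exists_lintegral_tail_le (fam : Family) (hfam : fam.Admissible) :
    ∃ A : ℝ, 0 ≤ A ∧ ∀ η : ℝ, ∫⁻ y, ENNReal.ofReal (fam.tail y) ∂(fam.responseLaw η) ≤
      ENNReal.ofReal (Real.exp (A * (1 + |η|))) := by
  have hexp : ∀ k : ℝ, 0 ≤ k → ∀ η q : ℝ, q ≤ k → -k ≤ q → Real.exp (η * q) ≤ Real.exp (k * |η|) := by
    intro k hk η q h1 h2
    refine Real.exp_le_exp.2 ((le_abs_self _).trans ?_)
    rw [abs_mul, mul_comm]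
    exact mul_le_mul_of_nonneg_right (abs_le.2 ⟨h2, h1⟩) (abs_nonneg _)
  cases fam with
  | poisson =>
    refine ⟨max 8 (Real.log (2 * 9 ^ 8)), by positivity, fun η => ?_⟩
    simp only [Family.responseLaw]
    rw [lintegral_map (Family.measurable_tail _).ennreal_ofReal (measurable_of_countable _)]
    have h1 : ∀ k : ℕ, ENNReal.ofReal (Family.poisson.tail k) ≤
        9 ^ 8 * (1 + (k.descFactorial 8 : ENNReal)) := by
      intro k
      simp only [Family.tail, Nat.abs_cast]
      have := add_one_pow_eight_le_descFactorial k
      have e : (1 + (k : ℝ)) ^ 8 = ((1 + k) ^ 8 : ℕ) := by push_cast; rfl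
      rw [e, ENNReal.ofReal_natCast]
      exact_mod_cast this
    refine (lintegral_mono h1).trans ?_
    rw [lintegral_const_mul _ (measurable_of_countable _),
      lintegral_add_left measurable_const, lintegral_descFactorial_poissonMeasure]
    simp only [lintegral_const, measure_univ, mul_one]
    have e : (9 ^ 8 * (1 + ((Real.exp η).toNNReal : ENNReal) ^ 8)) =
        ENNReal.ofReal (9 ^ 8 * (1 + Real.exp η ^ 8)) := by
      rw [ENNReal.ofReal_mul (by positivity), ENNReal.ofReal_add (by positivity) (by positivity),
        ENNReal.ofReal_pow (by positivity), ENNReal.ofReal_pow (by positivity)]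
      simp [ENNReal.ofReal]
    rw [e]
    refine ENNReal.ofReal_le_ofReal ?_
    have h2 : Real.exp η ^ 8 ≤ Real.exp (8 * |η|) := by
      rw [← Real.exp_nat_mul]
      have := hexp 8 (by norm_num) η 8 le_rfl (by norm_num)
      rwa [mul_comm] at this
    have h3 : (1 : ℝ) ≤ Real.exp (8 * |η|) := Real.one_le_exp (by positivity)
    calc 9 ^ 8 * (1 + Real.exp η ^ 8) ≤ (2 * 9 ^ 8) * Real.exp (8 * |η|) := by linarith
      _ = Real.exp (Real.log (2 * 9 ^ 8) + 8 * |η|) := by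
          rw [Real.exp_add, Real.exp_log (by norm_num)]
      _ ≤ _ := by
          refine Real.exp_le_exp.2 ?_
          have := mul_le_mul_of_nonneg_right (le_max_left 8 (Real.log (2 * 9 ^ 8))) (abs_nonneg η)
          linarith [le_max_right 8 (Real.log (2 * 9 ^ 8))]
  | gamma α =>
    have hα : 0 < α := hfam
    set c₁ := Real.Gamma (α + 8) / Real.Gamma α * α⁻¹ ^ (8 : ℝ) with hc₁
    set c₂ := Real.Gamma (α + -(α / 2)) / Real.Gamma α * α⁻¹ ^ (-(α / 2)) with hc₂
    have hG := Real.Gamma_pos_of_pos hα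
    have hG1 := Real.Gamma_pos_of_pos (show 0 < α + 8 by linarith)
    have hG2 := Real.Gamma_pos_of_pos (show 0 < α + -(α / 2) by linarith)
    have p1 : 0 < c₁ := by positivity
    have p2 : 0 < c₂ := by positivity
    set B := 2 ^ 7 * (1 + c₁) + c₂ with hB
    have hB0 : 0 < B := by positivity
    refine ⟨max (8 + α) (Real.log B), (by linarith : (0 : ℝ) ≤ 8 + α).trans (le_max_left _ _),
      fun η => ?_⟩
    have hr : 0 < α / Real.exp η := div_pos hα (Real.exp_pos _)
    have hprob := isProbabilityMeasure_gammaMeasure hα hr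
    have h1 : ∀ y : ℝ, ENNReal.ofReal ((Family.gamma α).tail y) ≤
        2 ^ 7 * (1 + ENNReal.ofReal (|y| ^ (8 : ℝ))) + ENNReal.ofReal (|y| ^ (-(α / 2))) := by
      intro y
      simp only [Family.tail]
      rw [ENNReal.ofReal_add (by positivity) (Real.rpow_nonneg (abs_nonneg _) _)]
      gcongr
      have e : (2 ^ 7 * (1 + ENNReal.ofReal (|y| ^ (8 : ℝ)))) =
          ENNReal.ofReal (2 ^ 7 * (1 + |y| ^ (8 : ℝ))) := by
        rw [ENNReal.ofReal_mul (by positivity), ENNReal.ofReal_add (by positivity) (by positivity),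
          ENNReal.ofReal_pow (by positivity)]
        simp
      rw [e]
      refine ENNReal.ofReal_le_ofReal ?_
      have := add_pow_le (zero_le_one' ℝ) (abs_nonneg y) 8
      rw [show ((8 : ℝ)) = ((8 : ℕ) : ℝ) by norm_num, Real.rpow_natCast]
      simpa using this
    refine (lintegral_mono h1).trans ?_
    simp only [Family.responseLaw]
    have m1 : Measurable fun y : ℝ => ENNReal.ofReal (|y| ^ (8 : ℝ)) := by fun_prop
    rw [lintegral_add_left (by fun_prop), lintegral_const_mul _ (by fun_prop),
      lintegral_add_left measurable_const, lintegral_rpow_gammaMeasure hα hr (by linarith),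
      lintegral_rpow_gammaMeasure hα hr (by linarith)]
    simp only [lintegral_const, measure_univ, mul_one]
    have hq : ∀ q : ℝ, (α / Real.exp η) ^ q = (α⁻¹ ^ q * Real.exp (η * q))⁻¹ := by
      intro q
      rw [Real.exp_mul, ← Real.mul_rpow (by positivity) (by positivity), ← Real.inv_rpow (by positivity)]
      congr 1
      field_simp
    rw [hq, hq]
    have e1 : Real.Gamma (α + 8) / (Real.Gamma α * (α⁻¹ ^ (8 : ℝ) * Real.exp (η * 8))⁻¹)
        = c₁ * Real.exp (η * 8) := by
      rw [hc₁]; field_simp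
    have e2 : Real.Gamma (α + -(α / 2)) / (Real.Gamma α *
        (α⁻¹ ^ (-(α / 2)) * Real.exp (η * -(α / 2)))⁻¹) = c₂ * Real.exp (η * -(α / 2)) := by
      rw [hc₂]; field_simp
    rw [e1, e2]
    have e : (2 ^ 7 * (1 + ENNReal.ofReal (c₁ * Real.exp (η * 8)))
        + ENNReal.ofReal (c₂ * Real.exp (η * -(α / 2)))) =
        ENNReal.ofReal (2 ^ 7 * (1 + c₁ * Real.exp (η * 8)) + c₂ * Real.exp (η * -(α / 2))) := by
      rw [ENNReal.ofReal_add (by positivity) (by positivity),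
        ENNReal.ofReal_mul (p := 2 ^ 7) (by positivity),
        ENNReal.ofReal_add (by positivity) (by positivity), ENNReal.ofReal_pow (by positivity)]
      simp
    rw [e]
    refine ENNReal.ofReal_le_ofReal ?_
    have f1 := hexp (8 + α) (by linarith) η 8 (by linarith) (by linarith)
    have f2 := hexp (8 + α) (by linarith) η (-(α / 2)) (by linarith) (by linarith)
    have f3 : (1 : ℝ) ≤ Real.exp ((8 + α) * |η|) := Real.one_le_exp (by positivity)
    calc _ ≤ B * Real.exp ((8 + α) * |η|) := by
          have g1 := mul_le_mul_of_nonneg_left f1 p1.le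
          have g2 := mul_le_mul_of_nonneg_left f2 p2.le
          rw [hB]; linarith
      _ = Real.exp (Real.log B + (8 + α) * |η|) := by rw [Real.exp_add, Real.exp_log hB0]
      _ ≤ _ := by
          refine Real.exp_le_exp.2 ?_
          have := mul_le_mul_of_nonneg_right (le_max_left (8 + α) (Real.log B)) (abs_nonneg η)
          linarith [le_max_right (8 + α) (Real.log B)]

/-- A sampler draws responses with a given linear predictor from a uniform variable. -/
structure IsSampler (fam : Family) (F : ℝ → unitInterval → ℝ) : Prop where
  measurable : Measurable (Function.uncurry F)
  map_eq : ∀ η, volume.map (F η) = fam.responseLaw η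

/-- A Markov kernel into the real line is the image of a uniform variable. With samplers,
conditional independence of the responses becomes independence of uniform variables, and the law of
a row is an image of a product measure. -/
lemma Family.exists_isSampler (fam : Family) (hfam : fam.Admissible) : ∃ F, IsSampler fam F := by
  let κ : Kernel ℝ ℝ := ⟨fam.responseLaw, fam.measurable_responseLaw⟩
  have : IsMarkovKernel κ := ⟨fun η => fam.isProbabilityMeasure_responseLaw hfam η⟩
  obtain ⟨F, h1, h2⟩ := κ.exists_measurable_map_eq_unitInterval
  exact ⟨F, h1, h2⟩


/-! ### The law of one cell given the row effect, and integrability under it -/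

/-- All exponential moments are finite. -/
def ExpMoments (μ : Measure ℝ) : Prop := ∀ t : ℝ, Integrable (fun x => Real.exp (t * x)) μ

lemma ExpMoments.integrable_abs {μ : Measure ℝ} (h : ExpMoments μ) (A : ℝ) :
    Integrable (fun x => Real.exp (A * |x|)) μ := by
  refine ((h A).add (h (-A))).mono' (by fun_prop) (Eventually.of_forall fun x => ?_)
  rw [Real.norm_of_nonneg (Real.exp_pos _).le]
  simp only [Pi.add_apply]
  rcases abs_cases x with ⟨h1, -⟩ | ⟨h1, -⟩
  · rw [h1]; linarith [Real.exp_pos (-A * x)]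
  · rw [h1]
    have : A * -x = -A * x := by ring
    rw [this]; linarith [Real.exp_pos (A * x)]

lemma expMoments_gaussianReal (s : NNReal) : ExpMoments (gaussianReal 0 s) := fun t =>
  integrable_exp_mul_gaussianReal t

lemma ExpMoments.exists_le {μ : Measure ℝ} (h : ExpMoments μ) (A : ℝ) :
    ∃ B : ℝ, 0 ≤ B ∧ ∫⁻ x, ENNReal.ofReal (Real.exp (A * |x|)) ∂μ ≤
      ENNReal.ofReal (Real.exp B) := by
  have h1 := h.integrable_abs A
  refine ⟨Real.log (1 + ∫ x, Real.exp (A * |x|) ∂μ), ?_, ?_⟩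
  · refine Real.log_nonneg ?_
    have : 0 ≤ ∫ x, Real.exp (A * |x|) ∂μ := integral_nonneg fun x => (Real.exp_pos _).le
    linarith
  · have : 0 ≤ ∫ x, Real.exp (A * |x|) ∂μ := integral_nonneg fun x => (Real.exp_pos _).le
    rw [← ofReal_integral_eq_lintegral_ofReal h1 (Eventually.of_forall fun x => (Real.exp_pos _).le),
      Real.exp_log (by linarith)]
    exact ENNReal.ofReal_le_ofReal (by linarith)

/-- The joint law of covariate and response in one cell of a row with effect `u`. -/
noncomputable def cellLaw (F : ℝ → unitInterval → ℝ) (b β1 : ℝ) (ν τ : Measure ℝ) (u : ℝ) :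
    Measure (ℝ × ℝ) :=
  (ν.prod (τ.prod volume)).map fun q => (q.1, F (b + β1 * q.1 + u + q.2.1) q.2.2)

/-- `f` is bounded by an exponential in the effect and the covariate times the weight `T` of the
response. -/
def Dominated (T : ℝ → ℝ) (f : ℝ → ℝ × ℝ → ℝ) : Prop :=
  ∃ A : ℝ, 0 ≤ A ∧ ∀ u q, |f u q| ≤ Real.exp (A * (1 + |u| + |q.1|)) * T q.2

lemma Dominated.mono {T T' : ℝ → ℝ} {f g : ℝ → ℝ × ℝ → ℝ} (h : Dominated T f)
    (hT : ∀ y, T y ≤ T' y) (hg : ∀ u q, |g u q| ≤ |f u q|) : Dominated T' g := by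
  obtain ⟨A, hA, h⟩ := h
  exact ⟨A, hA, fun u q => (hg u q).trans ((h u q).trans
    (mul_le_mul_of_nonneg_left (hT _) (Real.exp_pos _).le))⟩

lemma Dominated.add {T : ℝ → ℝ} {f g : ℝ → ℝ × ℝ → ℝ} (hT : ∀ y, 0 ≤ T y) (hf : Dominated T f)
    (hg : Dominated T g) : Dominated T fun u q => f u q + g u q := by
  obtain ⟨A, hA, h⟩ := hf
  obtain ⟨B, hB, h'⟩ := hg
  refine ⟨A + B + 1, by positivity, fun u q => (abs_add_le _ _).trans ?_⟩
  set z := 1 + |u| + |q.1| with hz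
  have hz1 : 1 ≤ z := by rw [hz]; linarith [abs_nonneg u, abs_nonneg q.1]
  have h1 : Real.exp (A * z) ≤ Real.exp ((A + B) * z) := Real.exp_le_exp.2 (by nlinarith)
  have h2 : Real.exp (B * z) ≤ Real.exp ((A + B) * z) := Real.exp_le_exp.2 (by nlinarith)
  have h3 : 2 ≤ Real.exp z := by linarith [Real.add_one_le_exp z]
  have h4 : Real.exp (A * z) + Real.exp (B * z) ≤ Real.exp ((A + B + 1) * z) := by
    have : Real.exp ((A + B + 1) * z) = Real.exp ((A + B) * z) * Real.exp z := by
      rw [← Real.exp_add]; congr 1; ring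
    rw [this]
    nlinarith [Real.exp_pos ((A + B) * z)]
  have := mul_le_mul_of_nonneg_right h4 (hT q.2)
  linarith [h u q, h' u q]

lemma Dominated.mul {T T' : ℝ → ℝ} {f g : ℝ → ℝ × ℝ → ℝ} (hf : Dominated T f)
    (hg : Dominated T' g) : Dominated (fun y => T y * T' y) fun u q => f u q * g u q := by
  obtain ⟨A, hA, h⟩ := hf
  obtain ⟨B, hB, h'⟩ := hg
  refine ⟨A + B, by positivity, fun u q => ?_⟩
  rw [abs_mul, add_mul, Real.exp_add]
  refine (mul_le_mul (h u q) (h' u q) (abs_nonneg _) ((abs_nonneg _).trans (h u q))).trans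
    (le_of_eq (by ring))

lemma Dominated.pow {T : ℝ → ℝ} {f : ℝ → ℝ × ℝ → ℝ} (hf : Dominated T f) (k : ℕ) :
    Dominated (fun y => T y ^ k) fun u q => f u q ^ k := by
  induction k with
  | zero => exact ⟨0, le_rfl, fun u q => by simp⟩
  | succ k ih =>
    have := ih.mul hf
    simpa only [← pow_succ] using this

lemma dominated_exp {f : ℝ → ℝ × ℝ → ℝ} (A : ℝ) (hA : 0 ≤ A)
    (h : ∀ u q, |f u q| ≤ Real.exp (A * (1 + |u| + |q.1|))) : Dominated (fun _ => 1) f :=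
  ⟨A, hA, fun u q => by simpa using h u q⟩

lemma dominated_exp_affine (a b c : ℝ) :
    Dominated (fun _ => 1) fun u q => Real.exp (a + b * q.1 + c * u) := by
  refine dominated_exp (|a| + |b| + |c|) (by positivity) fun u q => ?_
  rw [abs_of_pos (Real.exp_pos _)]
  refine Real.exp_le_exp.2 ?_
  have h1 : b * q.1 ≤ |b| * |q.1| := by rw [← abs_mul]; exact le_abs_self _
  have h2 : c * u ≤ |c| * |u| := by rw [← abs_mul]; exact le_abs_self _
  have := le_abs_self a
  have p1 : 0 ≤ |a| * |u| := by positivity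
  have p2 : 0 ≤ |a| * |q.1| := by positivity
  have p3 : 0 ≤ |b| * |u| := by positivity
  have p4 : 0 ≤ |c| * |q.1| := by positivity
  have p5 := abs_nonneg b
  have p6 := abs_nonneg c
  linarith

/-- Functions of the covariate with at most exponential growth. -/
def ExpGrowth (φ : ℝ → ℝ) : Prop := ∃ A : ℝ, 0 ≤ A ∧ ∀ x, |φ x| ≤ Real.exp (A * (1 + |x|))

lemma ExpGrowth.dominated {φ : ℝ → ℝ} (h : ExpGrowth φ) :
    Dominated (fun _ => 1) fun _ q => φ q.1 := by
  obtain ⟨A, hA, h⟩ := h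
  refine dominated_exp A hA fun u q => (h _).trans (Real.exp_le_exp.2 ?_)
  have : 0 ≤ A * |u| := by positivity
  linarith

section CellLaw

variable {fam : Family} {F : ℝ → unitInterval → ℝ} {ν τ : Measure ℝ} [IsProbabilityMeasure τ]

lemma IsSampler.measurable_comp (hF : IsSampler fam F) (b β1 u : ℝ) :
    Measurable fun q : ℝ × ℝ × unitInterval => F (b + β1 * q.1 + u + q.2.1) q.2.2 :=
  hF.measurable.comp (g := Function.uncurry F)
    (f := fun q : ℝ × ℝ × unitInterval => (b + β1 * q.1 + u + q.2.1, q.2.2)) (by fun_prop)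

lemma IsSampler.measurable_cell (hF : IsSampler fam F) (b β1 u : ℝ) :
    Measurable fun q : ℝ × ℝ × unitInterval => (q.1, F (b + β1 * q.1 + u + q.2.1) q.2.2) :=
  measurable_fst.prodMk (hF.measurable_comp b β1 u)

lemma IsSampler.isProbabilityMeasure_cellLaw [IsProbabilityMeasure ν] (hF : IsSampler fam F) (b β1 u : ℝ) :
    IsProbabilityMeasure (cellLaw F b β1 ν τ u) :=
  Measure.isProbabilityMeasure_map (hF.measurable_cell b β1 u).aemeasurable

lemma lintegral_cellLaw (hF : IsSampler fam F) (b β1 u : ℝ) {g : ℝ × ℝ → ENNReal}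
    (hg : Measurable g) :
    ∫⁻ q, g q ∂(cellLaw F b β1 ν τ u) =
      ∫⁻ x, ∫⁻ v, ∫⁻ y, g (x, y) ∂(fam.responseLaw (b + β1 * x + u + v)) ∂τ ∂ν := by
  have hm := hF.measurable_cell b β1 u
  unfold cellLaw
  have hgm : Measurable fun q : ℝ × ℝ × unitInterval =>
      g (q.1, F (b + β1 * q.1 + u + q.2.1) q.2.2) := hg.comp hm
  rw [lintegral_map hg hm, lintegral_prod _ hgm.aemeasurable]
  refine lintegral_congr fun x => ?_
  have hgx : Measurable fun q : ℝ × unitInterval => g (x, F (b + β1 * x + u + q.1) q.2) :=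
    hgm.comp measurable_prodMk_left
  rw [lintegral_prod _ hgx.aemeasurable]
  refine lintegral_congr fun v => ?_
  have hgy : Measurable fun y => g (x, y) := hg.comp measurable_prodMk_left
  rw [← hF.map_eq, lintegral_map hgy hF.measurable.of_uncurry_left]

/-- Integrating out the response, then the opposite effect `v`, then the covariate, one meets
exponentials of `|v|` and `|x|` only, which are integrable. What is left is exponential in `|u|`,
with a constant that does not depend on `u`. -/
theorem exists_lintegral_cellLaw_le (hfam : fam.Admissible) (hF : IsSampler fam F) (b β1 : ℝ)
    (hν : ExpMoments ν) (hτ : ExpMoments τ) {f : ℝ → ℝ × ℝ → ℝ} (hf : Dominated fam.tail f)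
    (hfm : ∀ u, Measurable (f u)) :
    ∃ A : ℝ, 0 ≤ A ∧ ∀ u, ∫⁻ q, ENNReal.ofReal |f u q| ∂(cellLaw F b β1 ν τ u) ≤
      ENNReal.ofReal (Real.exp (A * (1 + |u|))) := by
  obtain ⟨A₁, hA₁, h1⟩ := hf
  obtain ⟨A₂, hA₂, h2⟩ := fam.exists_lintegral_tail_le hfam
  obtain ⟨B₁, hB₁, h3⟩ := hν.exists_le (A₁ + A₂ * |β1|)
  obtain ⟨B₂, hB₂, h4⟩ := hτ.exists_le A₂
  refine ⟨A₁ + A₂ + A₂ * |b| + B₁ + B₂, by positivity, fun u => ?_⟩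
  rw [lintegral_cellLaw hF b β1 u (hfm u).abs.ennreal_ofReal]
  have key : ∀ x v, ∫⁻ y, ENNReal.ofReal |f u (x, y)| ∂(fam.responseLaw (b + β1 * x + u + v)) ≤
      ENNReal.ofReal (Real.exp (A₁ + A₂ + A₂ * |b| + (A₁ + A₂) * |u|)) *
        (ENNReal.ofReal (Real.exp ((A₁ + A₂ * |β1|) * |x|)) *
          ENNReal.ofReal (Real.exp (A₂ * |v|))) := by
    intro x v
    have e1 : ∀ y, ENNReal.ofReal |f u (x, y)| ≤
        ENNReal.ofReal (Real.exp (A₁ * (1 + |u| + |x|))) * ENNReal.ofReal (fam.tail y) := by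
      intro y
      rw [← ENNReal.ofReal_mul (Real.exp_pos _).le]
      exact ENNReal.ofReal_le_ofReal (h1 u (x, y))
    refine (lintegral_mono e1).trans ?_
    rw [lintegral_const_mul _ fam.measurable_tail.ennreal_ofReal]
    refine (mul_le_mul_right (h2 _) _).trans ?_
    rw [← ENNReal.ofReal_mul (Real.exp_pos _).le, ← ENNReal.ofReal_mul (Real.exp_pos _).le,
      ← ENNReal.ofReal_mul (Real.exp_pos _).le, ← Real.exp_add, ← Real.exp_add, ← Real.exp_add]
    refine ENNReal.ofReal_le_ofReal (Real.exp_le_exp.2 ?_)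
    have e2 : |b + β1 * x + u + v| ≤ |b| + |β1| * |x| + |u| + |v| := by
      rw [← abs_mul]
      linarith [abs_add_le (b + β1 * x + u) v, abs_add_le (b + β1 * x) u, abs_add_le b (β1 * x)]
    have e3 := mul_le_mul_of_nonneg_left e2 hA₂
    linarith
  refine (lintegral_mono fun x => lintegral_mono fun v => key x v).trans ?_
  have e4 : ∀ x : ℝ, ∫⁻ v, ENNReal.ofReal (Real.exp (A₁ + A₂ + A₂ * |b| + (A₁ + A₂) * |u|)) *
        (ENNReal.ofReal (Real.exp ((A₁ + A₂ * |β1|) * |x|)) *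
          ENNReal.ofReal (Real.exp (A₂ * |v|))) ∂τ ≤
      ENNReal.ofReal (Real.exp (A₁ + A₂ + A₂ * |b| + (A₁ + A₂) * |u|)) *
        (ENNReal.ofReal (Real.exp ((A₁ + A₂ * |β1|) * |x|)) * ENNReal.ofReal (Real.exp B₂)) := by
    intro x
    rw [lintegral_const_mul _ (by fun_prop), lintegral_const_mul _ (by fun_prop)]
    gcongr
  refine (lintegral_mono e4).trans ?_
  rw [lintegral_const_mul _ (by fun_prop), lintegral_mul_const _ (by fun_prop)]
  refine (mul_le_mul_right (mul_le_mul_left h3 _) _).trans ?_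
  rw [← ENNReal.ofReal_mul (Real.exp_pos _).le, ← ENNReal.ofReal_mul (Real.exp_pos _).le,
    ← Real.exp_add, ← Real.exp_add]
  refine ENNReal.ofReal_le_ofReal (Real.exp_le_exp.2 ?_)
  have p1 : 0 ≤ A₂ * |b| * |u| := by positivity
  have p2 : 0 ≤ B₁ * |u| := by positivity
  have p3 : 0 ≤ B₂ * |u| := by positivity
  linarith

lemma integrable_cellLaw (hfam : fam.Admissible) (hF : IsSampler fam F) (b β1 : ℝ)
    (hν : ExpMoments ν) (hτ : ExpMoments τ) {f : ℝ → ℝ × ℝ → ℝ} (hf : Dominated fam.tail f)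
    (hfm : ∀ u, Measurable (f u)) (u : ℝ) : Integrable (f u) (cellLaw F b β1 ν τ u) := by
  obtain ⟨A, -, hA⟩ := exists_lintegral_cellLaw_le hfam hF b β1 hν hτ hf hfm
  refine ⟨(hfm u).aestronglyMeasurable, ?_⟩
  rw [hasFiniteIntegral_iff_norm]
  exact (hA u).trans_lt ENNReal.ofReal_lt_top

variable [IsProbabilityMeasure ν]

lemma one_le_pow_tail (y : ℝ) : (1 : ℝ) ≤ (1 + |y|) ^ 8 :=
  one_le_pow₀ (by linarith [abs_nonneg y])

lemma Family.one_le_tail (fam : Family) (y : ℝ) : 1 ≤ fam.tail y :=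
  (one_le_pow_tail y).trans (fam.pow_le_tail y)

lemma Family.add_le_tail (fam : Family) (y : ℝ) : 1 + |y| ≤ fam.tail y :=
  (le_self_pow₀ (by linarith [abs_nonneg y]) (by norm_num)).trans (fam.pow_le_tail y)

lemma dominated_response : Dominated (fun y => 1 + |y|) fun _ q => q.2 :=
  ⟨0, le_rfl, fun u q => by simp⟩

lemma integral_cellLaw_covariate (hF : IsSampler fam F) (b β1 : ℝ) {φ : ℝ → ℝ}
    (hφ : Measurable φ) (u : ℝ) : ∫ q, φ q.1 ∂(cellLaw F b β1 ν τ u) = ∫ x, φ x ∂ν := by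
  unfold cellLaw
  have hm : Measurable fun q : ℝ × ℝ => φ q.1 := hφ.comp measurable_fst
  rw [integral_map (hF.measurable_cell b β1 u).aemeasurable hm.aestronglyMeasurable,
    integral_fun_fst]
  simp

lemma IsSampler.integral_eq (hF : IsSampler fam F) (hfam : fam.Admissible) (η : ℝ) :
    ∫ ξ, F η ξ = Real.exp η := by
  have h1 : ∫ ξ, F η ξ = ∫ y, y ∂(fam.responseLaw η) := by
    have hm : Measurable fun y : ℝ => y := measurable_id
    rw [← hF.map_eq η, integral_map hF.measurable.of_uncurry_left.aemeasurable
      hm.aestronglyMeasurable]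
  have hp := fam.isProbabilityMeasure_responseLaw hfam η
  have hae : ∀ᵐ y ∂(fam.responseLaw η), 0 ≤ y := by
    filter_upwards [(mem_ae_iff_prob_eq_one fam.measurableSet_support).2
      (fam.responseLaw_support hfam η)] with y hy
    cases fam with
    | poisson => exact hy
    | gamma α => exact le_of_lt hy
  rw [h1, integral_eq_lintegral_of_nonneg_ae hae aestronglyMeasurable_id,
    fam.lintegral_responseLaw hfam, ENNReal.toReal_ofReal (Real.exp_pos _).le]

/-- The mean of the response times a function of the covariate. -/
lemma integral_cellLaw_response (hfam : fam.Admissible) (hF : IsSampler fam F) (b β1 : ℝ)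
    (hν : ExpMoments ν) (hτ : ExpMoments τ) {φ : ℝ → ℝ} (hφ : Measurable φ) (hg : ExpGrowth φ)
    (u : ℝ) :
    ∫ q, q.2 * φ q.1 ∂(cellLaw F b β1 ν τ u) =
      (∫ x, φ x * Real.exp (b + β1 * x + u) ∂ν) * ∫ v, Real.exp v ∂τ := by
  have hd : Dominated fam.tail fun _ q => q.2 * φ q.1 :=
    (dominated_response.mul hg.dominated).mono (fun y => by simpa using fam.add_le_tail y)
      fun _ _ => le_rfl
  have hm : Measurable fun q : ℝ × ℝ => q.2 * φ q.1 :=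
    measurable_snd.mul (hφ.comp measurable_fst)
  have hint := integrable_cellLaw hfam hF b β1 hν hτ hd (fun _ => hm) u
  have hc := hF.measurable_cell b β1 u
  unfold cellLaw at hint ⊢
  rw [integrable_map_measure hm.aestronglyMeasurable hc.aemeasurable] at hint
  change Integrable (fun q : ℝ × ℝ × unitInterval => F (b + β1 * q.1 + u + q.2.1) q.2.2 * φ q.1) _
    at hint
  rw [integral_map hc.aemeasurable hm.aestronglyMeasurable, integral_prod _ hint,
    ← integral_mul_const]
  refine integral_congr_ae ?_
  filter_upwards [hint.prod_right_ae] with x hx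
  rw [integral_prod _ hx]
  simp only []
  rw [← integral_const_mul]
  refine integral_congr_ae (Eventually.of_forall fun v => ?_)
  simp only []
  rw [integral_mul_const, hF.integral_eq hfam, Real.exp_add]
  ring

end CellLaw


/-! ### Scores, weights and slack of a cell -/

/-- The scale of the weights of a row with effect `u`. -/
noncomputable def Family.scale : Family → ℝ → ℝ
  | .poisson, u => Real.exp u
  | .gamma _, _ => 1

lemma Family.exp_le_scale (fam : Family) (u : ℝ) : Real.exp (-|u|) ≤ fam.scale u := by
  cases fam
  · exact Real.exp_le_exp.2 (neg_abs_le u)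
  · exact Real.exp_le_one_iff.2 (by simp)

lemma Family.scale_le_exp (fam : Family) (u : ℝ) : fam.scale u ≤ Real.exp |u| := by
  cases fam
  · exact Real.exp_le_exp.2 (le_abs_self u)
  · exact Real.one_le_exp (abs_nonneg _)

/-- The weighted score of a cell. -/
noncomputable def Family.score (fam : Family) (b₀ β1 : ℝ) (φ : ℝ → ℝ) (u : ℝ) (q : ℝ × ℝ) : ℝ :=
  (fam.linWeight q.2 - fam.expWeight (b₀ + β1 * q.1 + u) q.2) * φ q.1 / fam.scale u

/-- The mean of the scaled exponential weight times a function of the covariate. -/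
noncomputable def Family.limit (fam : Family) (b₀ β1 : ℝ) (ν : Measure ℝ) (φ : ℝ → ℝ) : ℝ :=
  match fam with
  | .poisson => ∫ x, φ x * Real.exp (b₀ + β1 * x) ∂ν
  | .gamma _ => ∫ x, φ x ∂ν

/-- The scaled exponential weight of a cell times a function of the covariate, centered. -/
noncomputable def Family.excess (fam : Family) (b₀ β1 : ℝ) (ν : Measure ℝ) (φ : ℝ → ℝ) (u : ℝ)
    (q : ℝ × ℝ) : ℝ :=
  fam.expWeight (b₀ + β1 * q.1 + u) q.2 * φ q.1 / fam.scale u - fam.limit b₀ β1 ν φ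

/-- An upper bound of the gain of one cell over all values of the predictor. -/
noncomputable def Family.slack (fam : Family) (b₀ β1 u : ℝ) (q : ℝ × ℝ) : ℝ :=
  let w := fam.expWeight (b₀ + β1 * q.1 + u) q.2
  (match fam with
    | .poisson => (q.2 - w) ^ 2 / w
    | .gamma _ => |Real.log w| + w) + (fam.linWeight q.2 * |q.1| + w * Real.exp (|q.1| + 1))

lemma Family.measurable_linWeight (fam : Family) : Measurable fam.linWeight := by
  cases fam <;> unfold Family.linWeight <;> fun_prop

lemma Family.measurable_expWeight (fam : Family) (b₀ β1 u : ℝ) :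
    Measurable fun q : ℝ × ℝ => fam.expWeight (b₀ + β1 * q.1 + u) q.2 := by
  cases fam <;> unfold Family.expWeight <;> fun_prop

lemma Family.measurable_score (fam : Family) (b₀ β1 : ℝ) {φ : ℝ → ℝ} (hφ : Measurable φ) (u : ℝ) :
    Measurable (fam.score b₀ β1 φ u) := by
  have h1 := fam.measurable_linWeight
  have h2 := fam.measurable_expWeight b₀ β1 u
  unfold Family.score
  fun_prop

lemma Family.measurable_excess (fam : Family) (b₀ β1 : ℝ) (ν : Measure ℝ) {φ : ℝ → ℝ}
    (hφ : Measurable φ) (u : ℝ) : Measurable (fam.excess b₀ β1 ν φ u) := by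
  have h2 := fam.measurable_expWeight b₀ β1 u
  unfold Family.excess
  fun_prop

lemma Family.measurable_slack (fam : Family) (b₀ β1 u : ℝ) : Measurable (fam.slack b₀ β1 u) := by
  have h1 := fam.measurable_linWeight
  have h2 := fam.measurable_expWeight b₀ β1 u
  cases fam <;> unfold Family.slack <;> fun_prop

lemma one_le_one_add_abs (y : ℝ) : (1 : ℝ) ≤ 1 + |y| := by linarith [abs_nonneg y]

lemma Family.dominated_linWeight (fam : Family) :
    Dominated (fun y => 1 + |y|) fun _ q => fam.linWeight q.2 := by
  refine ⟨0, le_rfl, fun u q => ?_⟩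
  cases fam <;> simp [Family.linWeight]

lemma Family.dominated_expWeight (fam : Family) (b₀ β1 : ℝ) :
    Dominated (fun y => 1 + |y|) fun u q => fam.expWeight (b₀ + β1 * q.1 + u) q.2 := by
  cases fam with
  | poisson =>
    refine (dominated_exp_affine b₀ β1 1).mono one_le_one_add_abs fun u q => ?_
    simp [Family.expWeight]
  | gamma α =>
    refine (dominated_response.mul (dominated_exp_affine (-b₀) (-β1) (-1))).mono
      (fun y => by simp) fun u q => ?_
    simp only [Family.expWeight]
    refine le_of_eq ?_
    congr 3; ring

lemma Family.dominated_scale_inv (fam : Family) :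
    Dominated (fun _ => 1) fun u _ => (fam.scale u)⁻¹ := by
  cases fam with
  | poisson =>
    refine (dominated_exp_affine 0 0 (-1)).mono (fun _ => le_rfl) fun u q => ?_
    simp [Family.scale, Real.exp_neg]
  | gamma α => exact ⟨0, le_rfl, fun u q => by simp [Family.scale]⟩

lemma Dominated.neg {T : ℝ → ℝ} {f : ℝ → ℝ × ℝ → ℝ} (h : Dominated T f) :
    Dominated T fun u q => -f u q := h.mono (fun _ => le_rfl) fun _ _ => by simp

lemma Family.dominated_score (fam : Family) (b₀ β1 : ℝ) {φ : ℝ → ℝ} (hφ : ExpGrowth φ) :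
    Dominated (fun y => 1 + |y|) (fam.score b₀ β1 φ) := by
  have h := (((fam.dominated_linWeight).add (fun y => by positivity)
    (fam.dominated_expWeight b₀ β1).neg).mul hφ.dominated).mul fam.dominated_scale_inv
  refine h.mono (fun y => by simp) fun u q => ?_
  simp only [Family.score, div_eq_mul_inv, sub_eq_add_neg]
  exact le_rfl

lemma Family.dominated_weighted (fam : Family) (b₀ β1 : ℝ) {φ : ℝ → ℝ} (hφ : ExpGrowth φ) :
    Dominated (fun y => 1 + |y|)
      fun u q => fam.expWeight (b₀ + β1 * q.1 + u) q.2 * φ q.1 / fam.scale u := by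
  have h := ((fam.dominated_expWeight b₀ β1).mul hφ.dominated).mul fam.dominated_scale_inv
  refine h.mono (fun y => by simp) fun u q => ?_
  simp only [div_eq_mul_inv]
  exact le_rfl

lemma dominated_const (k : ℝ) : Dominated (fun y => 1 + |y|) fun _ _ => k := by
  refine ⟨|k|, abs_nonneg k, fun u q => ?_⟩
  have h1 := Real.add_one_le_exp (|k| * (1 + |u| + |q.1|))
  have h2 : 0 ≤ |k| * (|u| + |q.1|) := by positivity
  have h3 := mul_le_mul_of_nonneg_left (one_le_one_add_abs q.2)
    (Real.exp_pos (|k| * (1 + |u| + |q.1|))).le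
  linarith

lemma Family.dominated_excess (fam : Family) (b₀ β1 : ℝ) (ν : Measure ℝ) {φ : ℝ → ℝ}
    (hφ : ExpGrowth φ) : Dominated (fun y => 1 + |y|) (fam.excess b₀ β1 ν φ) :=
  ((fam.dominated_weighted b₀ β1 hφ).add (fun y => by positivity)
    (dominated_const (-fam.limit b₀ β1 ν φ))).mono (fun _ => le_rfl) fun u q => by
      simp only [Family.excess, sub_eq_add_neg]; exact le_rfl

/-- A polynomial takes care of large `|y|`. Near zero `log z ≤ z ^ (α / 4) / (α / 4)` with `z =
|y|⁻¹`, squared, produces the negative power that a Gamma law of shape `α` still integrates. -/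
lemma abs_log_sq_le {α : ℝ} (hα : 0 < α) (y : ℝ) :
    Real.log y ^ 2 ≤ (1 + 16 / α ^ 2) * ((1 + |y|) ^ 8 + |y| ^ (-(α / 2))) := by
  rw [← Real.log_abs]
  have hr : 0 ≤ |y| ^ (-(α / 2)) := Real.rpow_nonneg (abs_nonneg _) _
  have hp : (1 + |y|) ^ 2 ≤ (1 + |y|) ^ 8 := pow_le_pow_right₀ (one_le_one_add_abs y) (by norm_num)
  have hp1 := one_le_pow_tail y
  have ha : 0 ≤ 16 / α ^ 2 := by positivity
  rcases (abs_nonneg y).eq_or_lt' with h0 | h0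
  · rw [h0, Real.log_zero]
    have : 0 ≤ (1 + 16 / α ^ 2) * ((1 + 0) ^ 8 + (0 : ℝ) ^ (-(α / 2))) := by positivity
    simpa using this
  rcases le_total 1 |y| with h | h
  · have h1 := Real.log_le_self (abs_nonneg y)
    have h2 := Real.log_nonneg h
    have h3 : Real.log |y| ^ 2 ≤ |y| ^ 2 := by gcongr
    have h4 : |y| ^ 2 ≤ (1 + |y|) ^ 2 := by gcongr; linarith
    have h5 : 0 ≤ 16 / α ^ 2 * ((1 + |y|) ^ 8 + |y| ^ (-(α / 2))) := by positivity
    linarith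
  · have h1 := Real.log_le_rpow_div (x := |y|⁻¹) (by positivity) (show 0 < α / 4 by linarith)
    rw [Real.log_inv, Real.inv_rpow h0.le, ← Real.rpow_neg h0.le] at h1
    have h2 : 0 ≤ -Real.log |y| := by linarith [Real.log_nonpos h0.le h]
    have h3 : (-Real.log |y|) ^ 2 ≤ (|y| ^ (-(α / 4)) / (α / 4)) ^ 2 := by gcongr
    have h4 : (|y| ^ (-(α / 4)) / (α / 4)) ^ 2 = 16 / α ^ 2 * |y| ^ (-(α / 2)) := by
      rw [div_pow, ← Real.rpow_natCast (|y| ^ _), ← Real.rpow_mul h0.le]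
      rw [show -(α / 4) * ((2 : ℕ) : ℝ) = -(α / 2) by push_cast; ring]
      field_simp; ring
    have h5 : 0 ≤ 16 / α ^ 2 * (1 + |y|) ^ 8 := by positivity
    rw [h4, neg_sq] at h3
    linarith

/-- Second moments of the slack are all that bad rows require. In the Poisson case the slack is at
most quadratic in the response; in the Gamma case only the logarithm calls for the negative power in
`tail`. -/
lemma Family.dominated_slack_sq (fam : Family) (hfam : fam.Admissible) (b₀ β1 : ℝ) :
    Dominated fam.tail fun u q => fam.slack b₀ β1 u q ^ 2 := by
  have hx : ExpGrowth fun x => |x| := ⟨1, zero_le_one, fun x => by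
    rw [abs_abs]; linarith [Real.add_one_le_exp (1 * (1 + |x|))]⟩
  have he : ExpGrowth fun x => Real.exp (|x| + 1) := ⟨1, zero_le_one, fun x => by
    rw [abs_of_pos (Real.exp_pos _)]; exact Real.exp_le_exp.2 (by linarith)⟩
  have hmain : Dominated (fun y => 1 + |y|) fun u q => fam.linWeight q.2 * |q.1|
      + fam.expWeight (b₀ + β1 * q.1 + u) q.2 * Real.exp (|q.1| + 1) :=
    ((fam.dominated_linWeight.mul hx.dominated).mono (fun y => by simp) fun _ _ => le_rfl).add
      (fun y => by positivity)
      (((fam.dominated_expWeight b₀ β1).mul he.dominated).mono (fun y => by simp) fun _ _ => le_rfl)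
  cases fam with
  | poisson =>
    have h1 : Dominated (fun y => (1 + |y|) ^ 2) fun u q =>
        (q.2 - Family.poisson.expWeight (b₀ + β1 * q.1 + u) q.2) ^ 2
          / Family.poisson.expWeight (b₀ + β1 * q.1 + u) q.2 := by
      have := ((dominated_response.add (fun y => by positivity)
        (Family.poisson.dominated_expWeight b₀ β1).neg).pow 2).mul
        (dominated_exp_affine (-b₀) (-β1) (-1))
      refine this.mono (fun y => by simp) fun u q => le_of_eq ?_
      simp only [Family.expWeight, div_eq_mul_inv, ← Real.exp_neg, sub_eq_add_neg]
      congr 3; ring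
    have h2 : Dominated (fun y => (1 + |y|) ^ 2) (Family.poisson.slack b₀ β1) :=
      h1.add (fun y => by positivity) (hmain.mono
        (fun y => le_self_pow₀ (one_le_one_add_abs y) (by norm_num)) fun _ _ => le_rfl)
    refine (h2.pow 2).mono (fun y => ?_) fun _ _ => le_rfl
    rw [← pow_mul]
    exact (pow_le_pow_right₀ (one_le_one_add_abs y) (by norm_num)).trans
      (Family.poisson.pow_le_tail y)
  | gamma α =>
    have hα : 0 < α := hfam
    set fam := Family.gamma α with hfm
    have hw := fam.dominated_expWeight b₀ β1
    have ht0 : ∀ y, 0 ≤ fam.tail y := fun y => zero_le_one.trans (fam.one_le_tail y)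
    have hsq : ∀ y : ℝ, (1 + |y|) ^ 2 ≤ fam.tail y := fun y =>
      (pow_le_pow_right₀ (one_le_one_add_abs y) (by norm_num)).trans (fam.pow_le_tail y)
    have hlog : Dominated fam.tail fun u q => Real.log q.2 ^ 2 := by
      refine ⟨1 + 16 / α ^ 2, by positivity, fun u q => ?_⟩
      rw [abs_of_nonneg (sq_nonneg _)]
      refine (abs_log_sq_le hα q.2).trans (mul_le_mul_of_nonneg_right ?_ (ht0 _))
      have h1 := Real.add_one_le_exp ((1 + 16 / α ^ 2) * (1 + |u| + |q.1|))
      have h2 : 0 ≤ (1 + 16 / α ^ 2) * (|u| + |q.1|) := by positivity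
      linarith
    have haff : Dominated (fun _ => 1) fun u q => b₀ + β1 * q.1 + u :=
      dominated_exp (|b₀| + |β1| + 1) (by positivity) fun u q => by
        have h1 := Real.add_one_le_exp ((|b₀| + |β1| + 1) * (1 + |u| + |q.1|))
        have e2 : |b₀ + β1 * q.1 + u| ≤ |b₀| + |β1| * |q.1| + |u| := by
          rw [← abs_mul]
          linarith [abs_add_le (b₀ + β1 * q.1) u, abs_add_le b₀ (β1 * q.1)]
        have p1 : 0 ≤ |b₀| * (|u| + |q.1|) := by positivity
        have p2 : 0 ≤ |β1| * |u| := by positivity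
        have p3 := abs_nonneg β1
        have p4 := abs_nonneg q.1
        linarith
    have haff2 : Dominated fam.tail fun u q => (b₀ + β1 * q.1 + u) ^ 2 :=
      (haff.pow 2).mono (fun y => by simpa using fam.one_le_tail y) fun _ _ => le_rfl
    have hw2 := (hw.pow 2).mono (T' := fam.tail) hsq fun _ _ => le_rfl
    have hm2 := (hmain.pow 2).mono (T' := fam.tail) hsq fun _ _ => le_rfl
    have hsum := ((hlog.add ht0 haff2).add ht0 (hw2.add ht0 hm2))
    have hfour : Dominated fam.tail fun u q => 4 * (Real.log q.2 ^ 2 + (b₀ + β1 * q.1 + u) ^ 2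
        + (fam.expWeight (b₀ + β1 * q.1 + u) q.2 ^ 2 + (fam.linWeight q.2 * |q.1|
        + fam.expWeight (b₀ + β1 * q.1 + u) q.2 * Real.exp (|q.1| + 1)) ^ 2)) := by
      have h2 := hsum.add ht0 hsum
      refine (h2.add ht0 h2).mono (fun _ => le_rfl) fun u q => le_of_eq ?_
      congr 1; ring
    refine hfour.mono (fun _ => le_rfl) fun u q => ?_
    set w := fam.expWeight (b₀ + β1 * q.1 + u) q.2 with hwdef
    set E := fam.linWeight q.2 * |q.1| + w * Real.exp (|q.1| + 1) with hE
    have hs : fam.slack b₀ β1 u q = |Real.log w| + w + E := rfl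
    have hl : |Real.log w| ≤ |Real.log q.2| + |b₀ + β1 * q.1 + u| := by
      have : w = q.2 * Real.exp (-(b₀ + β1 * q.1 + u)) := rfl
      rw [this]
      rcases eq_or_ne q.2 0 with h | h
      · rw [h]; simp
      · rw [Real.log_mul h (Real.exp_pos _).ne', Real.log_exp]
        exact (abs_add_le _ _).trans (by rw [abs_neg])
    rw [hs, abs_of_nonneg (sq_nonneg (|Real.log w| + w + E))]
    refine le_trans ?_ (le_abs_self _)
    rw [← sq_abs (Real.log q.2), ← sq_abs (b₀ + β1 * q.1 + u), ← sq_abs w, ← sq_abs E]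
    have h3 : (|Real.log w| + w + E) ^ 2 ≤
        (|Real.log q.2| + |b₀ + β1 * q.1 + u| + |w| + |E|) ^ 2 := by
      rw [← sq_abs]
      gcongr
      refine (abs_add_le _ _).trans ?_
      gcongr
      refine (abs_add_le _ _).trans ?_
      gcongr
      rwa [abs_abs]
    refine h3.trans ?_
    generalize |Real.log q.2| = a
    generalize |b₀ + β1 * q.1 + u| = b
    generalize |w| = c
    generalize |E| = d
    nlinarith only [sq_nonneg (a - b), sq_nonneg (a - c), sq_nonneg (a - d), sq_nonneg (b - c),
      sq_nonneg (b - d), sq_nonneg (c - d)]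


section Means

variable {fam : Family} {F : ℝ → unitInterval → ℝ} {ν τ : Measure ℝ} [IsProbabilityMeasure ν]
  [IsProbabilityMeasure τ]

/-- The effect `u` drops out: in the Poisson case it cancels against the scale, and in the Gamma
case the response divided by its mean given covariate and `u` has mean one. The hypothesis `hb` says
that integrating out the opposite effect shifts the intercept from `b` to `b₀`. -/
lemma integral_cellLaw_weighted (hfam : fam.Admissible) (hF : IsSampler fam F) (b b₀ β1 : ℝ)
    (hν : ExpMoments ν) (hτ : ExpMoments τ) (hb : ∫ v, Real.exp v ∂τ = Real.exp (b₀ - b))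
    {φ : ℝ → ℝ} (hφ : Measurable φ) (hg : ExpGrowth φ) (u : ℝ) :
    ∫ q, fam.expWeight (b₀ + β1 * q.1 + u) q.2 * φ q.1 / fam.scale u ∂(cellLaw F b β1 ν τ u) =
      fam.limit b₀ β1 ν φ := by
  cases fam with
  | poisson =>
    simp only [Family.expWeight, Family.scale, Family.limit]
    rw [← integral_cellLaw_covariate (τ := τ) hF b β1
      (φ := fun x => φ x * Real.exp (b₀ + β1 * x)) (by fun_prop) u]
    refine integral_congr_ae (Eventually.of_forall fun q => ?_)
    simp only []
    rw [Real.exp_add _ u]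
    have := (Real.exp_pos u).ne'
    field_simp
  | gamma α =>
    simp only [Family.expWeight, Family.scale, Family.limit, div_one]
    set ψ : ℝ → ℝ := fun x => Real.exp (-(b₀ + β1 * x + u)) * φ x with hψ
    have hψm : Measurable ψ := by fun_prop
    have hψg : ExpGrowth ψ := by
      obtain ⟨A, hA, h⟩ := hg
      refine ⟨|b₀| + |β1| + |u| + A, by positivity, fun x => ?_⟩
      rw [hψ]
      simp only []
      rw [abs_mul, abs_of_pos (Real.exp_pos _), add_mul, Real.exp_add]
      refine mul_le_mul (Real.exp_le_exp.2 ?_) (h x) (abs_nonneg _) (Real.exp_pos _).le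
      have e2 : -(b₀ + β1 * x + u) ≤ |b₀| + |β1| * |x| + |u| := by
        rw [← abs_mul]
        linarith [neg_le_abs b₀, neg_le_abs (β1 * x), neg_le_abs u]
      have p1 : 0 ≤ |b₀| * |x| := by positivity
      have p2 : 0 ≤ |u| * |x| := by positivity
      have p3 := abs_nonneg β1
      linarith
    have h := integral_cellLaw_response hfam hF b β1 hν hτ hψm hψg u
    have e : ∀ q : ℝ × ℝ, q.2 * Real.exp (-(b₀ + β1 * q.1 + u)) * φ q.1 = q.2 * ψ q.1 := fun q => by
      rw [hψ]; ring
    simp_rw [e]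
    rw [h, hb, ← integral_mul_const]
    refine integral_congr_ae (Eventually.of_forall fun x => ?_)
    simp only [hψ]
    have : Real.exp (-(b₀ + β1 * x + u)) * Real.exp (b + β1 * x + u) * Real.exp (b₀ - b) = 1 := by
      rw [← Real.exp_add, ← Real.exp_add, ← Real.exp_zero]; congr 1; ring
    linear_combination φ x * this

lemma integral_cellLaw_linear (hfam : fam.Admissible) (hF : IsSampler fam F) (b b₀ β1 : ℝ)
    (hν : ExpMoments ν) (hτ : ExpMoments τ) (hb : ∫ v, Real.exp v ∂τ = Real.exp (b₀ - b))
    {φ : ℝ → ℝ} (hφ : Measurable φ) (hg : ExpGrowth φ) (u : ℝ) :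
    ∫ q, fam.linWeight q.2 * φ q.1 / fam.scale u ∂(cellLaw F b β1 ν τ u) =
      fam.limit b₀ β1 ν φ := by
  cases fam with
  | poisson =>
    simp only [Family.linWeight, Family.scale, Family.limit]
    rw [integral_div, integral_cellLaw_response hfam hF b β1 hν hτ hφ hg u, hb,
      ← integral_mul_const, ← integral_div]
    refine integral_congr_ae (Eventually.of_forall fun x => ?_)
    simp only []
    rw [div_eq_iff (Real.exp_pos u).ne', mul_assoc, mul_assoc, ← Real.exp_add, ← Real.exp_add]
    congr 2; ring
  | gamma α =>
    simp only [Family.linWeight, Family.scale, Family.limit, div_one, one_mul]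
    exact integral_cellLaw_covariate hF b β1 hφ u

lemma Family.dominated_tail (fam : Family) {f : ℝ → ℝ × ℝ → ℝ}
    (h : Dominated (fun y => 1 + |y|) f) : Dominated fam.tail f :=
  h.mono fam.add_le_tail fun _ _ => le_rfl

/-- Linear and exponential weights have the same mean at the shifted intercept `b₀`. So the row
likelihood, although it omits the other effect, has an unbiased score there, and this determines the
limit of the intercept. -/
lemma integral_score (hfam : fam.Admissible) (hF : IsSampler fam F) (b b₀ β1 : ℝ)
    (hν : ExpMoments ν) (hτ : ExpMoments τ) (hb : ∫ v, Real.exp v ∂τ = Real.exp (b₀ - b))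
    {φ : ℝ → ℝ} (hφ : Measurable φ) (hg : ExpGrowth φ) (u : ℝ) :
    ∫ q, fam.score b₀ β1 φ u q ∂(cellLaw F b β1 ν τ u) = 0 := by
  have hm1 := fam.measurable_linWeight
  have hm2 := fam.measurable_expWeight b₀ β1
  have i1 : Integrable (fun q => fam.linWeight q.2 * φ q.1 / fam.scale u)
      (cellLaw F b β1 ν τ u) := by
    have hd := ((fam.dominated_linWeight.mul hg.dominated).mul fam.dominated_scale_inv)
    refine integrable_cellLaw hfam hF b β1 hν hτ (f := fun u q => fam.linWeight q.2 * φ q.1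
      / fam.scale u) (fam.dominated_tail (hd.mono (fun y => by simp) fun u q => ?_))
      (fun u => by fun_prop) u
    simp only [div_eq_mul_inv]
    exact le_rfl
  have i2 : Integrable (fun q => fam.expWeight (b₀ + β1 * q.1 + u) q.2 * φ q.1 / fam.scale u)
      (cellLaw F b β1 ν τ u) :=
    integrable_cellLaw hfam hF b β1 hν hτ
      (f := fun u q => fam.expWeight (b₀ + β1 * q.1 + u) q.2 * φ q.1 / fam.scale u)
      (fam.dominated_tail (fam.dominated_weighted b₀ β1 hg))
      (fun u => by have := hm2 u; fun_prop) u
  have e : ∀ q, fam.score b₀ β1 φ u q = fam.linWeight q.2 * φ q.1 / fam.scale u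
      - fam.expWeight (b₀ + β1 * q.1 + u) q.2 * φ q.1 / fam.scale u := fun q => by
    unfold Family.score; ring
  simp_rw [e]
  rw [integral_sub i1 i2, integral_cellLaw_weighted hfam hF b b₀ β1 hν hτ hb hφ hg,
    integral_cellLaw_linear hfam hF b b₀ β1 hν hτ hb hφ hg, sub_self]

lemma integral_excess (hfam : fam.Admissible) (hF : IsSampler fam F) (b b₀ β1 : ℝ)
    (hν : ExpMoments ν) (hτ : ExpMoments τ) (hb : ∫ v, Real.exp v ∂τ = Real.exp (b₀ - b))
    {φ : ℝ → ℝ} (hφ : Measurable φ) (hg : ExpGrowth φ) (u : ℝ) :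
    ∫ q, fam.excess b₀ β1 ν φ u q ∂(cellLaw F b β1 ν τ u) = 0 := by
  have hm2 := fam.measurable_expWeight b₀ β1
  have i2 : Integrable (fun q => fam.expWeight (b₀ + β1 * q.1 + u) q.2 * φ q.1 / fam.scale u)
      (cellLaw F b β1 ν τ u) :=
    integrable_cellLaw hfam hF b β1 hν hτ
      (f := fun u q => fam.expWeight (b₀ + β1 * q.1 + u) q.2 * φ q.1 / fam.scale u)
      (fam.dominated_tail (fam.dominated_weighted b₀ β1 hg))
      (fun u => by have := hm2 u; fun_prop) u
  have := hF.isProbabilityMeasure_cellLaw (ν := ν) (τ := τ) b β1 u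
  unfold Family.excess
  rw [integral_sub i2 (integrable_const _),
    integral_cellLaw_weighted hfam hF b b₀ β1 hν hτ hb hφ hg]
  simp

/-- The normalized eighth power of a centered sum has an expectation that does not depend on the
number of summands. -/
lemma exists_lintegral_pow_eight_le (hfam : fam.Admissible) (hF : IsSampler fam F) (b β1 : ℝ)
    (hν : ExpMoments ν) (hτ : ExpMoments τ) {f : ℝ → ℝ × ℝ → ℝ}
    (hd : Dominated (fun y => 1 + |y|) f) (hm : ∀ u, Measurable (f u))
    (h0 : ∀ u, ∫ q, f u q ∂(cellLaw F b β1 ν τ u) = 0) :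
    ∃ A : ℝ, 0 ≤ A ∧ ∀ (N : ℕ) (u : ℝ), 0 < N →
      ∫⁻ z, ENNReal.ofReal ((∑ j : Fin N, f u (z j)) ^ 8 / N ^ 4)
        ∂(Measure.pi fun _ : Fin N => cellLaw F b β1 ν τ u) ≤
      ENNReal.ofReal (Real.exp (A * (1 + |u|))) := by
  obtain ⟨A, hA, h8⟩ := exists_lintegral_cellLaw_le hfam hF b β1 hν hτ
    ((hd.pow 8).mono fam.pow_le_tail fun _ _ => le_rfl) fun u => (hm u).pow_const 8
  refine ⟨4 * A + 4 * Real.log 494, by positivity, fun N u hN => ?_⟩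
  have := hF.isProbabilityMeasure_cellLaw (ν := ν) (τ := τ) b β1 u
  have hN4 : (0 : ℝ) < (N : ℝ) ^ 4 := by positivity
  have h1 := lintegral_pi_sum_pow_eight_le (P := cellLaw F b β1 ν τ u) (hm u)
    (Real.exp (A * (1 + |u|))) (Real.one_le_exp (by positivity)) (by
      refine le_trans (le_of_eq ?_) (h8 u)
      refine lintegral_congr fun q => ?_
      rw [abs_of_nonneg (by positivity)]) (h0 u) N
  have e : ∀ z : Fin N → ℝ × ℝ, ENNReal.ofReal ((∑ j : Fin N, f u (z j)) ^ 8 / N ^ 4) =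
      ENNReal.ofReal ((N : ℝ) ^ 4)⁻¹ * ENNReal.ofReal ((∑ j : Fin N, f u (z j)) ^ 8) := by
    intro z
    rw [← ENNReal.ofReal_mul (by positivity), div_eq_inv_mul]
  simp_rw [e]
  rw [lintegral_const_mul' _ _ ENNReal.ofReal_ne_top]
  refine (mul_le_mul_right h1 _).trans ?_
  rw [← ENNReal.ofReal_mul (by positivity)]
  refine ENNReal.ofReal_le_ofReal ?_
  have e2 : ((N : ℝ) ^ 4)⁻¹ * ((494 * Real.exp (A * (1 + |u|))) ^ 4 * N ^ 4) =
      (494 * Real.exp (A * (1 + |u|))) ^ 4 := by field_simp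
  rw [e2]
  have e3 : 494 * Real.exp (A * (1 + |u|)) = Real.exp (Real.log 494 + A * (1 + |u|)) := by
    rw [Real.exp_add, Real.exp_log (by norm_num)]
  rw [e3, ← Real.exp_nat_mul]
  refine Real.exp_le_exp.2 ?_
  push_cast
  have : 0 ≤ Real.log 494 * |u| := mul_nonneg (Real.log_nonneg (by norm_num)) (abs_nonneg u)
  linarith

end Means


/-! ### The remainder of a row and its expectation -/

/-- The size of the deviations of a row with effect `u` and cells `z` from their means. -/
noncomputable def Family.rowError (fam : Family) (b₀ β1 : ℝ) (ν : Measure ℝ) (a₁ b₁ a₂ b₂ : ℝ)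
    {N : ℕ} (u : ℝ) (z : Fin N → ℝ × ℝ) : ℝ :=
  (∑ j, fam.score b₀ β1 (fun _ => 1) u (z j)) ^ 8 / N ^ 4
    + (∑ j, fam.score b₀ β1 (fun x => x) u (z j)) ^ 8 / N ^ 4
    + (∑ j, fam.excess b₀ β1 ν ((Set.Icc a₁ b₁).indicator 1) u (z j)) ^ 8 / N ^ 4
    + (∑ j, fam.excess b₀ β1 ν ((Set.Icc a₂ b₂).indicator 1) u (z j)) ^ 8 / N ^ 4
    + (∑ j, fam.excess b₀ β1 ν (fun x => 1 + x ^ 2 * Real.exp |x|) u (z j)) ^ 8 / N ^ 4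
    + Real.exp (16 * |u|) + (∑ j, fam.slack b₀ β1 u (z j) ^ 2) / N

/-- The supremum over `t` is the Legendre transform `z log z - z + 1`, and `log z ≤ z - 1` bounds it
by the square. -/
lemma poisson_gain_le {z : ℝ} (hz : 0 ≤ z) (t : ℝ) : z * t - (Real.exp t - 1) ≤ (z - 1) ^ 2 := by
  rcases hz.eq_or_lt with h | h
  · rw [← h]; linarith [Real.exp_pos t]
  · have h1 := Real.add_one_le_exp (t - Real.log z)
    have h2 : Real.exp t = z * Real.exp (t - Real.log z) := by
      rw [Real.exp_sub, Real.exp_log h]; field_simp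
    have h3 := mul_le_mul_of_nonneg_left h1 hz
    have h4 := mul_le_mul_of_nonneg_left (Real.log_le_sub_one_of_pos h) hz
    rw [h2]
    linarith

lemma Family.nonneg_of_mem_support {fam : Family} {y : ℝ} (hy : y ∈ fam.support) : 0 ≤ y := by
  cases fam with
  | poisson => exact hy
  | gamma α => exact le_of_lt hy

lemma Family.linWeight_nonneg (fam : Family) {y : ℝ} (hy : 0 ≤ y) : 0 ≤ fam.linWeight y := by
  cases fam
  · exact hy
  · exact zero_le_one

lemma Family.expWeight_pos {fam : Family} {y : ℝ} (hy : y ∈ fam.support) (η : ℝ) :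
    0 < fam.expWeight η y := by
  cases fam with
  | poisson => exact Real.exp_pos _
  | gamma α => exact mul_pos hy (Real.exp_pos _)

/-- This supplies `saturated` in `RowData`: a bound uniform in the predictor. For Poisson one
divides by the weight and uses `poisson_gain_le`; for Gamma the supremum over `t` is `w - 1 - log
w`. -/
lemma Family.gain_le_slack {fam : Family} (b₀ β1 u : ℝ) {q : ℝ × ℝ} (hq : q.2 ∈ fam.support)
    (t : ℝ) : fam.linWeight q.2 * t - fam.expWeight (b₀ + β1 * q.1 + u) q.2 * (Real.exp t - 1) ≤
      fam.slack b₀ β1 u q := by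
  have hy := Family.nonneg_of_mem_support hq
  have hw := Family.expWeight_pos hq (b₀ + β1 * q.1 + u)
  have h0 : 0 ≤ fam.linWeight q.2 * |q.1|
      + fam.expWeight (b₀ + β1 * q.1 + u) q.2 * Real.exp (|q.1| + 1) :=
    add_nonneg (mul_nonneg (fam.linWeight_nonneg hy) (abs_nonneg _))
      (mul_nonneg hw.le (Real.exp_pos _).le)
  cases fam with
  | poisson =>
    set w := Family.poisson.expWeight (b₀ + β1 * q.1 + u) q.2 with hwd
    have h1 := mul_le_mul_of_nonneg_left (poisson_gain_le (div_nonneg hy hw.le) t) hw.le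
    have e1 : w * (q.2 / w * t - (Real.exp t - 1)) = q.2 * t - w * (Real.exp t - 1) := by
      field_simp
    have e2 : w * (q.2 / w - 1) ^ 2 = (q.2 - w) ^ 2 / w := by field_simp
    rw [e1, e2] at h1
    simp only [Family.slack, ← hwd]
    have : Family.poisson.linWeight q.2 = q.2 := rfl
    rw [this] at h0 ⊢
    linarith
  | gamma α =>
    set w := (Family.gamma α).expWeight (b₀ + β1 * q.1 + u) q.2 with hwd
    have h1 := Real.add_one_le_exp (t + Real.log w)
    rw [Real.exp_add, Real.exp_log hw] at h1
    simp only [Family.slack, ← hwd]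
    have : (Family.gamma α).linWeight q.2 = 1 := rfl
    rw [this] at h0 ⊢
    linarith [neg_le_abs (Real.log w)]

lemma Family.le_slack {fam : Family} (b₀ β1 u : ℝ) {q : ℝ × ℝ} (hq : q.2 ∈ fam.support) :
    fam.linWeight q.2 * |q.1| + fam.expWeight (b₀ + β1 * q.1 + u) q.2 * Real.exp (|q.1| + 1) ≤
      fam.slack b₀ β1 u q := by
  have hw := Family.expWeight_pos hq (b₀ + β1 * q.1 + u)
  simp only [Family.slack]
  refine le_add_of_nonneg_left ?_
  cases fam with
  | poisson => positivity
  | gamma α => positivity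

/-- `rowError` is a sum of nonnegative terms, one for each requirement; dropping the others gives
each bound. -/
theorem Family.rowData {fam : Family} (b₀ β1 : ℝ) (ν : Measure ℝ) (a₁ b₁ a₂ b₂ : ℝ) {N : ℕ}
    (hN : 0 < N) (u : ℝ) (z : Fin N → ℝ × ℝ) (hz : ∀ j, (z j).2 ∈ fam.support) :
    RowData a₁ b₁ a₂ b₂ (fam.limit b₀ β1 ν ((Set.Icc a₁ b₁).indicator 1))
      (fam.limit b₀ β1 ν ((Set.Icc a₂ b₂).indicator 1))
      (fam.limit b₀ β1 ν fun x => 1 + x ^ 2 * Real.exp |x|)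
      (fun j => fam.linWeight (z j).2) (fun j => fam.expWeight (b₀ + β1 * (z j).1 + u) (z j).2)
      (fun j => (z j).1) (fun j => fam.slack b₀ β1 u (z j)) (fam.scale u) u
      (fam.rowError b₀ β1 ν a₁ b₁ a₂ b₂ u z) := by
  have hN0 : (0 : ℝ) < N := by exact_mod_cast hN
  have p1 : ∀ f : ℝ × ℝ → ℝ, 0 ≤ (∑ j, f (z j)) ^ 8 / (N : ℝ) ^ 4 := fun f => by positivity
  have p2 := Real.exp_pos (16 * |u|)
  have p3 : 0 ≤ (∑ j, fam.slack b₀ β1 u (z j) ^ 2) / N := by positivity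
  have k1 := p1 (fam.score b₀ β1 (fun _ => 1) u)
  have k2 := p1 (fam.score b₀ β1 (fun x => x) u)
  have k3 := p1 (fam.excess b₀ β1 ν ((Set.Icc a₁ b₁).indicator 1) u)
  have k4 := p1 (fam.excess b₀ β1 ν ((Set.Icc a₂ b₂).indicator 1) u)
  have k5 := p1 (fam.excess b₀ β1 ν (fun x => 1 + x ^ 2 * Real.exp |x|) u)
  have key : ∀ S : ℝ, S / (N : ℝ) ^ 4 ≤ fam.rowError b₀ β1 ν a₁ b₁ a₂ b₂ u z →
      S ≤ N ^ 4 * fam.rowError b₀ β1 ν a₁ b₁ a₂ b₂ u z := fun S h => by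
    rwa [div_le_iff₀' (by positivity)] at h
  refine ⟨fun j => fam.linWeight_nonneg (Family.nonneg_of_mem_support (hz j)),
    fun j => (Family.expWeight_pos (hz j) _).le, fun j t => Family.gain_le_slack b₀ β1 u (hz j) t,
    fun j => Family.le_slack b₀ β1 u (hz j), fam.exp_le_scale u, fam.scale_le_exp u, ?_, ?_,
    key _ ?_, key _ ?_, key _ ?_, key _ ?_, key _ ?_⟩
  · unfold Family.rowError; linarith
  · have : (∑ j, fam.slack b₀ β1 u (z j) ^ 2) / N ≤ fam.rowError b₀ β1 ν a₁ b₁ a₂ b₂ u z := by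
      unfold Family.rowError; linarith
    rwa [div_le_iff₀' hN0] at this
  · have : (∑ j, (fam.linWeight (z j).2 - fam.expWeight (b₀ + β1 * (z j).1 + u) (z j).2)
        / fam.scale u) = ∑ j, fam.score b₀ β1 (fun _ => 1) u (z j) := by
      simp only [Family.score, mul_one]
    rw [this]
    unfold Family.rowError; linarith
  · change (∑ j, fam.score b₀ β1 (fun x => x) u (z j)) ^ 8 / (N : ℝ) ^ 4 ≤ _
    unfold Family.rowError; linarith
  · change (∑ j, fam.excess b₀ β1 ν ((Set.Icc a₁ b₁).indicator 1) u (z j)) ^ 8 / (N : ℝ) ^ 4 ≤ _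
    unfold Family.rowError; linarith
  · change (∑ j, fam.excess b₀ β1 ν ((Set.Icc a₂ b₂).indicator 1) u (z j)) ^ 8 / (N : ℝ) ^ 4 ≤ _
    unfold Family.rowError; linarith
  · change (∑ j, fam.excess b₀ β1 ν (fun x => 1 + x ^ 2 * Real.exp |x|) u (z j)) ^ 8
      / (N : ℝ) ^ 4 ≤ _
    unfold Family.rowError; linarith

lemma expGrowth_one : ExpGrowth fun _ => 1 := ⟨0, le_rfl, fun x => by simp⟩

lemma expGrowth_id : ExpGrowth fun x => x := ⟨1, zero_le_one, fun x => by
  linarith [Real.add_one_le_exp (1 * (1 + |x|))]⟩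

lemma expGrowth_indicator (s : Set ℝ) : ExpGrowth (s.indicator 1) := ⟨0, le_rfl, fun x => by
  by_cases h : x ∈ s <;> simp [h]⟩

lemma expGrowth_weight : ExpGrowth fun x => 1 + x ^ 2 * Real.exp |x| := by
  refine ⟨3, by norm_num, fun x => ?_⟩
  rw [abs_of_pos (by positivity)]
  have h0 := abs_nonneg x
  have h1 : x ^ 2 ≤ Real.exp |x| ^ 2 := by
    rw [← sq_abs]
    have := Real.add_one_le_exp |x|
    gcongr; linarith
  have h2 : Real.exp |x| ^ 2 * Real.exp |x| = Real.exp (3 * |x|) := by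
    rw [← pow_succ, ← Real.exp_nat_mul]; norm_num
  have h3 := mul_le_mul_of_nonneg_right h1 (Real.exp_pos |x|).le
  have h4 : 1 ≤ Real.exp (3 * |x|) := Real.one_le_exp (by positivity)
  have h5 : Real.exp (3 * (1 + |x|)) = Real.exp 3 * Real.exp (3 * |x|) := by
    rw [← Real.exp_add]; congr 1; ring
  have h6 := Real.add_one_le_exp (3 : ℝ)
  rw [h5]
  nlinarith

section Expectation

variable {fam : Family} {F : ℝ → unitInterval → ℝ} {ν τ : Measure ℝ} [IsProbabilityMeasure ν]
  [IsProbabilityMeasure τ]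

lemma measurable_rowError (fam : Family) (b₀ β1 : ℝ) (ν : Measure ℝ) (a₁ b₁ a₂ b₂ : ℝ) (N : ℕ) :
    Measurable fun q : ℝ × (Fin N → ℝ × ℝ) => fam.rowError b₀ β1 ν a₁ b₁ a₂ b₂ q.1 q.2 := by
  have hw : ∀ j : Fin N, Measurable fun q : ℝ × (Fin N → ℝ × ℝ) =>
      fam.expWeight (b₀ + β1 * (q.2 j).1 + q.1) (q.2 j).2 := by
    intro j
    cases fam <;> unfold Family.expWeight <;> fun_prop
  have hl : ∀ j : Fin N, Measurable fun q : ℝ × (Fin N → ℝ × ℝ) => fam.linWeight (q.2 j).2 := by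
    intro j
    have := fam.measurable_linWeight
    fun_prop
  have hs : Measurable fun q : ℝ × (Fin N → ℝ × ℝ) => fam.scale q.1 := by
    cases fam <;> unfold Family.scale <;> fun_prop
  have hx : ∀ j : Fin N, Measurable fun q : ℝ × (Fin N → ℝ × ℝ) => (q.2 j).1 := fun j => by fun_prop
  have hscore : ∀ φ : ℝ → ℝ, Measurable φ → Measurable fun q : ℝ × (Fin N → ℝ × ℝ) =>
      (∑ j, fam.score b₀ β1 φ q.1 (q.2 j)) ^ 8 / (N : ℝ) ^ 4 := fun φ hφ =>
    ((Finset.measurable_sum _ fun j _ =>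
      (((hl j).sub (hw j)).mul (hφ.comp (hx j))).div hs).pow_const 8).div_const _
  have hexc : ∀ φ : ℝ → ℝ, Measurable φ → Measurable fun q : ℝ × (Fin N → ℝ × ℝ) =>
      (∑ j, fam.excess b₀ β1 ν φ q.1 (q.2 j)) ^ 8 / (N : ℝ) ^ 4 := fun φ hφ =>
    ((Finset.measurable_sum _ fun j _ =>
      ((((hw j).mul (hφ.comp (hx j))).div hs).sub_const _)).pow_const 8).div_const _
  have hslack : ∀ j : Fin N, Measurable fun q : ℝ × (Fin N → ℝ × ℝ) =>
      fam.slack b₀ β1 q.1 (q.2 j) := by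
    intro j
    have h1 := hw j
    have h2 := hl j
    have h3 : Measurable fun q : ℝ × (Fin N → ℝ × ℝ) => (q.2 j).2 := by fun_prop
    have h4 := hx j
    unfold Family.slack
    refine Measurable.add ?_ ?_
    · cases fam
      · exact ((h3.sub h1).pow_const 2).div h1
      · exact (Real.measurable_log.comp h1).abs.add h1
    · exact (h2.mul h4.abs).add (h1.mul (Real.measurable_exp.comp (h4.abs.add_const 1)))
  have hind : ∀ a b : ℝ, Measurable ((Set.Icc a b).indicator (1 : ℝ → ℝ)) := fun a b =>
    measurable_one.indicator measurableSet_Icc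
  unfold Family.rowError
  refine ((((((hscore _ measurable_const).add (hscore _ measurable_id)).add (hexc _ (hind _ _))).add
    (hexc _ (hind _ _))).add (hexc _ (by fun_prop))).add (by fun_prop)).add
    ((Finset.measurable_sum _ fun j _ => (hslack j).pow_const 2).div_const _)

/-- Given `u` the cells are i.i.d. and the five sums are centered, so their normalized eighth
moments are bounded uniformly in `N`; the slack enters as an average and needs no centering. -/
theorem exists_lintegral_rowError_le (hfam : fam.Admissible) (hF : IsSampler fam F) (b b₀ β1 : ℝ)
    (hν : ExpMoments ν) (hτ : ExpMoments τ) (hb : ∫ v, Real.exp v ∂τ = Real.exp (b₀ - b))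
    (a₁ b₁ a₂ b₂ : ℝ) :
    ∃ A : ℝ, 0 ≤ A ∧ ∀ (N : ℕ) (u : ℝ), 0 < N →
      ∫⁻ z, ENNReal.ofReal (fam.rowError b₀ β1 ν a₁ b₁ a₂ b₂ u z)
        ∂(Measure.pi fun _ : Fin N => cellLaw F b β1 ν τ u) ≤
      ENNReal.ofReal (Real.exp (A * (1 + |u|))) := by
  have hind : ∀ a b : ℝ, Measurable ((Set.Icc a b).indicator (1 : ℝ → ℝ)) := fun a b =>
    measurable_one.indicator measurableSet_Icc
  have hid : Measurable fun x : ℝ => x := measurable_id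
  have hscore := fun (φ : ℝ → ℝ) (hφ : Measurable φ) (hg : ExpGrowth φ) =>
    exists_lintegral_pow_eight_le hfam hF b β1 hν hτ (fam.dominated_score b₀ β1 hg)
      (fam.measurable_score b₀ β1 hφ) (integral_score hfam hF b b₀ β1 hν hτ hb hφ hg)
  have hexc := fun (φ : ℝ → ℝ) (hφ : Measurable φ) (hg : ExpGrowth φ) =>
    exists_lintegral_pow_eight_le hfam hF b β1 hν hτ (fam.dominated_excess b₀ β1 ν hg)
      (fam.measurable_excess b₀ β1 ν hφ) (integral_excess hfam hF b b₀ β1 hν hτ hb hφ hg)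
  obtain ⟨A₁, hA₁, h1⟩ := hscore _ measurable_const expGrowth_one
  obtain ⟨A₂, hA₂, h2⟩ := hscore _ hid expGrowth_id
  obtain ⟨A₃, hA₃, h3⟩ := hexc _ (hind a₁ b₁) (expGrowth_indicator _)
  obtain ⟨A₄, hA₄, h4⟩ := hexc _ (hind a₂ b₂) (expGrowth_indicator _)
  obtain ⟨A₅, hA₅, h5⟩ := hexc _ (by fun_prop) expGrowth_weight
  obtain ⟨A₆, hA₆, h6⟩ := exists_lintegral_cellLaw_le hfam hF b β1 hν hτ
    (fam.dominated_slack_sq hfam b₀ β1) fun u => (fam.measurable_slack b₀ β1 u).pow_const 2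
  set B := A₁ + A₂ + A₃ + A₄ + A₅ + A₆ + 16 with hB
  refine ⟨B + 6, by positivity, fun N u hN => ?_⟩
  have hprob := hF.isProbabilityMeasure_cellLaw (ν := ν) (τ := τ) b β1 u
  have hN0 : (0 : ℝ) < N := by exact_mod_cast hN
  set Q := Measure.pi fun _ : Fin N => cellLaw F b β1 ν τ u with hQ
  have h7 : ∫⁻ z, ENNReal.ofReal ((∑ j, fam.slack b₀ β1 u (z j) ^ 2) / N) ∂Q ≤
      ENNReal.ofReal (Real.exp (A₆ * (1 + |u|))) := by
    have hm : Measurable fun q => ENNReal.ofReal (fam.slack b₀ β1 u q ^ 2) :=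
      ((fam.measurable_slack b₀ β1 u).pow_const 2).ennreal_ofReal
    have e : ∀ z : Fin N → ℝ × ℝ, ENNReal.ofReal ((∑ j, fam.slack b₀ β1 u (z j) ^ 2) / N) =
        ENNReal.ofReal (N : ℝ)⁻¹ * ∑ j, ENNReal.ofReal (fam.slack b₀ β1 u (z j) ^ 2) := fun z => by
      rw [← ENNReal.ofReal_sum_of_nonneg fun j _ => sq_nonneg _,
        ← ENNReal.ofReal_mul (by positivity), div_eq_inv_mul]
    simp_rw [e]
    have hmj : ∀ j : Fin N, Measurable fun z : Fin N → ℝ × ℝ =>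
        ENNReal.ofReal (fam.slack b₀ β1 u (z j) ^ 2) := fun j => hm.comp (measurable_pi_apply j)
    rw [lintegral_const_mul' _ _ ENNReal.ofReal_ne_top, lintegral_finsetSum _ fun j _ => hmj j]
    have e2 : ∀ j : Fin N, ∫⁻ z, ENNReal.ofReal (fam.slack b₀ β1 u (z j) ^ 2) ∂Q ≤
        ENNReal.ofReal (Real.exp (A₆ * (1 + |u|))) := fun j => by
      have hp : MeasurePreserving (fun z : Fin N → ℝ × ℝ => z j) Q (cellLaw F b β1 ν τ u) :=
        measurePreserving_eval _ j
      rw [hp.lintegral_comp hm]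
      refine le_trans (le_of_eq (lintegral_congr fun q => ?_)) (h6 u)
      rw [abs_of_nonneg (sq_nonneg _)]
    refine (mul_le_mul_right (Finset.sum_le_sum fun j _ => e2 j) _).trans ?_
    rw [Finset.sum_const, Finset.card_univ, Fintype.card_fin, nsmul_eq_mul,
      ← ENNReal.ofReal_natCast, ← ENNReal.ofReal_mul (by positivity),
      ← ENNReal.ofReal_mul (by positivity), ← mul_assoc, inv_mul_cancel₀ hN0.ne', one_mul]
  have hms : ∀ f : ℝ × ℝ → ℝ, Measurable f → Measurable fun z : Fin N → ℝ × ℝ =>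
      ENNReal.ofReal ((∑ j, f (z j)) ^ 8 / (N : ℝ) ^ 4) := fun f hf =>
    (((Finset.measurable_sum _ fun j _ => hf.comp (measurable_pi_apply j)).pow_const
      8).div_const _).ennreal_ofReal
  have hone : ∀ A : ℝ, A ≤ B → ENNReal.ofReal (Real.exp (A * (1 + |u|))) ≤
      ENNReal.ofReal (Real.exp (B * (1 + |u|))) := fun A hA => by
    refine ENNReal.ofReal_le_ofReal (Real.exp_le_exp.2 ?_)
    exact mul_le_mul_of_nonneg_right hA (by positivity)
  have hsplit : ∀ z : Fin N → ℝ × ℝ,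
      ENNReal.ofReal (fam.rowError b₀ β1 ν a₁ b₁ a₂ b₂ u z) ≤
      ENNReal.ofReal ((∑ j, fam.score b₀ β1 (fun _ => 1) u (z j)) ^ 8 / (N : ℝ) ^ 4)
      + (ENNReal.ofReal ((∑ j, fam.score b₀ β1 (fun x => x) u (z j)) ^ 8 / (N : ℝ) ^ 4)
      + (ENNReal.ofReal ((∑ j, fam.excess b₀ β1 ν ((Set.Icc a₁ b₁).indicator 1) u (z j)) ^ 8
        / (N : ℝ) ^ 4)
      + (ENNReal.ofReal ((∑ j, fam.excess b₀ β1 ν ((Set.Icc a₂ b₂).indicator 1) u (z j)) ^ 8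
        / (N : ℝ) ^ 4)
      + (ENNReal.ofReal ((∑ j, fam.excess b₀ β1 ν (fun x => 1 + x ^ 2 * Real.exp |x|) u (z j)) ^ 8
        / (N : ℝ) ^ 4)
      + (ENNReal.ofReal (Real.exp (16 * |u|))
      + ENNReal.ofReal ((∑ j, fam.slack b₀ β1 u (z j) ^ 2) / N)))))) := by
    intro z
    unfold Family.rowError
    simp only [add_assoc]
    refine ENNReal.ofReal_add_le.trans (add_le_add_right ?_ _)
    refine ENNReal.ofReal_add_le.trans (add_le_add_right ?_ _)
    refine ENNReal.ofReal_add_le.trans (add_le_add_right ?_ _)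
    refine ENNReal.ofReal_add_le.trans (add_le_add_right ?_ _)
    refine ENNReal.ofReal_add_le.trans (add_le_add_right ?_ _)
    exact ENNReal.ofReal_add_le
  refine (lintegral_mono hsplit).trans ?_
  rw [lintegral_add_left (hms _ (fam.measurable_score b₀ β1 measurable_const u)),
    lintegral_add_left (hms _ (fam.measurable_score b₀ β1 hid u)),
    lintegral_add_left (hms _ (fam.measurable_excess b₀ β1 ν (hind _ _) u)),
    lintegral_add_left (hms _ (fam.measurable_excess b₀ β1 ν (hind _ _) u)),
    lintegral_add_left (hms _ (fam.measurable_excess b₀ β1 ν (by fun_prop) u)),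
    lintegral_add_left measurable_const]
  simp only [lintegral_const, measure_univ, mul_one]
  have h8 : ENNReal.ofReal (Real.exp (16 * |u|)) ≤ ENNReal.ofReal (Real.exp (B * (1 + |u|))) := by
    refine ENNReal.ofReal_le_ofReal (Real.exp_le_exp.2 ?_)
    have : 16 * |u| ≤ B * |u| := mul_le_mul_of_nonneg_right (by rw [hB]; linarith) (abs_nonneg u)
    have : 0 ≤ B := by positivity
    linarith
  refine (add_le_add ((h1 N u hN).trans (hone A₁ (by rw [hB]; linarith)))
    (add_le_add ((h2 N u hN).trans (hone A₂ (by rw [hB]; linarith)))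
    (add_le_add ((h3 N u hN).trans (hone A₃ (by rw [hB]; linarith)))
    (add_le_add ((h4 N u hN).trans (hone A₄ (by rw [hB]; linarith)))
    (add_le_add ((h5 N u hN).trans (hone A₅ (by rw [hB]; linarith)))
    (add_le_add h8 (h7.trans (hone A₆ (by rw [hB]; linarith))))))))).trans ?_
  have hE := (Real.exp_pos (B * (1 + |u|))).le
  rw [← ENNReal.ofReal_add hE hE, ← ENNReal.ofReal_add hE (by positivity),
    ← ENNReal.ofReal_add hE (by positivity), ← ENNReal.ofReal_add hE (by positivity),
    ← ENNReal.ofReal_add hE (by positivity), ← ENNReal.ofReal_add hE (by positivity)]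
  refine ENNReal.ofReal_le_ofReal ?_
  have h9 : (7 : ℝ) ≤ Real.exp (6 * (1 + |u|)) := by
    have := Real.add_one_le_exp (6 * (1 + |u|))
    linarith [abs_nonneg u]
  rw [add_mul B 6, Real.exp_add]
  have := mul_le_mul_of_nonneg_left h9 hE
  linarith

end Expectation


/-! ### The joint law of one row or one column -/

section Preserving

variable {α β γ δ : Type*} [MeasurableSpace α] [MeasurableSpace β] [MeasurableSpace γ]
  [MeasurableSpace δ]

lemma measurePreserving_prod_left_comm (a : Measure α) (b : Measure β) (c : Measure γ)
    [SFinite a] [SFinite b] [SFinite c] :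
    MeasurePreserving (fun p : α × β × γ => (p.2.1, p.1, p.2.2)) (a.prod (b.prod c))
      (b.prod (a.prod c)) :=
  ((measurePreserving_prodAssoc b a c).comp
    ((Measure.measurePreserving_swap (μ := a) (ν := b)).prod (MeasurePreserving.id c))).comp
    (measurePreserving_prodAssoc a b c).symm

lemma measurePreserving_pi_zip {N : ℕ} (a : Measure α) (b : Measure β) (c : Measure γ)
    [SigmaFinite a] [SigmaFinite b] [SigmaFinite c] :
    MeasurePreserving
      (fun (p : (Fin N → α) × (Fin N → β) × (Fin N → γ)) (j : Fin N) => (p.1 j, p.2.1 j, p.2.2 j))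
      ((Measure.pi fun _ : Fin N => a).prod ((Measure.pi fun _ : Fin N => b).prod
        (Measure.pi fun _ : Fin N => c)))
      (Measure.pi fun _ : Fin N => a.prod (b.prod c)) :=
  (measurePreserving_arrowProdEquivProdArrow α (β × γ) (Fin N) (fun _ => a)
    fun _ => b.prod c).symm.comp ((MeasurePreserving.id _).prod
      (measurePreserving_arrowProdEquivProdArrow β γ (Fin N) (fun _ => b) fun _ => c).symm)

lemma measurePreserving_pi_row {m n : ℕ} (a : Measure α) [IsProbabilityMeasure a] (i : Fin m) :
    MeasurePreserving (fun X : Fin m → Fin n → α => X i)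
      (Measure.pi fun _ : Fin m => Measure.pi fun _ : Fin n => a) (Measure.pi fun _ : Fin n => a) :=
  measurePreserving_eval _ i

lemma measurePreserving_pi_column {m n : ℕ} (a : Measure α) [IsProbabilityMeasure a] (j : Fin n) :
    MeasurePreserving (fun (X : Fin m → Fin n → α) i => X i j)
      (Measure.pi fun _ : Fin m => Measure.pi fun _ : Fin n => a) (Measure.pi fun _ : Fin m => a) :=
  measurePreserving_pi _ _ fun _ => measurePreserving_eval _ j

/-- The model prescribes the conditional law of the responses on rectangles only. These form a
π-system which generates the doubly indexed product σ-algebra. -/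
lemma ext_of_pi_pi {m n : ℕ} {μ ν : Measure (Fin m → Fin n → α)} [IsFiniteMeasure μ]
    (h : ∀ B : Fin m → Fin n → Set α, (∀ i j, MeasurableSet (B i j)) →
      μ (Set.univ.pi fun i => Set.univ.pi (B i)) = ν (Set.univ.pi fun i => Set.univ.pi (B i))) :
    μ = ν := by
  refine ext_of_generate_finite (Set.univ.pi '' Set.univ.pi fun _ : Fin m =>
    (Set.univ.pi '' Set.univ.pi fun _ : Fin n => {s : Set α | MeasurableSet s})) ?_ ?_ ?_ ?_
  · exact (generateFrom_eq_pi (fun _ => generateFrom_pi) fun _ =>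
      IsCountablySpanning.pi fun _ => isCountablySpanning_measurableSet).symm
  · exact IsPiSystem.pi fun _ => isPiSystem_pi
  · rintro _ ⟨S, hS, rfl⟩
    choose B hB hBS using fun i => hS i (Set.mem_univ i)
    have : S = fun i => Set.univ.pi (B i) := funext fun i => (hBS i).symm
    rw [this]
    exact h B fun i j => hB i j (Set.mem_univ j)
  · have := h (fun _ _ => Set.univ) fun _ _ => MeasurableSet.univ
    simpa using this

end Preserving

section Laws

variable {fam : Family} {β0 β1 σu2 σv2 : ℝ} {ν : Measure ℝ} {m n : ℕ}
  {Ω : Type*} [MeasurableSpace Ω] {P : Measure Ω}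
  {X : Fin m → Fin n → Ω → ℝ} {U : Fin m → Ω → ℝ} {V : Fin n → Ω → ℝ} {Y : Fin m → Fin n → Ω → ℝ}
  {F : ℝ → unitInterval → ℝ}

/-- The law of covariates and random effects. -/
noncomputable def latentLaw (σu2 σv2 : ℝ) (ν : Measure ℝ) (m n : ℕ) :
    Measure ((Fin m → Fin n → ℝ) × (Fin m → ℝ) × (Fin n → ℝ)) :=
  (Measure.pi fun _ : Fin m => Measure.pi fun _ : Fin n => ν).prod
    ((Measure.pi fun _ : Fin m => gaussianReal 0 σu2.toNNReal).prod
      (Measure.pi fun _ : Fin n => gaussianReal 0 σv2.toNNReal))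

instance [IsProbabilityMeasure ν] : IsProbabilityMeasure (latentLaw σu2 σv2 ν m n) := by
  unfold latentLaw; infer_instance

/-- The responses drawn by a sampler. -/
def sampledResponses (F : ℝ → unitInterval → ℝ) (β0 β1 : ℝ) {m n : ℕ}
    (p : ((Fin m → Fin n → ℝ) × (Fin m → ℝ) × (Fin n → ℝ)) × (Fin m → Fin n → unitInterval)) :
    Fin m → Fin n → ℝ :=
  fun i j => F (β0 + β1 * p.1.1 i j + p.1.2.1 i + p.1.2.2 j) (p.2 i j)

lemma IsSampler.measurable_sampledResponses (hF : IsSampler fam F) (β0 β1 : ℝ) :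
    Measurable (sampledResponses F β0 β1 (m := m) (n := n)) := by
  refine measurable_pi_lambda _ fun i => measurable_pi_lambda _ fun j => ?_
  exact hF.measurable.comp (g := Function.uncurry F)
    (f := fun p : ((Fin m → Fin n → ℝ) × (Fin m → ℝ) × (Fin n → ℝ)) ×
      (Fin m → Fin n → unitInterval) =>
      (β0 + β1 * p.1.1 i j + p.1.2.1 i + p.1.2.2 j, p.2 i j)) (by fun_prop)

lemma IsCrossedSample.measurable_latent (h : IsCrossedSample fam β0 β1 σu2 σv2 ν P X U V Y) :
    Measurable fun ω => ((fun i j => X i j ω, fun i => U i ω, fun j => V j ω) :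
        (Fin m → Fin n → ℝ) × (Fin m → ℝ) × (Fin n → ℝ)) := by
  have h1 := h.measurable_X
  have h2 := h.measurable_U
  have h3 := h.measurable_V
  fun_prop

lemma IsCrossedSample.measurable_responses (h : IsCrossedSample fam β0 β1 σu2 σv2 ν P X U V Y) :
    Measurable fun ω => (fun i j => Y i j ω : Fin m → Fin n → ℝ) := by
  have h1 := h.measurable_Y
  fun_prop

variable [IsProbabilityMeasure ν] [IsProbabilityMeasure P]

/-- The joint law of all the data is that of sampled responses. -/
theorem IsCrossedSample.map_eq (h : IsCrossedSample fam β0 β1 σu2 σv2 ν P X U V Y)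
    (hF : IsSampler fam F) :
    P.map (fun ω => (((fun i j => X i j ω, fun i => U i ω, fun j => V j ω) :
        (Fin m → Fin n → ℝ) × (Fin m → ℝ) × (Fin n → ℝ)), (fun i j => Y i j ω : Fin m → Fin n → ℝ))) =
      ((latentLaw σu2 σv2 ν m n).prod
        (Measure.pi fun _ : Fin m => Measure.pi fun _ : Fin n => (volume : Measure unitInterval))).map
        fun p => (p.1, sampledResponses F β0 β1 p) := by
  set Z : Ω → (Fin m → Fin n → ℝ) × (Fin m → ℝ) × (Fin n → ℝ) :=
    fun ω => (fun i j => X i j ω, fun i => U i ω, fun j => V j ω) with hZ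
  have hZm : Measurable Z := h.measurable_latent
  have hYm := h.measurable_responses
  have hSm := hF.measurable_sampledResponses (m := m) (n := n) β0 β1
  have hlat : P.map Z = latentLaw σu2 σv2 ν m n := h.latent_law
  set Λ := (latentLaw σu2 σv2 ν m n).prod
    (Measure.pi fun _ : Fin m => Measure.pi fun _ : Fin n => (volume : Measure unitInterval)) with hΛ
  have hZY : Measurable fun ω => (Z ω, (fun i j => Y i j ω : Fin m → Fin n → ℝ)) := hZm.prodMk hYm
  have hpS : Measurable fun p => (p.1, sampledResponses F β0 β1 (m := m) (n := n) p) :=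
    measurable_fst.prodMk hSm
  have := Measure.isProbabilityMeasure_map (μ := P) hZY.aemeasurable
  have := Measure.isProbabilityMeasure_map (μ := Λ) hpS.aemeasurable
  have hresp : ∀ B : Fin m → Fin n → Set ℝ, (∀ i j, MeasurableSet (B i j)) → Measurable
      fun l : (Fin m → Fin n → ℝ) × (Fin m → ℝ) × (Fin n → ℝ) =>
        ∏ i, ∏ j, fam.responseLaw (β0 + β1 * l.1 i j + l.2.1 i + l.2.2 j) (B i j) := by
    intro B hB
    refine Finset.measurable_prod _ fun i _ => Finset.measurable_prod _ fun j _ => ?_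
    have h1 := (Measure.measurable_coe (hB i j)).comp fam.measurable_responseLaw
    exact h1.comp (g := fun η => fam.responseLaw η (B i j)) (by fun_prop)
  -- For a set `A` of latent values and a rectangle of responses, both sides are the integral over
  -- `A` of the product of response laws: on the left by hypothesis, on the right by Fubini and the
  -- sampler.
  have key : ∀ A, MeasurableSet A → ∀ B : Fin m → Fin n → Set ℝ, (∀ i j, MeasurableSet (B i j)) →
      P {ω | Z ω ∈ A ∧ ∀ i j, Y i j ω ∈ B i j} =
        Λ {p | p.1 ∈ A ∧ ∀ i j, sampledResponses F β0 β1 p i j ∈ B i j} := by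
    intro A hA B hB
    have hmeas : MeasurableSet {p : ((Fin m → Fin n → ℝ) × (Fin m → ℝ) × (Fin n → ℝ)) ×
        (Fin m → Fin n → unitInterval) |
        p.1 ∈ A ∧ ∀ i j, sampledResponses F β0 β1 p i j ∈ B i j} := by
      have e : {p : ((Fin m → Fin n → ℝ) × (Fin m → ℝ) × (Fin n → ℝ)) ×
          (Fin m → Fin n → unitInterval) | ∀ i j, sampledResponses F β0 β1 p i j ∈ B i j} =
          ⋂ i, ⋂ j, (fun p => sampledResponses F β0 β1 p i j) ⁻¹' B i j := by
        ext p; simp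
      have hall : MeasurableSet {p : ((Fin m → Fin n → ℝ) × (Fin m → ℝ) × (Fin n → ℝ)) ×
          (Fin m → Fin n → unitInterval) | ∀ i j, sampledResponses F β0 β1 p i j ∈ B i j} := by
        rw [e]
        exact MeasurableSet.iInter fun i => MeasurableSet.iInter fun j =>
          ((measurable_pi_apply j).comp ((measurable_pi_apply i).comp hSm)) (hB i j)
      exact (measurable_fst hA).inter hall
    have e1 := h.response_law A hA B hB
    refine e1.trans ?_
    change ∫⁻ ω in Z ⁻¹' A, (fun l : (Fin m → Fin n → ℝ) × (Fin m → ℝ) × (Fin n → ℝ) =>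
      ∏ i, ∏ j, fam.responseLaw (β0 + β1 * l.1 i j + l.2.1 i + l.2.2 j) (B i j)) (Z ω) ∂P = _
    rw [← setLIntegral_map hA (hresp B hB) hZm, hlat, hΛ, Measure.prod_apply hmeas,
      ← lintegral_indicator hA]
    refine lintegral_congr fun l => ?_
    by_cases hl : l ∈ A
    · rw [Set.indicator_of_mem hl]
      have e2 : (Prod.mk l ⁻¹' {p : ((Fin m → Fin n → ℝ) × (Fin m → ℝ) × (Fin n → ℝ)) ×
          (Fin m → Fin n → unitInterval) |
          p.1 ∈ A ∧ ∀ i j, sampledResponses F β0 β1 p i j ∈ B i j}) =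
          Set.univ.pi fun i => Set.univ.pi fun j =>
            F (β0 + β1 * l.1 i j + l.2.1 i + l.2.2 j) ⁻¹' B i j := by
        ext ξ
        simp [hl, sampledResponses]
      rw [e2, Measure.pi_pi]
      refine Finset.prod_congr rfl fun i _ => ?_
      rw [Measure.pi_pi]
      refine Finset.prod_congr rfl fun j _ => ?_
      rw [← hF.map_eq, Measure.map_apply hF.measurable.of_uncurry_left (hB i j)]
    · rw [Set.indicator_of_notMem hl]
      have e2 : (Prod.mk l ⁻¹' {p : ((Fin m → Fin n → ℝ) × (Fin m → ℝ) × (Fin n → ℝ)) ×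
          (Fin m → Fin n → unitInterval) |
          p.1 ∈ A ∧ ∀ i j, sampledResponses F β0 β1 p i j ∈ B i j}) = ∅ := by
        ext ξ
        simp [hl]
      rw [e2, measure_empty]
  -- Two extensions are made: for a fixed latent set from response rectangles to all response sets,
  -- then from products of sets to the joint law.
  refine Measure.ext_prod fun {A B'} hA hB' => ?_
  have hρ : (P.restrict (Z ⁻¹' A)).map (fun ω => (fun i j => Y i j ω : Fin m → Fin n → ℝ)) =
      (Λ.restrict (Prod.fst ⁻¹' A)).map (sampledResponses F β0 β1) := by
    refine ext_of_pi_pi fun B hB => ?_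
    have hR : MeasurableSet (Set.univ.pi fun i => Set.univ.pi (B i)) :=
      MeasurableSet.univ_pi fun i => MeasurableSet.univ_pi (hB i)
    rw [Measure.map_apply hYm hR, Measure.map_apply hSm hR, Measure.restrict_apply (hYm hR),
      Measure.restrict_apply (hSm hR)]
    convert key A hA B hB using 2
    · ext ω; simp [and_comm]
    · ext p; simp [and_comm]
  have e3 := DFunLike.congr_fun hρ B'
  rw [Measure.map_apply hYm hB', Measure.map_apply hSm hB', Measure.restrict_apply (hYm hB'),
      Measure.restrict_apply (hSm hB')] at e3
  rw [Measure.map_apply hZY (hA.prod hB'), Measure.map_apply hpS (hA.prod hB')]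
  convert e3 using 2
  · ext ω; simp [and_comm]
  · ext p; simp [and_comm]

end Laws


/-- The cells of a row with effect `u`, drawn by a sampler. -/
def rowSample (F : ℝ → unitInterval → ℝ) (b β1 : ℝ) {N : ℕ}
    (p : ℝ × (Fin N → ℝ × ℝ × unitInterval)) : ℝ × (Fin N → ℝ × ℝ) :=
  (p.1, fun j => ((p.2 j).1, F (b + β1 * (p.2 j).1 + p.1 + (p.2 j).2.1) (p.2 j).2.2))

/-- The joint law of a row effect and the cells of the row. -/
noncomputable def rowLaw (F : ℝ → unitInterval → ℝ) (b β1 : ℝ) (ν γ τ : Measure ℝ) (N : ℕ) :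
    Measure (ℝ × (Fin N → ℝ × ℝ)) :=
  (γ.prod (Measure.pi fun _ : Fin N => ν.prod (τ.prod volume))).map (rowSample F b β1)

section Laws

variable {fam : Family} {β0 β1 σu2 σv2 : ℝ} {ν : Measure ℝ} {m n : ℕ}
  {Ω : Type*} [MeasurableSpace Ω] {P : Measure Ω}
  {X : Fin m → Fin n → Ω → ℝ} {U : Fin m → Ω → ℝ} {V : Fin n → Ω → ℝ} {Y : Fin m → Fin n → Ω → ℝ}
  {F : ℝ → unitInterval → ℝ}

lemma IsSampler.measurable_rowSample (hF : IsSampler fam F) (b β1 : ℝ) (N : ℕ) :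
    Measurable (rowSample F b β1 (N := N)) := by
  refine measurable_fst.prodMk (measurable_pi_lambda _ fun j => Measurable.prodMk (by fun_prop) ?_)
  exact hF.measurable.comp (g := Function.uncurry F)
    (f := fun p : ℝ × (Fin N → ℝ × ℝ × unitInterval) =>
      (b + β1 * (p.2 j).1 + p.1 + (p.2 j).2.1, (p.2 j).2.2)) (by fun_prop)

/-- The law of all responses is carried by the support. -/
lemma IsCrossedSample.ae_mem_support [IsProbabilityMeasure P] (hfam : fam.Admissible)
    (h : IsCrossedSample fam β0 β1 σu2 σv2 ν P X U V Y) :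
    ∀ᵐ ω ∂P, ∀ i j, Y i j ω ∈ fam.support := by
  have h1 := h.response_law Set.univ MeasurableSet.univ (fun _ _ => fam.support)
    fun _ _ => fam.measurableSet_support
  simp only [Set.mem_univ, true_and, fam.responseLaw_support hfam, Finset.prod_const_one,
    Set.ofPred_true, lintegral_const, Measure.restrict_apply, MeasurableSet.univ, Set.univ_inter,
    measure_univ, mul_one] at h1
  have hm : MeasurableSet {ω | ∀ i j, Y i j ω ∈ fam.support} := by
    have : {ω | ∀ i j, Y i j ω ∈ fam.support} = ⋂ i, ⋂ j, Y i j ⁻¹' fam.support := by ext ω; simp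
    rw [this]
    exact MeasurableSet.iInter fun i => MeasurableSet.iInter fun j =>
      h.measurable_Y i j fam.measurableSet_support
  exact (mem_ae_iff_prob_eq_one hm).2 h1

variable [IsProbabilityMeasure ν]

/-- Seen from a single row, each cell has its own column effect. Grouping covariate, column effect
and uniform variable by cell exhibits the cells as i.i.d. given the row effect, though the same
column effects recur in all other rows. -/
lemma measurePreserving_select_row (i : Fin m) :
    MeasurePreserving (fun (p : ((Fin m → Fin n → ℝ) × (Fin m → ℝ) × (Fin n → ℝ)) ×
      (Fin m → Fin n → unitInterval)) =>
        (p.1.2.1 i, fun j => (p.1.1 i j, p.1.2.2 j, p.2 i j)))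
      ((latentLaw σu2 σv2 ν m n).prod
        (Measure.pi fun _ : Fin m => Measure.pi fun _ : Fin n => (volume : Measure unitInterval)))
      ((gaussianReal 0 σu2.toNNReal).prod (Measure.pi fun _ : Fin n =>
        ν.prod ((gaussianReal 0 σv2.toNNReal).prod volume))) := by
  have h1 := ((measurePreserving_pi_row (n := n) ν i).prod
    ((measurePreserving_eval (fun _ : Fin m => gaussianReal 0 σu2.toNNReal) i).prod
      (MeasurePreserving.id (Measure.pi fun _ : Fin n => gaussianReal 0 σv2.toNNReal)))).prod
    (measurePreserving_pi_row (n := n) (volume : Measure unitInterval) i)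
  have h2 := (measurePreserving_prodAssoc (Measure.pi fun _ : Fin n => ν)
    ((gaussianReal 0 σu2.toNNReal).prod (Measure.pi fun _ : Fin n => gaussianReal 0 σv2.toNNReal))
    (Measure.pi fun _ : Fin n => (volume : Measure unitInterval))).comp h1
  have h3 := ((MeasurePreserving.id (Measure.pi fun _ : Fin n => ν)).prod
    (measurePreserving_prodAssoc (gaussianReal 0 σu2.toNNReal)
      (Measure.pi fun _ : Fin n => gaussianReal 0 σv2.toNNReal)
      (Measure.pi fun _ : Fin n => (volume : Measure unitInterval)))).comp h2
  have h4 := (measurePreserving_prod_left_comm (Measure.pi fun _ : Fin n => ν)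
    (gaussianReal 0 σu2.toNNReal) ((Measure.pi fun _ : Fin n => gaussianReal 0 σv2.toNNReal).prod
      (Measure.pi fun _ : Fin n => (volume : Measure unitInterval)))).comp h3
  exact ((MeasurePreserving.id (gaussianReal 0 σu2.toNNReal)).prod (measurePreserving_pi_zip ν
    (gaussianReal 0 σv2.toNNReal) (volume : Measure unitInterval))).comp h4

lemma measurePreserving_select_column (j : Fin n) :
    MeasurePreserving (fun (p : ((Fin m → Fin n → ℝ) × (Fin m → ℝ) × (Fin n → ℝ)) ×
      (Fin m → Fin n → unitInterval)) =>
        (p.1.2.2 j, fun i => (p.1.1 i j, p.1.2.1 i, p.2 i j)))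
      ((latentLaw σu2 σv2 ν m n).prod
        (Measure.pi fun _ : Fin m => Measure.pi fun _ : Fin n => (volume : Measure unitInterval)))
      ((gaussianReal 0 σv2.toNNReal).prod (Measure.pi fun _ : Fin m =>
        ν.prod ((gaussianReal 0 σu2.toNNReal).prod volume))) := by
  have h0 := (Measure.measurePreserving_swap (μ := gaussianReal 0 σv2.toNNReal)
    (ν := Measure.pi fun _ : Fin m => gaussianReal 0 σu2.toNNReal))
  have h1 := ((measurePreserving_pi_column (m := m) ν j).prod
    ((Measure.measurePreserving_swap (μ := Measure.pi fun _ : Fin m => gaussianReal 0 σu2.toNNReal)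
      (ν := gaussianReal 0 σv2.toNNReal)).comp
      ((MeasurePreserving.id (Measure.pi fun _ : Fin m => gaussianReal 0 σu2.toNNReal)).prod
        (measurePreserving_eval (fun _ : Fin n => gaussianReal 0 σv2.toNNReal) j)))).prod
    (measurePreserving_pi_column (m := m) (volume : Measure unitInterval) j)
  have h2 := (measurePreserving_prodAssoc (Measure.pi fun _ : Fin m => ν)
    ((gaussianReal 0 σv2.toNNReal).prod (Measure.pi fun _ : Fin m => gaussianReal 0 σu2.toNNReal))
    (Measure.pi fun _ : Fin m => (volume : Measure unitInterval))).comp h1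
  have h3 := ((MeasurePreserving.id (Measure.pi fun _ : Fin m => ν)).prod
    (measurePreserving_prodAssoc (gaussianReal 0 σv2.toNNReal)
      (Measure.pi fun _ : Fin m => gaussianReal 0 σu2.toNNReal)
      (Measure.pi fun _ : Fin m => (volume : Measure unitInterval)))).comp h2
  have h4 := (measurePreserving_prod_left_comm (Measure.pi fun _ : Fin m => ν)
    (gaussianReal 0 σv2.toNNReal) ((Measure.pi fun _ : Fin m => gaussianReal 0 σu2.toNNReal).prod
      (Measure.pi fun _ : Fin m => (volume : Measure unitInterval)))).comp h3
  exact ((MeasurePreserving.id (gaussianReal 0 σv2.toNNReal)).prod (measurePreserving_pi_zip ν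
    (gaussianReal 0 σu2.toNNReal) (volume : Measure unitInterval))).comp h4

variable [IsProbabilityMeasure P]

theorem IsCrossedSample.map_row (h : IsCrossedSample fam β0 β1 σu2 σv2 ν P X U V Y)
    (hF : IsSampler fam F) (i : Fin m) :
    P.map (fun ω => (U i ω, fun j => (X i j ω, Y i j ω))) =
      rowLaw F β0 β1 ν (gaussianReal 0 σu2.toNNReal) (gaussianReal 0 σv2.toNNReal) n := by
  have hm := h.map_eq hF
  have hZY := h.measurable_latent.prodMk h.measurable_responses
  have hpS := measurable_fst.prodMk (hF.measurable_sampledResponses (m := m) (n := n) β0 β1)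
  set H : ((Fin m → Fin n → ℝ) × (Fin m → ℝ) × (Fin n → ℝ)) × (Fin m → Fin n → ℝ) →
    ℝ × (Fin n → ℝ × ℝ) := fun q => (q.1.2.1 i, fun j => (q.1.1 i j, q.2 i j)) with hH
  have hHm : Measurable H := by rw [hH]; fun_prop
  have e := congrArg (Measure.map H) hm
  rw [Measure.map_map hHm hZY, Measure.map_map hHm hpS] at e
  refine e.trans ?_
  unfold rowLaw
  have hsel := measurePreserving_select_row (σu2 := σu2) (σv2 := σv2) (ν := ν) (n := n) i
  rw [← hsel.map_eq, Measure.map_map (hF.measurable_rowSample β0 β1 n) hsel.measurable]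
  rfl

theorem IsCrossedSample.map_column (h : IsCrossedSample fam β0 β1 σu2 σv2 ν P X U V Y)
    (hF : IsSampler fam F) (j : Fin n) :
    P.map (fun ω => (V j ω, fun i => (X i j ω, Y i j ω))) =
      rowLaw F β0 β1 ν (gaussianReal 0 σv2.toNNReal) (gaussianReal 0 σu2.toNNReal) m := by
  have hm := h.map_eq hF
  have hZY := h.measurable_latent.prodMk h.measurable_responses
  have hpS := measurable_fst.prodMk (hF.measurable_sampledResponses (m := m) (n := n) β0 β1)
  set H : ((Fin m → Fin n → ℝ) × (Fin m → ℝ) × (Fin n → ℝ)) × (Fin m → Fin n → ℝ) →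
    ℝ × (Fin m → ℝ × ℝ) := fun q => (q.1.2.2 j, fun i => (q.1.1 i j, q.2 i j)) with hH
  have hHm : Measurable H := by rw [hH]; fun_prop
  have e := congrArg (Measure.map H) hm
  rw [Measure.map_map hHm hZY, Measure.map_map hHm hpS] at e
  refine e.trans ?_
  unfold rowLaw
  have hsel := measurePreserving_select_column (σu2 := σu2) (σv2 := σv2) (ν := ν) (m := m) j
  rw [← hsel.map_eq, Measure.map_map (hF.measurable_rowSample β0 β1 m) hsel.measurable]
  congr 1
  funext p
  simp only [Function.comp, hH, rowSample, sampledResponses, Prod.mk.injEq, true_and]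
  funext i
  -- Seen from a column the two effects enter the predictor in the opposite order.
  rw [add_right_comm (β0 + β1 * p.1.1 i j)]

end Laws

/-- The conditional bound is exponential in the absolute value of the row effect, so the exponential
moments of that effect make the expected remainder bounded uniformly in `N`. -/
theorem exists_lintegral_rowLaw_le {fam : Family} {F : ℝ → unitInterval → ℝ} {ν γ τ : Measure ℝ}
    [IsProbabilityMeasure ν] [IsProbabilityMeasure γ] [IsProbabilityMeasure τ]
    (hfam : fam.Admissible) (hF : IsSampler fam F) (b b₀ β1 : ℝ)
    (hν : ExpMoments ν) (hγ : ExpMoments γ) (hτ : ExpMoments τ)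
    (hb : ∫ v, Real.exp v ∂τ = Real.exp (b₀ - b)) (a₁ b₁ a₂ b₂ : ℝ) :
    ∃ C : ℝ, 0 ≤ C ∧ ∀ N : ℕ, 0 < N →
      ∫⁻ q, ENNReal.ofReal (fam.rowError b₀ β1 ν a₁ b₁ a₂ b₂ q.1 q.2) ∂(rowLaw F b β1 ν γ τ N) ≤
        ENNReal.ofReal C := by
  obtain ⟨A, hA, h1⟩ := exists_lintegral_rowError_le hfam hF b b₀ β1 hν hτ hb a₁ b₁ a₂ b₂
  obtain ⟨B, hB, h2⟩ := hγ.exists_le A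
  refine ⟨Real.exp A * Real.exp B, by positivity, fun N hN => ?_⟩
  have hm := (measurable_rowError fam b₀ β1 ν a₁ b₁ a₂ b₂ N).ennreal_ofReal
  have hs := hF.measurable_rowSample b β1 N
  have hms : Measurable fun p => ENNReal.ofReal (fam.rowError b₀ β1 ν a₁ b₁ a₂ b₂
      (rowSample F b β1 (N := N) p).1 (rowSample F b β1 p).2) := hm.comp hs
  unfold rowLaw
  rw [lintegral_map hm hs, lintegral_prod _ hms.aemeasurable]
  have key : ∀ u : ℝ, ∫⁻ z, ENNReal.ofReal (fam.rowError b₀ β1 ν a₁ b₁ a₂ b₂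
      (rowSample F b β1 (u, z)).1 (rowSample F b β1 (u, z)).2)
      ∂(Measure.pi fun _ : Fin N => ν.prod (τ.prod volume)) ≤
      ENNReal.ofReal (Real.exp A) * ENNReal.ofReal (Real.exp (A * |u|)) := by
    intro u
    simp only [rowSample]
    have hprob := hF.isProbabilityMeasure_cellLaw (ν := ν) (τ := τ) b β1 u
    have hc := hF.measurable_cell b β1 u
    have e : (Measure.pi fun _ : Fin N => cellLaw F b β1 ν τ u) =
        (Measure.pi fun _ : Fin N => ν.prod (τ.prod volume)).map fun z j =>
          ((z j).1, F (b + β1 * (z j).1 + u + (z j).2.1) (z j).2.2) := by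
      unfold cellLaw at hprob ⊢
      rw [Measure.pi_map_pi (f := fun _ : Fin N => fun q : ℝ × ℝ × unitInterval =>
        (q.1, F (b + β1 * q.1 + u + q.2.1) q.2.2)) fun _ => hc.aemeasurable]
    have h3 := h1 N u hN
    have hmu : Measurable fun z : Fin N → ℝ × ℝ =>
        ENNReal.ofReal (fam.rowError b₀ β1 ν a₁ b₁ a₂ b₂ u z) := by
      have := hm.comp (measurable_prodMk_left (x := u))
      simpa only [Function.comp_def] using this
    have hcu : Measurable fun (z : Fin N → ℝ × ℝ × unitInterval) (j : Fin N) =>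
        ((z j).1, F (b + β1 * (z j).1 + u + (z j).2.1) (z j).2.2) :=
      measurable_pi_lambda _ fun j => hc.comp (measurable_pi_apply j)
    rw [e, lintegral_map hmu hcu] at h3
    refine h3.trans (le_of_eq ?_)
    rw [← ENNReal.ofReal_mul (Real.exp_pos _).le, ← Real.exp_add]
    congr 2; ring
  refine (lintegral_mono key).trans ?_
  rw [lintegral_const_mul _ (by fun_prop), ENNReal.ofReal_mul (Real.exp_pos _).le]
  exact mul_le_mul_right h2 _


/-! ### Nondegenerate covariates and tail bounds -/

section Nondegenerate

variable {ν : Measure ℝ}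

lemma ExpMoments.integrable_id (hν : ExpMoments ν) : Integrable (fun x : ℝ => x) ν := by
  refine (hν.integrable_abs 1).mono' measurable_id.aestronglyMeasurable
    (Eventually.of_forall fun x => ?_)
  rw [Real.norm_eq_abs, one_mul]
  linarith [Real.add_one_le_exp |x|]

lemma Family.limit_nonneg (fam : Family) (b₀ β1 : ℝ) {φ : ℝ → ℝ} (hφ : ∀ x, 0 ≤ φ x) :
    0 ≤ fam.limit b₀ β1 ν φ := by
  cases fam with
  | poisson => exact integral_nonneg fun x => mul_nonneg (hφ x) (Real.exp_pos _).le
  | gamma α => exact integral_nonneg hφ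

variable [IsProbabilityMeasure ν]

/-- Without mass below the mean, `x - a` would be nonnegative with integral zero, hence zero almost
everywhere, and the law would be concentrated at `a`. -/
lemma measure_Iio_mean_pos (hν : Integrable (fun x : ℝ => x) ν)
    (hnd : ¬ ∃ a : ℝ, ∀ᵐ x ∂ν, x = a) : ν (Set.Iio (∫ x, x ∂ν)) ≠ 0 := by
  intro h0
  set a := ∫ x, x ∂ν with ha
  have h1 : ∀ᵐ x ∂ν, a ≤ x := by
    have : ∀ᵐ x ∂ν, x ∉ Set.Iio a := measure_eq_zero_iff_ae_notMem.1 h0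
    filter_upwards [this] with x hx using not_lt.1 hx
  have h2 : ∫ x, (x - a) ∂ν = 0 := by
    rw [integral_sub hν (integrable_const _)]; simp [ha]
  have hi : Integrable (fun x => x - a) ν := hν.sub (integrable_const _)
  rw [integral_eq_zero_iff_of_nonneg_ae (by
    filter_upwards [h1] with x hx using sub_nonneg.2 hx) hi] at h2
  exact hnd ⟨a, by filter_upwards [h2] with x hx using sub_eq_zero.1 hx⟩

lemma measure_Ioi_mean_pos (hν : Integrable (fun x : ℝ => x) ν)
    (hnd : ¬ ∃ a : ℝ, ∀ᵐ x ∂ν, x = a) : ν (Set.Ioi (∫ x, x ∂ν)) ≠ 0 := by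
  intro h0
  set a := ∫ x, x ∂ν with ha
  have h1 : ∀ᵐ x ∂ν, x ≤ a := by
    have : ∀ᵐ x ∂ν, x ∉ Set.Ioi a := measure_eq_zero_iff_ae_notMem.1 h0
    filter_upwards [this] with x hx using not_lt.1 hx
  have h2 : ∫ x, (a - x) ∂ν = 0 := by
    rw [integral_sub (integrable_const _) hν]; simp [ha]
  have hi : Integrable (fun x => a - x) ν := (integrable_const _).sub hν
  rw [integral_eq_zero_iff_of_nonneg_ae (by
    filter_upwards [h1] with x hx using sub_nonneg.2 hx) hi] at h2
  exact hnd ⟨a, by filter_upwards [h2] with x hx using (sub_eq_zero.1 hx).symm⟩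

/-- A nondegenerate law charges two disjoint compact intervals. -/
lemma exists_two_intervals (hν : Integrable (fun x : ℝ => x) ν)
    (hnd : ¬ ∃ a : ℝ, ∀ᵐ x ∂ν, x = a) :
    ∃ a₁ b₁ a₂ b₂ : ℝ, b₁ < a₂ ∧ 0 < ν (Set.Icc a₁ b₁) ∧ 0 < ν (Set.Icc a₂ b₂) := by
  set a := ∫ x, x ∂ν with ha
  have h1 := measure_Iio_mean_pos hν hnd
  have h2 := measure_Ioi_mean_pos hν hnd
  -- Both half-lines are exhausted by compact intervals at positive distance from the mean, so one
  -- interval on each side is charged and the two are disjoint.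
  have e1 : Set.Iio a = ⋃ k : ℕ, Set.Icc (a - (k + 1)) (a - 1 / (k + 1)) := by
    ext x
    simp only [Set.mem_Iio, Set.mem_iUnion, Set.mem_Icc]
    constructor
    · intro hx
      obtain ⟨k₁, hk₁⟩ := exists_nat_gt (a - x)
      obtain ⟨k₂, hk₂⟩ := exists_nat_one_div_lt (sub_pos.2 hx)
      have h3 : (k₁ : ℝ) ≤ (max k₁ k₂ : ℕ) := by exact_mod_cast le_max_left _ _
      have h4 : (k₂ : ℝ) ≤ (max k₁ k₂ : ℕ) := by exact_mod_cast le_max_right _ _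
      refine ⟨max k₁ k₂, by linarith, ?_⟩
      have h5 : 1 / (((max k₁ k₂ : ℕ) : ℝ) + 1) ≤ 1 / ((k₂ : ℝ) + 1) := by gcongr
      linarith
    · rintro ⟨k, -, hk⟩
      have : (0 : ℝ) < 1 / (k + 1) := by positivity
      linarith
  have e2 : Set.Ioi a = ⋃ k : ℕ, Set.Icc (a + 1 / (k + 1)) (a + (k + 1)) := by
    ext x
    simp only [Set.mem_Ioi, Set.mem_iUnion, Set.mem_Icc]
    constructor
    · intro hx
      obtain ⟨k₁, hk₁⟩ := exists_nat_gt (x - a)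
      obtain ⟨k₂, hk₂⟩ := exists_nat_one_div_lt (sub_pos.2 hx)
      have h3 : (k₁ : ℝ) ≤ (max k₁ k₂ : ℕ) := by exact_mod_cast le_max_left _ _
      have h4 : (k₂ : ℝ) ≤ (max k₁ k₂ : ℕ) := by exact_mod_cast le_max_right _ _
      have h5 : 1 / (((max k₁ k₂ : ℕ) : ℝ) + 1) ≤ 1 / ((k₂ : ℝ) + 1) := by gcongr
      exact ⟨max k₁ k₂, by linarith, by linarith⟩
    · rintro ⟨k, hk, -⟩
      have : (0 : ℝ) < 1 / (k + 1) := by positivity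
      linarith
  rw [e1] at h1
  rw [e2] at h2
  obtain ⟨k₁, hk₁⟩ : ∃ k : ℕ, ν (Set.Icc (a - (k + 1)) (a - 1 / (k + 1))) ≠ 0 := by
    by_contra! h
    exact h1 (measure_iUnion_null h)
  obtain ⟨k₂, hk₂⟩ : ∃ k : ℕ, ν (Set.Icc (a + 1 / (k + 1)) (a + (k + 1))) ≠ 0 := by
    by_contra! h
    exact h2 (measure_iUnion_null h)
  refine ⟨_, _, _, _, ?_, pos_iff_ne_zero.2 hk₁, pos_iff_ne_zero.2 hk₂⟩
  have : (0 : ℝ) < 1 / (k₁ + 1) := by positivity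
  have : (0 : ℝ) < 1 / (k₂ + 1) := by positivity
  linarith

lemma Family.limit_indicator_pos (fam : Family) (b₀ β1 : ℝ) (hν : ExpMoments ν) {a b : ℝ}
    (h : 0 < ν (Set.Icc a b)) : 0 < fam.limit b₀ β1 ν ((Set.Icc a b).indicator 1) := by
  cases fam with
  | poisson =>
    simp only [Family.limit]
    have e : ∀ x : ℝ, (Set.Icc a b).indicator (1 : ℝ → ℝ) x * Real.exp (b₀ + β1 * x) =
        (Set.Icc a b).indicator (fun x => Real.exp (b₀ + β1 * x)) x := by
      intro x
      by_cases hx : x ∈ Set.Icc a b <;> simp [hx]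
    simp_rw [e]
    have hint : Integrable (fun x => Real.exp (b₀ + β1 * x)) ν := by
      simp_rw [Real.exp_add]
      exact (hν β1).const_mul _
    rw [integral_pos_iff_support_of_nonneg (fun x => Set.indicator_nonneg
      (fun _ _ => (Real.exp_pos _).le) x) (hint.indicator measurableSet_Icc)]
    refine h.trans_le (measure_mono fun x hx => ?_)
    rw [Function.mem_support, Set.indicator_of_mem hx]
    exact (Real.exp_pos _).ne'
  | gamma α =>
    simp only [Family.limit]
    rw [integral_indicator_one measurableSet_Icc]
    exact ENNReal.toReal_pos h.ne' (measure_ne_top _ _)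

end Nondegenerate

lemma measure_lt_le_of_lintegral_le {Ω : Type*} [MeasurableSpace Ω] {P : Measure Ω} {f : Ω → ℝ}
    (hf : Measurable f) {B t : ℝ} (ht : 0 < t)
    (h : ∫⁻ ω, ENNReal.ofReal (f ω) ∂P ≤ ENNReal.ofReal B) :
    P {ω | t < f ω} ≤ ENNReal.ofReal (B / t) := by
  have h1 := meas_ge_le_lintegral_div (μ := P) hf.ennreal_ofReal.aemeasurable
    (ENNReal.ofReal_pos.2 ht).ne' ENNReal.ofReal_ne_top
  refine (measure_mono fun ω hω => ?_).trans (h1.trans ?_)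
  · exact ENNReal.ofReal_le_ofReal (le_of_lt hω)
  · rw [ENNReal.ofReal_div_of_pos ht]
    exact ENNReal.div_le_div_right h _

lemma ExpGrowth.exists_lintegral_pow_eight_le {μ : Measure ℝ} (hμ : ExpMoments μ) {φ : ℝ → ℝ}
    (h : ExpGrowth φ) : ∃ D : ℝ, 1 ≤ D ∧ ∫⁻ x, ENNReal.ofReal (φ x ^ 8) ∂μ ≤ ENNReal.ofReal D := by
  obtain ⟨A, hA, h⟩ := h
  obtain ⟨B, hB, hB'⟩ := hμ.exists_le (8 * A)
  refine ⟨Real.exp (8 * A) * Real.exp B, ?_, ?_⟩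
  · rw [← Real.exp_add]; exact Real.one_le_exp (by positivity)
  · have e : ∀ x, ENNReal.ofReal (φ x ^ 8) ≤
        ENNReal.ofReal (Real.exp (8 * A)) * ENNReal.ofReal (Real.exp (8 * A * |x|)) := by
      intro x
      rw [← ENNReal.ofReal_mul (Real.exp_pos _).le, ← Real.exp_add]
      refine ENNReal.ofReal_le_ofReal ?_
      have h1 : φ x ^ 8 = |φ x| ^ 8 := by
        rw [← abs_pow]; exact (abs_of_nonneg (by positivity)).symm
      have h2 : |φ x| ^ 8 ≤ Real.exp (A * (1 + |x|)) ^ 8 := by gcongr; exact h x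
      rw [h1]
      refine h2.trans (le_of_eq ?_)
      rw [← Real.exp_nat_mul]
      congr 1; push_cast; ring
    refine (lintegral_mono e).trans ?_
    rw [lintegral_const_mul _ (by fun_prop), ENNReal.ofReal_mul (Real.exp_pos _).le]
    exact mul_le_mul_right hB' _

/-- Sums of independent centered variables are of the order of the square root of their number. -/
lemma exists_measure_sum_le {μ : Measure ℝ} [IsProbabilityMeasure μ] (hμ : ExpMoments μ)
    {φ : ℝ → ℝ} (hφ : Measurable φ) (hg : ExpGrowth φ) (h0 : ∫ x, φ x ∂μ = 0) :
    ∃ B : ℝ, 0 ≤ B ∧ ∀ (M : ℕ) (K : ℝ), 0 < M → 1 ≤ K →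
      (Measure.pi fun _ : Fin M => μ) {z | K * √M < |∑ i, φ (z i)|} ≤ ENNReal.ofReal (B / K) := by
  obtain ⟨D, hD, h8⟩ := hg.exists_lintegral_pow_eight_le hμ
  refine ⟨(494 * D) ^ 4, by positivity, fun M K hM hK => ?_⟩
  have hM0 : (0 : ℝ) < M := by exact_mod_cast hM
  have hmeas : Measurable fun z : Fin M → ℝ => (∑ i, φ (z i)) ^ 8 :=
    (Finset.measurable_sum _ fun i _ => hφ.comp (measurable_pi_apply i)).pow_const 8
  have h1 := measure_lt_le_of_lintegral_le (P := Measure.pi fun _ : Fin M => μ) hmeas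
    (t := K * M ^ 4) (by positivity) (lintegral_pi_sum_pow_eight_le hφ D hD h8 h0 M)
  refine (measure_mono fun z hz => ?_).trans (h1.trans (ENNReal.ofReal_le_ofReal (le_of_eq ?_)))
  · have hz : K * √M < |∑ i, φ (z i)| := hz
    have h2 : (K * √M) ^ 8 < |∑ i, φ (z i)| ^ 8 := by gcongr
    have h3 : |∑ i, φ (z i)| ^ 8 = (∑ i, φ (z i)) ^ 8 := by
      rw [← abs_pow]; exact abs_of_nonneg (by positivity)
    have h4 : (K * √M) ^ 8 = K ^ 8 * M ^ 4 := by
      rw [mul_pow, show (√(M : ℝ)) ^ 8 = ((√(M : ℝ)) ^ 2) ^ 4 by ring, Real.sq_sqrt hM0.le]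
    have h5 : K * (M : ℝ) ^ 4 ≤ K ^ 8 * M ^ 4 := by
      gcongr; exact le_self_pow₀ hK (by norm_num)
    show K * (M : ℝ) ^ 4 < (∑ i, φ (z i)) ^ 8
    rw [h4, h3] at h2
    linarith
  · field_simp

lemma integral_sq_gaussianReal {s : ℝ} (hs : 0 < s) :
    ∫ x, (x ^ 2 - s) ∂(gaussianReal 0 s.toNNReal) = 0 := by
  have h1 := variance_id_gaussianReal (μ := 0) (v := s.toNNReal)
  have hi : MemLp id 2 (gaussianReal 0 s.toNNReal) := memLp_id_gaussianReal 2
  rw [variance_of_integral_eq_zero measurable_id.aemeasurable (by simp)] at h1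
  have h2 : Integrable (fun x : ℝ => x ^ 2) (gaussianReal 0 s.toNNReal) := hi.integrable_sq
  rw [integral_sub h2 (integrable_const _)]
  simp only [id] at h1
  rw [h1]
  simp [hs.le]


/-! ### Control of one side with high probability -/

lemma Family.rowError_nonneg (fam : Family) (b₀ β1 : ℝ) (ν : Measure ℝ) (a₁ b₁ a₂ b₂ : ℝ)
    {N : ℕ} (u : ℝ) (z : Fin N → ℝ × ℝ) : 0 ≤ fam.rowError b₀ β1 ν a₁ b₁ a₂ b₂ u z := by
  unfold Family.rowError
  positivity

lemma expGrowth_sq_sub (s : ℝ) : ExpGrowth fun x => x ^ 2 - s := by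
  refine ⟨2 + |s|, by positivity, fun x => ?_⟩
  have hx := abs_nonneg x
  have hs := abs_nonneg s
  have h1 := Real.quadratic_le_exp_of_nonneg (x := (2 + |s|) * (1 + |x|)) (by positivity)
  have h2 : |x ^ 2 - s| ≤ |x| ^ 2 + |s| := (abs_sub _ _).trans (by rw [abs_pow])
  have h3 : (2 * |x|) ^ 2 ≤ ((2 + |s|) * (1 + |x|)) ^ 2 := by
    gcongr
    · linarith
    · linarith
  have h4 : |s| ≤ (2 + |s|) * (1 + |x|) := by nlinarith [mul_nonneg hs hx]
  nlinarith [sq_nonneg |x|]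

/-- Markov's inequality for the sum. Only expectations are added, so no independence between the
rows is required. -/
lemma measure_sum_lt_le {Ω : Type*} [MeasurableSpace Ω] {P : Measure Ω} {M : ℕ}
    {f : Fin M → Ω → ℝ} (hf : ∀ i, Measurable (f i)) (h0 : ∀ i ω, 0 ≤ f i ω) {A K : ℝ}
    (h : ∀ i, ∫⁻ ω, ENNReal.ofReal (f i ω) ∂P ≤ ENNReal.ofReal A) (hM : 0 < M) (hK : 0 < K) :
    P {ω | K * M < ∑ i, f i ω} ≤ ENNReal.ofReal (A / K) := by
  have hM0 : (0 : ℝ) < M := by exact_mod_cast hM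
  refine (measure_lt_le_of_lintegral_le (B := M * A)
    (Finset.measurable_sum _ fun i _ => hf i) (by positivity) ?_).trans_eq ?_
  · rw [lintegral_congr fun ω => ENNReal.ofReal_sum_of_nonneg fun i _ => h0 i ω,
      lintegral_finsetSum _ fun i _ => (hf i).ennreal_ofReal,
      ENNReal.ofReal_mul hM0.le, ENNReal.ofReal_natCast]
    exact (Finset.sum_le_sum fun i _ => h i).trans_eq (by simp)
  · congr 1
    field_simp

section Side

variable {fam : Family} {ν : Measure ℝ} {Ω : Type*} [MeasurableSpace Ω] {P : Measure Ω}
  {M N : ℕ} {x y : Fin M → Fin N → Ω → ℝ} {u : Fin M → Ω → ℝ} {A K : ℝ}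

lemma measure_sum_rowError_le {ρ : Measure (ℝ × (Fin N → ℝ × ℝ))} (b₀ β1 a₁ b₁ a₂ b₂ : ℝ)
    (hx : ∀ i j, Measurable (x i j)) (hu : ∀ i, Measurable (u i)) (hy : ∀ i j, Measurable (y i j))
    (hlaw : ∀ i, P.map (fun ω => (u i ω, fun j => (x i j ω, y i j ω))) = ρ)
    (hρ : ∫⁻ q, ENNReal.ofReal (fam.rowError b₀ β1 ν a₁ b₁ a₂ b₂ q.1 q.2) ∂ρ ≤ ENNReal.ofReal A)
    (hM : 0 < M) (hK : 0 < K) :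
    P {ω | K * M < ∑ i, fam.rowError b₀ β1 ν a₁ b₁ a₂ b₂ (u i ω) fun j => (x i j ω, y i j ω)} ≤
      ENNReal.ofReal (A / K) := by
  have hzm : ∀ i, Measurable fun ω => (u i ω, fun j => (x i j ω, y i j ω)) := fun i =>
    (hu i).prodMk (measurable_pi_lambda _ fun j => (hx i j).prodMk (hy i j))
  have hem := measurable_rowError fam b₀ β1 ν a₁ b₁ a₂ b₂ N
  refine measure_sum_lt_le (fun i => hem.comp (hzm i))
    (fun i ω => fam.rowError_nonneg b₀ β1 ν a₁ b₁ a₂ b₂ _ _) (fun i => ?_) hM hK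
  rw [← hlaw i, lintegral_map hem.ennreal_ofReal (hzm i)] at hρ
  exact hρ

lemma measure_sum_le_of_map_eq {γ : Measure ℝ} (hu : ∀ i, Measurable (u i))
    (hlaw : P.map (fun ω i => u i ω) = Measure.pi fun _ : Fin M => γ) {φ : ℝ → ℝ}
    (hφ : Measurable φ) {t B : ℝ}
    (h : (Measure.pi fun _ : Fin M => γ) {z | t < |∑ i, φ (z i)|} ≤ ENNReal.ofReal B) :
    P {ω | t < |∑ i, φ (u i ω)|} ≤ ENNReal.ofReal B := by
  rw [← hlaw, Measure.map_apply (measurable_pi_lambda _ hu)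
    (measurableSet_lt measurable_const (by fun_prop))] at h
  exact h

end Side

/-- With probability close to one, one side of the array is controlled. -/
theorem exists_sideControl {fam : Family} {F : ℝ → unitInterval → ℝ} {ν : Measure ℝ}
    [IsProbabilityMeasure ν] (hfam : fam.Admissible) (hF : IsSampler fam F) (hν : ExpMoments ν)
    (hnd : ¬ ∃ a : ℝ, ∀ᵐ x ∂ν, x = a) (b β1 : ℝ) {s s' : ℝ} (hs : 0 < s) (hs' : 0 < s') :
    ∃ c C : ℝ, 0 < c ∧ c ≤ 1 ∧ 0 < C ∧ ∃ N₀ : ℕ, ∀ ε : ℝ, 0 < ε → ∃ K : ℝ, 1 ≤ K ∧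
      ∀ M N : ℕ, 0 < M → 0 < N → N₀ ≤ N → ∀ (Ω : Type*) [MeasurableSpace Ω] (P : Measure Ω)
        (x : Fin M → Fin N → Ω → ℝ) (u : Fin M → Ω → ℝ) (y : Fin M → Fin N → Ω → ℝ),
        (∀ i j, Measurable (x i j)) → (∀ i, Measurable (u i)) → (∀ i j, Measurable (y i j)) →
        (∀ i, P.map (fun ω => (u i ω, fun j => (x i j ω, y i j ω))) =
          rowLaw F b β1 ν (gaussianReal 0 s.toNNReal) (gaussianReal 0 s'.toNNReal) N) →
        P.map (fun ω i => u i ω) = (Measure.pi fun _ : Fin M => gaussianReal 0 s.toNNReal) →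
        (∀ᵐ ω ∂P, ∀ i j, y i j ω ∈ fam.support) →
        P {ω | ¬ ∃ R, SideControl c C K s N (fam.fits (fun i j => x i j ω) (fun i j => y i j ω)
          (b + s' / 2) β1 fun i => u i ω) (fun i => u i ω) R} ≤ ENNReal.ofReal ε := by
  obtain ⟨a₁, b₁, a₂, b₂, hab, h₁, h₂⟩ := exists_two_intervals hν.integrable_id hnd
  set b₀ := b + s' / 2 with hb₀
  obtain ⟨c, C, hc, hc1, hC, N₀, hfit⟩ := exists_fitControl a₁ b₁ a₂ b₂ _ _
    (fam.limit b₀ β1 ν fun x => 1 + x ^ 2 * Real.exp |x|) hab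
    (fam.limit_indicator_pos b₀ β1 hν h₁) (fam.limit_indicator_pos b₀ β1 hν h₂)
    (fam.limit_nonneg b₀ β1 fun x => by positivity)
  -- Only `K` depends on `ε`: the row constants hold for all data, and the probability enters
  -- through the size of the remainders and of the empirical moments.
  refine ⟨c, C, hc, hc1, hC, N₀, fun ε hε => ?_⟩
  -- The lognormal mean `exp (s' / 2)`, source of the shift by half the variance of the opposite
  -- effect.
  have hb : ∫ v, Real.exp v ∂(gaussianReal 0 s'.toNNReal) = Real.exp (b₀ - b) := by
    have h := integral_exp_gaussian 0 s' hs' 1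
    simp only [one_mul, one_pow, mul_one, zero_add] at h
    rw [h, hb₀, add_sub_cancel_left]
  obtain ⟨A, hA, hrow⟩ := exists_lintegral_rowLaw_le hfam hF b b₀ β1 hν
    (expMoments_gaussianReal s.toNNReal) (expMoments_gaussianReal s'.toNNReal) hb a₁ b₁ a₂ b₂
  obtain ⟨B₁, hB₁, hsum⟩ := exists_measure_sum_le (expMoments_gaussianReal s.toNNReal)
    (φ := fun x => x) measurable_id expGrowth_id (by simp)
  obtain ⟨B₂, hB₂, hsq⟩ := exists_measure_sum_le (expMoments_gaussianReal s.toNNReal)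
    (φ := fun x => x ^ 2 - s) (by fun_prop) (expGrowth_sq_sub s) (integral_sq_gaussianReal hs)
  -- The exceptional events for the remainders, the first and the second moment have probabilities
  -- at most `A / K`, `B₁ / K` and `B₂ / K`.
  refine ⟨max 1 ((A + B₁ + B₂) / ε), le_max_left _ _, ?_⟩
  set K := max 1 ((A + B₁ + B₂) / ε) with hK
  have hK1 : 1 ≤ K := le_max_left _ _
  have hK0 : 0 < K := by linarith
  have hKε : A / K + B₁ / K + B₂ / K ≤ ε := by
    rw [← add_div, ← add_div, div_le_iff₀ hK0, ← div_le_iff₀' hε]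
    exact le_max_right _ _
  intro M N hM hN hN₀ Ω _ P x u y hx hu hy hlaw hulaw hsupp
  have e0 : P {ω | ¬ ∀ i j, y i j ω ∈ fam.support} = 0 := hsupp
  have e1 := measure_sum_rowError_le b₀ β1 a₁ b₁ a₂ b₂ hx hu hy hlaw (hrow N hN) hM hK0
  have e2 := measure_sum_le_of_map_eq hu hulaw measurable_id (hsum M K hM hK1)
  have e3 := measure_sum_le_of_map_eq hu hulaw (φ := fun x => x ^ 2 - s) (by fun_prop)
    (hsq M K hM hK1)
  have hsub : {ω | ¬ ∃ R, SideControl c C K s N (fam.fits (fun i j => x i j ω)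
      (fun i j => y i j ω) b₀ β1 fun i => u i ω) (fun i => u i ω) R} ⊆
      {ω | ¬ ∀ i j, y i j ω ∈ fam.support} ∪ ({ω | K * M < ∑ i, fam.rowError b₀ β1 ν a₁ b₁ a₂ b₂ (u i ω)
        fun j => (x i j ω, y i j ω)} ∪
        {ω | K * √M < |∑ i, u i ω|} ∪ {ω | K * √M < |∑ i, (u i ω ^ 2 - s)|}) := by
    intro ω hω
    by_contra hn
    simp only [Set.mem_union, Set.mem_ofPred_eq, not_or, not_not, not_lt] at hn
    obtain ⟨n0, ⟨n1, n2⟩, n3⟩ := hn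
    exact hω ⟨_, fun i => hfit N hN₀ _ _ _ _ _ _ _
      (Family.rowData b₀ β1 ν a₁ b₁ a₂ b₂ hN (u i ω) (fun j => (x i j ω, y i j ω)) fun j => n0 i j), n1, n2, n3⟩
  refine (measure_mono hsub).trans ((measure_union_le _ _).trans ?_)
  rw [e0, zero_add]
  refine (measure_union_le _ _).trans ((add_le_add_left (measure_union_le _ _) _).trans ?_)
  refine (add_le_add (add_le_add e1 e2) e3).trans ?_
  rw [← ENNReal.ofReal_add (by positivity) (by positivity),
    ← ENNReal.ofReal_add (by positivity) (by positivity)]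
  exact ENNReal.ofReal_le_ofReal hKε


/-! ### Both sides with high probability, and the passage to the `O_p` statement -/

section Laws

variable {fam : Family} {β0 β1 σu2 σv2 : ℝ} {ν : Measure ℝ} [IsProbabilityMeasure ν] {m n : ℕ}
  {Ω : Type*} [MeasurableSpace Ω] {P : Measure Ω}
  {X : Fin m → Fin n → Ω → ℝ} {U : Fin m → Ω → ℝ} {V : Fin n → Ω → ℝ} {Y : Fin m → Fin n → Ω → ℝ}

lemma IsCrossedSample.map_rowEffects (h : IsCrossedSample fam β0 β1 σu2 σv2 ν P X U V Y) :
    P.map (fun ω i => U i ω) = Measure.pi fun _ : Fin m => gaussianReal 0 σu2.toNNReal := by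
  have e := congrArg (Measure.map fun q : (Fin m → Fin n → ℝ) × (Fin m → ℝ) × (Fin n → ℝ) => q.2.1)
    h.latent_law
  rw [Measure.map_map (by fun_prop) h.measurable_latent] at e
  refine e.trans ?_
  exact (measurePreserving_fst.comp measurePreserving_snd).map_eq

lemma IsCrossedSample.map_columnEffects (h : IsCrossedSample fam β0 β1 σu2 σv2 ν P X U V Y) :
    P.map (fun ω j => V j ω) = Measure.pi fun _ : Fin n => gaussianReal 0 σv2.toNNReal := by
  have e := congrArg (Measure.map fun q : (Fin m → Fin n → ℝ) × (Fin m → ℝ) × (Fin n → ℝ) => q.2.2)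
    h.latent_law
  rw [Measure.map_map (by fun_prop) h.measurable_latent] at e
  refine e.trans ?_
  exact (measurePreserving_snd.comp measurePreserving_snd).map_eq

end Laws

/-- With probability close to one, the bound has global maximizers, and all of them are within the
rate of the limit parameter. -/
theorem exists_measure_not_rate_le {fam : Family} (hfam : fam.Admissible) {κ : ℝ} (hκ : 0 < κ)
    (β0 β1 : ℝ) {σu2 σv2 : ℝ} (hσu : 0 < σu2) (hσv : 0 < σv2) {ν : Measure ℝ}
    [IsProbabilityMeasure ν] (hν : ExpMoments ν) (hnd : ¬ ∃ a : ℝ, ∀ᵐ x ∂ν, x = a)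
    {Θ : Set RowColParam} (hΘ : ContainsNhd Θ ⟨β0 + σv2 / 2, β0 + σu2 / 2, β1, σu2, σv2⟩)
    {c₀ : ℝ} (hc₀ : 0 < c₀) {ε : ℝ} (hε : 0 < ε) :
    ∃ D : ℝ, 0 < D ∧ ∃ N₀ : ℕ, ∀ m n : ℕ, N₀ ≤ m → N₀ ≤ n → c₀ * n ≤ m →
      ∀ (Ω : Type*) [MeasurableSpace Ω] (P : Measure Ω) [IsProbabilityMeasure P]
        (X : Fin m → Fin n → Ω → ℝ) (U : Fin m → Ω → ℝ) (V : Fin n → Ω → ℝ)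
        (Y : Fin m → Fin n → Ω → ℝ), IsCrossedSample fam β0 β1 σu2 σv2 ν P X U V Y →
        P {ω | ¬ ((∃ p, IsMaximizer fam κ Θ (fun i j => X i j ω) (fun i j => Y i j ω) p) ∧
          ∀ p, IsMaximizer fam κ Θ (fun i j => X i j ω) (fun i j => Y i j ω) p →
            InBox (D * (1 / √m + 1 / √n)) ⟨β0 + σv2 / 2, β0 + σu2 / 2, β1, σu2, σv2⟩ p.1)} ≤
          ENNReal.ofReal ε := by
  obtain ⟨F, hF⟩ := fam.exists_isSampler hfam
  obtain ⟨c₁, C₁, hc₁, hc₁', hC₁, N₁, h₁⟩ := exists_sideControl hfam hF hν hnd β0 β1 hσu hσv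
  obtain ⟨c₂, C₂, hc₂, hc₂', hC₂, N₂, h₂⟩ := exists_sideControl hfam hF hν hnd β0 β1 hσv hσu
  obtain ⟨K₁, hK₁, h₁⟩ := h₁ (ε / 2) (by positivity)
  obtain ⟨K₂, hK₂, h₂⟩ := h₂ (ε / 2) (by positivity)
  obtain ⟨D, hD, N₃, hrate⟩ := exists_maximizer_rate fam κ hκ
    ⟨β0 + σv2 / 2, β0 + σu2 / 2, β1, σu2, σv2⟩ hσu hσv Θ hΘ (min c₁ c₂) (max C₁ C₂) (max K₁ K₂) c₀
    (lt_min hc₁ hc₂) ((min_le_left _ _).trans hc₁') (hC₁.trans_le (le_max_left _ _))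
    (hK₁.trans (le_max_left _ _)) hc₀
  refine ⟨D, hD, N₁ + N₂ + N₃ + 1, fun m n hm hn hmn Ω _ P _ X U V Y h => ?_⟩
  have hsupp := h.ae_mem_support hfam
  have e1 := h₁ m n (by omega) (by omega) (by omega) Ω P X U Y h.measurable_X h.measurable_U
    h.measurable_Y (h.map_row hF) h.map_rowEffects hsupp
  -- Columns are the rows of the transposed array, with the two variances exchanged; the two events
  -- need not be independent, since a union bound suffices.
  have e2 := h₂ n m (by omega) (by omega) (by omega) Ω P (fun j i => X i j) V (fun j i => Y i j)
    (fun j i => h.measurable_X i j) h.measurable_V (fun j i => h.measurable_Y i j)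
    (h.map_column hF) h.map_columnEffects (hsupp.mono fun ω hω j i => hω i j)
  have e0 : P {ω | ¬ ∀ i j, Y i j ω ∈ fam.support} = 0 := hsupp
  have e3 := (measure_union_le _ _).trans (add_le_add e1 e2)
  rw [← ENNReal.ofReal_add (by positivity) (by positivity), add_halves] at e3
  refine (measure_mono ?_).trans ((measure_union_le _ _).trans (add_le_add e0.le e3)) |>.trans_eq
    (zero_add _)
  intro ω hω
  by_contra hbad
  simp only [Set.mem_union, Set.mem_ofPred_eq, not_or, not_not] at hbad
  obtain ⟨g0, ⟨R₁, g1⟩, ⟨R₂, g2⟩⟩ := hbad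
  exact hω (hrate m n (by omega) (by omega) hmn _ _ _ R₁ _ R₂
    (fun i j => Family.nonneg_of_mem_support (g0 i j))
    (g1.mono (min_le_left _ _) (le_max_left _ _) (le_max_left _ _))
    (g2.mono (min_le_right _ _) (le_max_right _ _) (le_max_right _ _)))

lemma one_div_sqrt_eq_rpow (k : ℕ) : 1 / √(k : ℝ) = (k : ℝ) ^ (-(1 / 2) : ℝ) := by
  rw [Real.rpow_neg k.cast_nonneg, Real.sqrt_eq_rpow, one_div]

/-- A sequence of quantities that, with probability close to one, are bounded by multiples of the
rate is of the order of the rate. -/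
lemma IsBigOP.of_eventually {Ω : ℕ → Type*} [∀ k, MeasurableSpace (Ω k)] {P : ∀ k, Measure (Ω k)}
    {Z : ∀ k, Ω k → ℝ} {r : ℕ → ℝ} {good : ℝ → ∀ k, Ω k → Prop}
    (h : ∀ ε : ℝ, 0 < ε → ∃ D : ℝ, ∀ᶠ k in atTop, P k {ω | ¬ good D k ω} ≤ ENNReal.ofReal ε)
    {a : ℝ} (hg : ∀ D k, ∀ᵐ ω ∂P k, good D k ω → |Z k ω| ≤ a * (D * r k)) : IsBigOP P Z r := by
  intro ε hε
  obtain ⟨D, hD⟩ := h ε hε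
  refine ⟨a * D, hD.mono fun k hk => (measure_mono_ae ?_).trans hk⟩
  filter_upwards [hg D k] with ω hω hlt hgood
  have hlt : a * D * r k < |Z k ω| := hlt
  linarith [hω hgood]

end CrossedGVA

open CrossedGVA in
theorem theorem1
    -- the response family and the factor in front of the likelihood part of the bound
    (fam : Family) (hfam : fam.Admissible) (κ : ℝ) (hκ : 0 < κ)
    -- the true parameter values
    (β0 β1 σu2 σv2 : ℝ) (hσu : 0 < σu2) (hσv : 0 < σv2)
    -- the law of the covariate: all exponential moments are finite, and it is not degenerate
    (ν : Measure ℝ) [IsProbabilityMeasure ν]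
    (hmgf : ∀ t : ℝ, Integrable (fun x => Real.exp (t * x)) ν)
    (hnd : ¬ ∃ a : ℝ, ∀ᵐ x ∂ν, x = a)
    -- the parameter set over which the bound is maximized
    (Θ : Set RowColParam)
    (hΘ : ContainsNhd Θ ⟨β0 + σv2 / 2, β0 + σu2 / 2, β1, σu2, σv2⟩)
    -- the numbers of rows and columns diverge, and their ratio is bounded away from zero
    (m n : ℕ → ℕ) (hm : Tendsto m atTop atTop) (hn : Tendsto n atTop atTop)
    (c : ℝ) (hc : 0 < c) (hmn : ∀ᶠ k in atTop, c ≤ (m k : ℝ) / (n k : ℝ))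
    -- the data
    (Ω : ℕ → Type*) [∀ k, MeasurableSpace (Ω k)] (P : ∀ k, Measure (Ω k))
    [∀ k, IsProbabilityMeasure (P k)]
    (X : ∀ k, Fin (m k) → Fin (n k) → Ω k → ℝ) (U : ∀ k, Fin (m k) → Ω k → ℝ)
    (V : ∀ k, Fin (n k) → Ω k → ℝ) (Y : ∀ k, Fin (m k) → Fin (n k) → Ω k → ℝ)
    (hdata : ∀ k, IsCrossedSample fam β0 β1 σu2 σv2 ν (P k) (X k) (U k) (V k) (Y k))
    -- the estimator, which is part of a global maximizer whenever there is one
    (ψhat : ∀ k, Ω k → RowColParam)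
    (hψhat : ∀ k, ∀ᵐ ω ∂(P k),
      (∃ p, IsMaximizer fam κ Θ (fun i j => X k i j ω) (fun i j => Y k i j ω) p) →
        ∃ ξ, IsMaximizer fam κ Θ (fun i j => X k i j ω) (fun i j => Y k i j ω) (ψhat k ω, ξ)) :
    Tendsto (fun k => P k {ω | ¬ ∃ p,
        IsMaximizer fam κ Θ (fun i j => X k i j ω) (fun i j => Y k i j ω) p}) atTop (𝓝 0) ∧
    IsBigOP P (fun k ω => (ψhat k ω).β0 - β0)
      (fun k => (m k : ℝ) ^ (-(1 / 2) : ℝ) + (n k : ℝ) ^ (-(1 / 2) : ℝ)) ∧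
    IsBigOP P (fun k ω => (ψhat k ω).β1 - β1)
      (fun k => (m k : ℝ) ^ (-(1 / 2) : ℝ) + (n k : ℝ) ^ (-(1 / 2) : ℝ)) ∧
    IsBigOP P (fun k ω => (ψhat k ω).σu2 - σu2)
      (fun k => (m k : ℝ) ^ (-(1 / 2) : ℝ) + (n k : ℝ) ^ (-(1 / 2) : ℝ)) ∧
    IsBigOP P (fun k ω => (ψhat k ω).σv2 - σv2)
      (fun k => (m k : ℝ) ^ (-(1 / 2) : ℝ) + (n k : ℝ) ^ (-(1 / 2) : ℝ)) := by
  let ψ : RowColParam := ⟨β0 + σv2 / 2, β0 + σu2 / 2, β1, σu2, σv2⟩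
  let r : ℕ → ℝ := fun k => (m k : ℝ) ^ (-(1 / 2) : ℝ) + (n k : ℝ) ^ (-(1 / 2) : ℝ)
  let good : ℝ → ∀ k, Ω k → Prop := fun D k ω =>
    (∃ p, IsMaximizer fam κ Θ (fun i j => X k i j ω) (fun i j => Y k i j ω) p) ∧
      ∀ p, IsMaximizer fam κ Θ (fun i j => X k i j ω) (fun i j => Y k i j ω) p →
        InBox (D * r k) ψ p.1
  have hgood : ∀ ε : ℝ, 0 < ε → ∃ D : ℝ, ∀ᶠ k in atTop,
      P k {ω | ¬ good D k ω} ≤ ENNReal.ofReal ε := by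
    intro ε hε
    obtain ⟨D, -, N₀, h⟩ :=
      exists_measure_not_rate_le hfam hκ β0 β1 hσu hσv hmgf hnd hΘ hc hε
    refine ⟨D, ?_⟩
    -- Positivity of `n k` is needed to read the bound on the ratio as `c * n k ≤ m k`.
    filter_upwards [hm.eventually_ge_atTop N₀, hn.eventually_ge_atTop N₀,
      hn.eventually_gt_atTop 0, hmn] with k h1 h2 h3 h4
    have h3 : (0 : ℝ) < n k := by exact_mod_cast h3
    have := h (m k) (n k) h1 h2 ((le_div_iff₀ h3).1 h4) (Ω k) (P k) _ _ _ _ (hdata k)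
    simpa only [one_div_sqrt_eq_rpow] using this
  have hbox : ∀ D k, ∀ᵐ ω ∂P k, good D k ω → InBox (D * r k) ψ (ψhat k ω) := by
    intro D k
    filter_upwards [hψhat k] with ω hω hg
    obtain ⟨ξ, hξ⟩ := hω hg.1
    exact hg.2 _ hξ
  have hβ0 : ψ.β0 = β0 := by
    simp only [ψ, RowColParam.β0]
    ring
  -- The combination defining the intercept has error at most `3 / 2` of the box radius, for which
  -- `InBox.β0_le` gives the factor two; the other components are coordinates of the box.
  refine ⟨?_, IsBigOP.of_eventually hgood (a := 2) ?_, IsBigOP.of_eventually hgood (a := 1) ?_,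
    IsBigOP.of_eventually hgood (a := 1) ?_, IsBigOP.of_eventually hgood (a := 1) ?_⟩
  · refine ENNReal.tendsto_nhds_zero.2 fun ε hε => ?_
    obtain ⟨δ, hδ, hδε⟩ : ∃ δ : ℝ, 0 < δ ∧ ENNReal.ofReal δ ≤ ε := by
      obtain ⟨δ, hδ, hδε⟩ := ENNReal.lt_iff_exists_nnreal_btwn.1 hε
      exact ⟨δ, by simpa using hδ, by simpa using hδε.le⟩
    obtain ⟨D, hD⟩ := hgood δ hδ
    refine hD.mono fun k hk => (measure_mono ?_).trans (hk.trans hδε)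
    exact fun ω hω (hg : good D k ω) => absurd hg.1 hω
  · intro D k
    filter_upwards [hbox D k] with ω hω hg
    simpa only [hβ0] using (hω hg).β0_le
  · intro D k
    filter_upwards [hbox D k] with ω hω hg
    rw [one_mul]
    exact (hω hg).2.2.1
  · intro D k
    filter_upwards [hbox D k] with ω hω hg
    rw [one_mul]
    exact (hω hg).2.2.2.1
  · intro D k
    filter_upwards [hbox D k] with ω hω hg
    rw [one_mul]
    exact (hω hg).2.2.2.2
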